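/- Let $\Gamma$ be the free group on a finite set $S$ with $|S|=r$. For every $n$ let $(\pi_n(s))_{s\in S}$ be independent Haar-distributed random matrices in the unitary group $\mathrm{U}(n)$, and let $\pi_n:\Gamma\to\mathrm{U}(n)$ be the resulting random unitary representation. A positive definite map $\phi:\Gamma\to\mathrm{M}_k(\mathbf{C})$ is a bounded map such that $\sum_{i,j}\sum_{g,h}\overline{a_{i}(h)}\,a_{j}(g)\,\phi_{ij}(h^{-1}g)\ge 0$ for all finitely supported $a_1,\dots,a_k:\Gamma\to\mathbf{C}$; the set of these maps carries the weak$^*$ topology of $\ell^\infty(\Gamma;\mathrm{M}_k)$. For such $\phi$, the annealed almost periodic entropy is $$\mathrm{h}^{\mathrm{ann}}(\phi) := \inf_O\limsup_{n\to\infty}\frac1n\log\mathbf{E}\,\frac{\mathrm{vol}_{2kn}\{(v_1,\dots,v_k)\in(\mathbf{C}^n)^k:\ (g\mapsto[\langle\pi_n(g)v_j,v_i\rangle]_{i,j=1}^k)\in O\}}{v(n)^k},$$ where $O$ ranges over the neighbourhoods of $\phi$ in the space of positive definite maps, $v(n)=\pi^n/n!$ is the volume of the unit ball of $\mathbf{C}^n$,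 and $\log 0=-\infty$. For a finite set $F\subset\Gamma$ let $\phi[F]$ be the positive semidefinite block matrix $[\phi(g^{-1}h)]_{g,h\in F}$, and let $B_n$ be the set of elements of $\Gamma$ of word length at most $n$ with respect to $S\cup S^{-1}$. Then, for every positive definite map $\phi:\Gamma\to\mathrm{M}_k(\mathbf{C})$, the value $\mathrm{h}^{\mathrm{ann}}(\phi)$ lies in $[-\infty,\infty)$, and it is equal to both $$\lim_{n\to\infty}\Big(\log\det\phi[B_n]-\sum_{s\in S}\log\det\phi[B_n\cap sB_n]\Big)$$ and $$\lim_{n\to\infty}\Big(\sum_{s\in S}\log\det\phi[B_n\cup sB_n]-(2r-1)\log\det\phi[B_n]\Big),$$ where each expression in parentheses is interpreted as $-\infty$ if any of the determinants appearing in it is $0$. In particular both limits exist in $[-\infty,\infty)$. -/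

import Mathlib

open MeasureTheory ProbabilityTheory Filter Topology
open scoped ENNReal ComplexOrder Pointwise

/-- Positive definite maps `φ : Γ → M_k(ℂ)` on a group `Γ`: bounded maps such that
`∑ i j, ∑ h g, conj (a i h) * a j g * φ (h⁻¹ * g) i j ≥ 0` (in particular, this complex number is
real) for all finitely supported `a 1, …, a k : Γ → ℂ`. -/
@[ext]
structure PosDefMap (Γ : Type*) [Group Γ] (k : ℕ) where
  /-- The underlying map. -/
  toFun : Γ → Matrix (Fin k) (Fin k) ℂ
  bounded : ∃ C : ℝ, ∀ g i j, ‖toFun g i j‖ ≤ C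
  nonneg : ∀ a : Fin k → Γ →₀ ℂ,
    0 ≤ ∑ i, ∑ j, (a i).sum fun h x => (a j).sum fun g y =>
      star x * y * toFun (h⁻¹ * g) i j

namespace PosDefMap

instance {Γ : Type*} [Group Γ] {k : ℕ} :
    CoeFun (PosDefMap Γ k) (fun _ => Γ → Matrix (Fin k) (Fin k) ℂ) := ⟨PosDefMap.toFun⟩

/-- The space of positive definite maps carries the weak-star topology of `ℓ^∞(Γ; M_k)`, as the
dual of `ℓ¹`: the coarsest topology for which `ψ ↦ ∑ g, f g * ψ g i j` is continuous for all
absolutely summable `f : Γ → ℂ` and all `i`, `j`. -/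
noncomputable instance {Γ : Type*} [Group Γ] {k : ℕ} : TopologicalSpace (PosDefMap Γ k) :=
  TopologicalSpace.induced
    (fun (ψ : PosDefMap Γ k)
        (p : {f : Γ → ℂ // Summable fun g => ‖f g‖} × Fin k × Fin k) =>
      ∑' g, p.1.1 g * ψ g p.2.1 p.2.2)
    Pi.topologicalSpace

/-- The finite block matrix `φ[F]`, with block `φ (g⁻¹ * h)` at position `(g, h)`. -/
def gram {Γ : Type*} [Group Γ] {k : ℕ} (φ : PosDefMap Γ k) (F : Finset Γ) :
    Matrix (F × Fin k) (F × Fin k) ℂ :=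
  Matrix.of fun p q => φ ((p.1 : Γ)⁻¹ * (q.1 : Γ)) p.2 q.2

/-- The determinant of the positive semidefinite matrix `φ[F]`, as a real number. -/
noncomputable def gramDet {Γ : Type*} [Group Γ] [DecidableEq Γ] {k : ℕ}
    (φ : PosDefMap Γ k) (F : Finset Γ) : ℝ :=
  (φ.gram F).det.re

end PosDefMap

section Types

variable {Γ : Type*} [Group Γ] {k n : ℕ}

/-- For an `n`-dimensional unitary representation `π` of `Γ` and vectors `v 1, …, v k` in `ℂⁿ`,
the matrix `[⟨π(g) v j, v i⟩]` of matrix elements (inner products are linear in the first entry). -/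
def matrixElements (π : Γ →* Matrix.unitaryGroup (Fin n) ℂ) (v : Fin k → Fin n → ℂ) (g : Γ) :
    Matrix (Fin k) (Fin k) ℂ :=
  Matrix.of fun i j => star (v i) ⬝ᵥ ((π g : Matrix (Fin n) (Fin n) ℂ).mulVec (v j))

theorem matrixElements_bounded (π : Γ →* Matrix.unitaryGroup (Fin n) ℂ)
    (v : Fin k → Fin n → ℂ) : ∃ C : ℝ, ∀ g i j, ‖matrixElements π v g i j‖ ≤ C := by
  refine ⟨∑ i, ∑ j, ∑ a, ∑ b, ‖v i a‖ * ‖v j b‖, fun g i j => ?_⟩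
  have h1 : ‖matrixElements π v g i j‖ ≤ ∑ a, ∑ b, ‖v i a‖ * ‖v j b‖ := by
    simp only [matrixElements, Matrix.of_apply, dotProduct, Matrix.mulVec]
    refine (norm_sum_le _ _).trans (Finset.sum_le_sum fun a _ => ?_)
    rw [norm_mul, Pi.star_apply, norm_star, ← Finset.mul_sum]
    refine mul_le_mul_of_nonneg_left ?_ (norm_nonneg _)
    refine (norm_sum_le _ _).trans (Finset.sum_le_sum fun b _ => ?_)
    rw [norm_mul]
    exact mul_le_of_le_one_left (norm_nonneg _) (entry_norm_bound_of_unitary (π g).2 a b)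
  have h2 : ∀ i j, 0 ≤ ∑ a, ∑ b, ‖v i a‖ * ‖v j b‖ := fun i j => by positivity
  calc _ ≤ _ := h1
    _ ≤ ∑ j, ∑ a, ∑ b, ‖v i a‖ * ‖v j b‖ :=
      Finset.single_le_sum (f := fun j => ∑ a, ∑ b, ‖v i a‖ * ‖v j b‖)
        (fun j _ => h2 i j) (Finset.mem_univ j)
    _ ≤ _ := Finset.single_le_sum (f := fun i => ∑ j, ∑ a, ∑ b, ‖v i a‖ * ‖v j b‖)
        (fun i _ => Finset.sum_nonneg fun j _ => h2 i j) (Finset.mem_univ i)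

theorem matrixElements_inv_mul (π : Γ →* Matrix.unitaryGroup (Fin n) ℂ)
    (v : Fin k → Fin n → ℂ) (h g : Γ) (i j : Fin k) :
    matrixElements π v (h⁻¹ * g) i j =
      star ((π h : Matrix (Fin n) (Fin n) ℂ).mulVec (v i)) ⬝ᵥ
        ((π g : Matrix (Fin n) (Fin n) ℂ).mulVec (v j)) := by
  have : ((π (h⁻¹ * g) : Matrix.unitaryGroup (Fin n) ℂ) : Matrix (Fin n) (Fin n) ℂ) =
      (π h : Matrix (Fin n) (Fin n) ℂ).conjTranspose * (π g : Matrix (Fin n) (Fin n) ℂ) := by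
    rw [map_mul, map_inv]; rfl
  rw [matrixElements, Matrix.of_apply, this, ← Matrix.mulVec_mulVec, Matrix.star_mulVec,
    Matrix.dotProduct_mulVec]

theorem matrixElements_nonneg (π : Γ →* Matrix.unitaryGroup (Fin n) ℂ)
    (v : Fin k → Fin n → ℂ) (a : Fin k → Γ →₀ ℂ) :
    0 ≤ ∑ i, ∑ j, (a i).sum fun h x => (a j).sum fun g y =>
      star x * y * matrixElements π v (h⁻¹ * g) i j := by
  let w : Fin n → ℂ := ∑ i, ∑ h ∈ (a i).support,
    a i h • (π h : Matrix (Fin n) (Fin n) ℂ).mulVec (v i)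
  have key : (∑ i, ∑ j, (a i).sum fun h x => (a j).sum fun g y =>
      star x * y * matrixElements π v (h⁻¹ * g) i j) = star w ⬝ᵥ w := by
    have e : star w ⬝ᵥ w = ∑ i, ∑ h ∈ (a i).support, star (a i h) *
        (star ((π h : Matrix (Fin n) (Fin n) ℂ).mulVec (v i)) ⬝ᵥ w) := by
      conv_lhs => rw [show star w = ∑ i, ∑ h ∈ (a i).support, star (a i h) •
        star ((π h : Matrix (Fin n) (Fin n) ℂ).mulVec (v i)) by simp only [w, star_sum, star_smul]]
      simp only [sum_dotProduct, smul_dotProduct, smul_eq_mul]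
    rw [e]
    refine Finset.sum_congr rfl fun i _ => ?_
    simp only [Finsupp.sum]
    rw [Finset.sum_comm]
    refine Finset.sum_congr rfl fun h _ => ?_
    simp only [w, dotProduct_sum, dotProduct_smul, smul_eq_mul, Finset.mul_sum,
      matrixElements_inv_mul]
    refine Finset.sum_congr rfl fun j _ => Finset.sum_congr rfl fun g _ => ?_
    ring
  rw [key]
  exact dotProduct_star_self_nonneg w

/-- The type of the tuple `v` in the representation `π`: the positive definite map
`g ↦ [⟨π(g) v j, v i⟩]`. -/
def tupleType (π : Γ →* Matrix.unitaryGroup (Fin n) ℂ) (v : Fin k → Fin n → ℂ) :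
    PosDefMap Γ k where
  toFun := matrixElements π v
  bounded := matrixElements_bounded π v
  nonneg := matrixElements_nonneg π v

/-- The set of `O`-typical `k`-tuples of vectors of the representation `π`. -/
def typicalTuples (π : Γ →* Matrix.unitaryGroup (Fin n) ℂ) (O : Set (PosDefMap Γ k)) :
    Set (Fin k → Fin n → ℂ) :=
  {v | tupleType π v ∈ O}

end Types

/-- The volume `π ^ d / d!` of the unit ball of `ℂ^d`. -/
noncomputable def ballVolume (d : ℕ) : ℝ≥0∞ :=
  ENNReal.ofReal (Real.pi ^ d / (d.factorial : ℝ))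

/-- The annealed almost periodic entropy of `φ` along a sequence of random unitary representations
`π n` of dimension `n`: the infimum over all neighbourhoods `O` of `φ` of
`limsup (1 / n) log E (vol (typical tuples) / v(n) ^ k)`, where `vol` is Lebesgue measure on
`(ℂⁿ)^k` and `log 0 = -∞`. -/
noncomputable def annealedEntropy {Γ : Type*} [Group Γ] {k : ℕ} {Ω : Type*} [MeasurableSpace Ω]
    (P : Measure Ω) (π : ∀ n : ℕ, Ω → Γ →* Matrix.unitaryGroup (Fin n) ℂ)
    (φ : PosDefMap Γ k) : EReal :=
  ⨅ O ∈ 𝓝 φ, limsup (fun n : ℕ =>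
    ENNReal.log (∫⁻ ω, volume (typicalTuples (π n ω) O) / ballVolume n ^ k ∂P) / (n : EReal)) atTop

/-- The unitary group `U(n)` carries its Borel sigma-algebra. -/
noncomputable instance (n : ℕ) : MeasurableSpace (Matrix.unitaryGroup (Fin n) ℂ) := borel _

instance (n : ℕ) : BorelSpace (Matrix.unitaryGroup (Fin n) ℂ) := ⟨rfl⟩

/-- `π` is a uniformly random almost periodic sequence for the free group on `S`: for each
dimension `n`, the unitary matrices `π n s`, for `s` in `S`, are independent, and the law of each
of them is a Haar measure on `U(n)` (the normalized one, when `P` is a probability measure). -/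
structure IsUniformlyRandom {S : Type*} {Ω : Type*} [MeasurableSpace Ω] (P : Measure Ω)
    (π : ∀ n : ℕ, Ω → FreeGroup S →* Matrix.unitaryGroup (Fin n) ℂ) : Prop where
  measurable : ∀ n s, Measurable fun ω => π n ω (FreeGroup.of s)
  indep : ∀ n, iIndepFun (fun s ω => π n ω (FreeGroup.of s)) P
  haar : ∀ n s, (P.map fun ω => π n ω (FreeGroup.of s)).IsHaarMeasure

section Balls

variable {S : Type*} [Fintype S] [DecidableEq S]

theorem finite_norm_le (n : ℕ) : {g : FreeGroup S | g.norm ≤ n}.Finite :=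
  ((List.finite_length_le (S × Bool) n).image FreeGroup.mk).subset
    fun g hg => ⟨g.toWord, hg, FreeGroup.mk_toWord⟩

/-- The closed ball of radius `n` around the identity in the (left) Cayley graph: the elements
whose reduced word has length at most `n`. -/
noncomputable def freeBall (S : Type*) [Fintype S] [DecidableEq S] (n : ℕ) :
    Finset (FreeGroup S) :=
  (finite_norm_le (S := S) n).toFinset

variable {k : ℕ}

/-- `log det φ[B_n] - ∑ s, log det φ[B_n ∩ s B_n]`, read as `-∞` if one of these determinants
is zero. -/
noncomputable def interTerm (φ : PosDefMap (FreeGroup S) k) (n : ℕ) : EReal :=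
  if φ.gramDet (freeBall S n) = 0 ∨
      ∃ s : S, φ.gramDet (freeBall S n ∩ FreeGroup.of s • freeBall S n) = 0 then ⊥
  else ((Real.log (φ.gramDet (freeBall S n)) -
    ∑ s : S, Real.log (φ.gramDet (freeBall S n ∩ FreeGroup.of s • freeBall S n)) : ℝ) : EReal)

/-- `∑ s, log det φ[B_n ∪ s B_n] - (2 r - 1) log det φ[B_n]`, where `r` is the number of
generators, read as `-∞` if one of these determinants is zero. -/
noncomputable def unionTerm (φ : PosDefMap (FreeGroup S) k) (n : ℕ) : EReal :=
  if φ.gramDet (freeBall S n) = 0 ∨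
      ∃ s : S, φ.gramDet (freeBall S n ∪ FreeGroup.of s • freeBall S n) = 0 then ⊥
  else ((∑ s : S, Real.log (φ.gramDet (freeBall S n ∪ FreeGroup.of s • freeBall S n)) -
    (2 * (Fintype.card S : ℝ) - 1) * Real.log (φ.gramDet (freeBall S n)) : ℝ) : EReal)

end Balls

/-! The proof counts one set in two ways. Let `F` be a finite subtree of the left Cayley tree
containing the identity. Call a tuple `Y` of vectors indexed by `F × Fin k` nearly consistent if,
along every edge from `s⁻¹g` to `g` inside `F`, the random matrix of `s` carries `Y` at `s⁻¹g` to
within `δ` of `Y` at `g`. The quantity to compute is the expected volume of the nearly consistent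
`Y` whose Gram matrix is close to `φ[F]`.

For fixed unitaries, such a `Y` is almost the orbit of its root vectors. The increments along edges
range freely over `δ`-balls, so the volume is about that of the good root tuples times `(δ^(2n)
v(n))^((|F|-1)k)` (`volume_orbitTuple_mul_le`, `volume_nearConsistent_le`).

For fixed `Y`, independence gives a product over `s` of Haar probabilities of carrying one tuple
near another with almost the same Gram matrix. Each is about `δ^(2n)` to the number of vectors,
divided by `(det φ[F ∩ sF])^n` (`measure_nearTransporters_mul_det_le`,
`le_measure_nearTransporters_mul_det`). The tuples with Gram matrix near `φ[F]` have volume about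
`(det φ[F])^n v(n)^(|F|k)` (`volume_entryClose_le`, `le_volume_entryClose`).

A tree has one edge fewer than vertices, so the powers of `δ` and of `v(n)` cancel. What remains is
the growth rate `gramRatio φ F = det φ[F] / ∏ det φ[F ∩ sF]` (`exists_expectedCloseVolume_le`,
`exists_le_expectedCloseVolume`).

With `F` a ball, the logarithm of this ratio is the first expression of the theorem. It bounds the
entropy above for every radius. Conditions on large balls are cofinal among neighbourhoods of `φ`
(`eventually_exists_entryClose_subset`), which gives the lower bound, hence the first limit. If a
determinant vanishes, leaves are pruned until the upper bound applies and yields `-∞`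
(`annealedEntropy_eq_bot_of_gramDet_eq_zero`). The second expression interlaces with the first by
Koteljanskii's inequality (`unionTerm_le_interTerm`, `interTerm_succ_le_unionTerm`). -/

/-! ### Tuples of vectors, Gram matrices and linear recombination -/

section Tuples

variable {ι κ : Type*} {n : ℕ}

/-- The Euclidean norm of a vector of `ℂⁿ`. -/
noncomputable def l2norm (x : Fin n → ℂ) : ℝ := ‖WithLp.toLp 2 x‖

theorem l2norm_nonneg (x : Fin n → ℂ) : 0 ≤ l2norm x := norm_nonneg _

theorem l2norm_zero : l2norm (0 : Fin n → ℂ) = 0 := by simp [l2norm]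

theorem l2norm_add_le (x y : Fin n → ℂ) : l2norm (x + y) ≤ l2norm x + l2norm y := by
  simp only [l2norm, WithLp.toLp_add]; exact norm_add_le _ _

theorem l2norm_neg (x : Fin n → ℂ) : l2norm (-x) = l2norm x := by
  simp only [l2norm, WithLp.toLp_neg]; exact norm_neg _

theorem l2norm_sub_comm (x y : Fin n → ℂ) : l2norm (x - y) = l2norm (y - x) := by
  rw [← l2norm_neg, neg_sub]

theorem l2norm_smul (c : ℂ) (x : Fin n → ℂ) : l2norm (c • x) = ‖c‖ * l2norm x := by
  simp only [l2norm, WithLp.toLp_smul]; exact norm_smul _ _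

theorem l2norm_sum_le (s : Finset κ) (f : κ → Fin n → ℂ) :
    l2norm (∑ i ∈ s, f i) ≤ ∑ i ∈ s, l2norm (f i) := by
  simp only [l2norm, WithLp.toLp_sum]; exact norm_sum_le _ _

theorem inner_toLp_eq (x y : Fin n → ℂ) :
    inner ℂ (WithLp.toLp 2 x) (WithLp.toLp 2 y) = star x ⬝ᵥ y := by
  rw [EuclideanSpace.inner_eq_star_dotProduct, dotProduct_comm]

theorem norm_dotProduct_le (x y : Fin n → ℂ) : ‖star x ⬝ᵥ y‖ ≤ l2norm x * l2norm y := by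
  rw [← inner_toLp_eq]; exact norm_inner_le_norm _ _

theorem dotProduct_self_eq (x : Fin n → ℂ) : star x ⬝ᵥ x = ((l2norm x ^ 2 : ℝ) : ℂ) := by
  rw [← inner_toLp_eq, inner_self_eq_norm_sq_to_K, l2norm]; push_cast; rfl

theorem continuous_l2norm : Continuous (l2norm : (Fin n → ℂ) → ℝ) := by
  unfold l2norm; fun_prop

theorem l2norm_mulVec_unitary (U : Matrix.unitaryGroup (Fin n) ℂ) (x : Fin n → ℂ) :
    l2norm ((U : Matrix (Fin n) (Fin n) ℂ).mulVec x) = l2norm x := by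
  have h : ((l2norm ((U : Matrix (Fin n) (Fin n) ℂ).mulVec x) ^ 2 : ℝ) : ℂ) =
      ((l2norm x ^ 2 : ℝ) : ℂ) := by
    rw [← dotProduct_self_eq, ← dotProduct_self_eq, Matrix.star_mulVec, ← Matrix.dotProduct_mulVec,
      Matrix.mulVec_mulVec]
    have : (U : Matrix (Fin n) (Fin n) ℂ).conjTranspose * (U : Matrix (Fin n) (Fin n) ℂ) = 1 :=
      Matrix.UnitaryGroup.star_mul_self U
    rw [this, Matrix.one_mulVec]
  exact (sq_eq_sq₀ (l2norm_nonneg _) (l2norm_nonneg _)).1 (by exact_mod_cast h)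

/-- The Gram matrix of a tuple of vectors. -/
def gramMat (Y : ι → Fin n → ℂ) : Matrix ι ι ℂ := Matrix.of fun p q => star (Y p) ⬝ᵥ Y q

/-- Linear recombination of a tuple of vectors by the columns of a matrix. -/
def recombine [Fintype ι] (T : Matrix ι κ ℂ) (Y : ι → Fin n → ℂ) : κ → Fin n → ℂ :=
  fun q => ∑ p, T p q • Y p

theorem gramMat_apply (Y : ι → Fin n → ℂ) (p q : ι) : gramMat Y p q = star (Y p) ⬝ᵥ Y q := rfl

theorem gramMat_self (Y : ι → Fin n → ℂ) (p : ι) :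
    gramMat Y p p = ((l2norm (Y p) ^ 2 : ℝ) : ℂ) := dotProduct_self_eq _

theorem gramMat_eq (Y : ι → Fin n → ℂ) :
    gramMat Y = (Matrix.of Y).map star * (Matrix.of Y).transpose := by
  ext p q; simp [gramMat, Matrix.mul_apply, dotProduct]

theorem continuous_gramMat : Continuous (gramMat : (ι → Fin n → ℂ) → Matrix ι ι ℂ) := by
  refine continuous_matrix fun p q => ?_
  simp only [gramMat_apply, dotProduct, Pi.star_apply]; fun_prop

variable [Fintype ι]

theorem recombine_eq (T : Matrix ι κ ℂ) (Y : ι → Fin n → ℂ) :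
    Matrix.of (recombine T Y) = T.transpose * Matrix.of Y := by
  ext q a; simp [recombine, Matrix.mul_apply]

theorem posSemidef_gramMat (Y : ι → Fin n → ℂ) : (gramMat Y).PosSemidef := by
  rw [gramMat_eq]
  have := Matrix.posSemidef_self_mul_conjTranspose ((Matrix.of Y).map star)
  convert this using 2
  ext; simp

theorem gramMat_recombine (T : Matrix ι κ ℂ) (Y : ι → Fin n → ℂ) :
    gramMat (recombine T Y) = T.conjTranspose * gramMat Y * T := by
  rw [gramMat_eq, gramMat_eq, recombine_eq, Matrix.transpose_mul, Matrix.transpose_transpose]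
  have : (T.transpose * Matrix.of Y).map star = T.conjTranspose * (Matrix.of Y).map star := by
    ext; simp [Matrix.mul_apply]
  rw [this]; simp only [Matrix.mul_assoc]

theorem recombine_recombine [Fintype κ] {μ : Type*} (T : Matrix ι κ ℂ) (T' : Matrix κ μ ℂ)
    (Y : ι → Fin n → ℂ) : recombine T' (recombine T Y) = recombine (T * T') Y := by
  have := recombine_eq T' (recombine T Y)
  rw [recombine_eq T Y, ← Matrix.mul_assoc, ← Matrix.transpose_mul, ← recombine_eq] at this
  exact Matrix.of.injective this

theorem recombine_one [DecidableEq ι] (Y : ι → Fin n → ℂ) : recombine 1 Y = Y := by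
  have := recombine_eq (1 : Matrix ι ι ℂ) Y
  rw [Matrix.transpose_one, Matrix.one_mul] at this
  exact Matrix.of.injective this

theorem recombine_sub (T : Matrix ι κ ℂ) (Y Y' : ι → Fin n → ℂ) :
    recombine T (Y - Y') = recombine T Y - recombine T Y' := by
  ext q a; simp [recombine, mul_sub]

theorem recombine_add (T : Matrix ι κ ℂ) (Y Y' : ι → Fin n → ℂ) :
    recombine T (Y + Y') = recombine T Y + recombine T Y' := by
  ext q a; simp [recombine, Finset.sum_add_distrib]

theorem recombine_smul (T : Matrix ι κ ℂ) (c : ℂ) (Y : ι → Fin n → ℂ) :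
    recombine T (c • Y) = c • recombine T Y := by
  ext q a; simp [recombine, Finset.mul_sum, mul_left_comm]

theorem recombine_mulVec (T : Matrix ι κ ℂ) (U : Matrix (Fin n) (Fin n) ℂ) (Y : ι → Fin n → ℂ)
    (q : κ) : recombine T (fun p => U.mulVec (Y p)) q = U.mulVec (recombine T Y q) := by
  simp only [recombine, Matrix.mulVec_sum, Matrix.mulVec_smul]

theorem continuous_recombine (T : Matrix ι κ ℂ) :
    Continuous (recombine T : (ι → Fin n → ℂ) → κ → Fin n → ℂ) := by
  unfold recombine; fun_prop

theorem l2norm_recombine_le (T : Matrix ι κ ℂ) (Y : ι → Fin n → ℂ) {K ρ : ℝ}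
    (hK : ∀ q, ∑ p, ‖T p q‖ ≤ K) (hρ : 0 ≤ ρ) (hY : ∀ p, l2norm (Y p) ≤ ρ) (q : κ) :
    l2norm (recombine T Y q) ≤ K * ρ := by
  calc _ ≤ ∑ p, l2norm (T p q • Y p) := l2norm_sum_le _ _
    _ ≤ ∑ p, ‖T p q‖ * ρ := Finset.sum_le_sum fun p _ => by
        rw [l2norm_smul]; exact mul_le_mul_of_nonneg_left (hY p) (norm_nonneg _)
    _ = (∑ p, ‖T p q‖) * ρ := by rw [Finset.sum_mul]
    _ ≤ _ := mul_le_mul_of_nonneg_right (hK q) hρ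

end Tuples

/-! ### Lebesgue measure under recombination, unitaries and products of balls -/

section Volumes

variable {ι : Type*} [Fintype ι] {n : ℕ}

instance : (volume : Measure (ι → Fin n → ℂ)).IsAddHaarMeasure :=
  Measure.pi.isAddHaarMeasure fun _ : ι => (volume : Measure (Fin n → ℂ))

theorem ballVolume_ne_zero (n : ℕ) : ballVolume n ≠ 0 := by
  simp only [ballVolume, ne_eq, ENNReal.ofReal_eq_zero, not_le]; positivity

theorem ballVolume_ne_top (n : ℕ) : ballVolume n ≠ ⊤ := ENNReal.ofReal_ne_top

/-- Recombination of tuples as a real-linear map. -/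
noncomputable def recombineLin (n : ℕ) (T : Matrix ι ι ℂ) :
    (ι → Fin n → ℂ) →ₗ[ℂ] (ι → Fin n → ℂ) where
  toFun := recombine T
  map_add' := recombine_add T
  map_smul' := recombine_smul T

/-- After exchanging the two indices, the map acts on each of the `n` coordinates separately by the
transpose of `T`. -/
theorem det_recombineLin [DecidableEq ι] (T : Matrix ι ι ℂ) :
    LinearMap.det (recombineLin n T) = T.det ^ n := by
  let e : (Fin n → ι → ℂ) ≃ₗ[ℂ] (ι → Fin n → ℂ) :=
    { toFun := fun f i j => f j i
      invFun := fun f i j => f j i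
      map_add' := fun _ _ => rfl
      map_smul' := fun _ _ => rfl
      left_inv := fun _ => rfl
      right_inv := fun _ => rfl }
  have h : recombineLin n T = e.toLinearMap ∘ₗ
      (LinearMap.pi fun a => (Matrix.toLin' T.transpose).comp (LinearMap.proj a)) ∘ₗ
        e.symm.toLinearMap := by
    refine LinearMap.ext fun Y => ?_
    ext q a
    simp [recombineLin, recombine, e, Matrix.mulVec, dotProduct]
  rw [h, LinearMap.det_conj, LinearMap.det_pi]
  simp

/-- The exponent is `2 * n` because the real determinant of a complex-linear map is the squared
modulus of its complex determinant. -/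
theorem volume_eq_recombine_preimage [DecidableEq ι] (T : Matrix ι ι ℂ) (hT : T.det ≠ 0)
    (A : Set (ι → Fin n → ℂ)) :
    volume A = ENNReal.ofReal (‖T.det‖ ^ (2 * n)) * volume (recombine T ⁻¹' A) := by
  have hd : LinearMap.det ((recombineLin n T).restrictScalars ℝ) = ‖T.det‖ ^ (2 * n) := by
    rw [LinearMap.det_restrictScalars, det_recombineLin, Algebra.norm_complex_apply,
      Complex.normSq_eq_norm_sq, norm_pow, ← pow_mul, mul_comm]
  have hpos : 0 < ‖T.det‖ ^ (2 * n) := by positivity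
  have := Measure.addHaar_preimage_linearMap (volume : Measure (ι → Fin n → ℂ))
    (f := (recombineLin n T).restrictScalars ℝ) (by rw [hd]; exact hpos.ne') A
  rw [hd] at this
  change volume (recombine T ⁻¹' A) = _ at this
  rw [this, ← mul_assoc, ← ENNReal.ofReal_mul hpos.le, abs_of_pos (inv_pos.2 hpos),
    mul_inv_cancel₀ hpos.ne', ENNReal.ofReal_one, one_mul]

theorem measurePreserving_mulVec_unitary (U : Matrix.unitaryGroup (Fin n) ℂ) :
    MeasurePreserving (fun x : Fin n → ℂ => (U : Matrix (Fin n) (Fin n) ℂ).mulVec x)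
      volume volume := by
  set f : (Fin n → ℂ) →ₗ[ℂ] (Fin n → ℂ) := Matrix.toLin' (U : Matrix (Fin n) (Fin n) ℂ) with hf
  have hn : ‖(U : Matrix (Fin n) (Fin n) ℂ).det‖ = 1 := by
    have := Matrix.UnitaryGroup.det_isUnit U
    have h2 := Matrix.det_of_mem_unitary U.2
    exact CStarRing.norm_of_mem_unitary h2
  have hd : LinearMap.det (f.restrictScalars ℝ) = 1 := by
    rw [LinearMap.det_restrictScalars, hf, LinearMap.det_toLin', Algebra.norm_complex_apply,
      Complex.normSq_eq_norm_sq, hn, one_pow]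
  have hm : Measurable fun x : Fin n → ℂ => (U : Matrix (Fin n) (Fin n) ℂ).mulVec x := by
    unfold Matrix.mulVec dotProduct
    fun_prop
  refine ⟨hm, ?_⟩
  have := Measure.map_linearMap_addHaar_eq_smul_addHaar (volume : Measure (Fin n → ℂ))
    (f := f.restrictScalars ℝ) (by rw [hd]; exact one_ne_zero)
  rw [hd, inv_one, abs_one, ENNReal.ofReal_one, one_smul] at this
  exact this

theorem measurePreserving_mulVec_unitary_pi (U : ι → Matrix.unitaryGroup (Fin n) ℂ) :
    MeasurePreserving (fun (Y : ι → Fin n → ℂ) p =>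
      (U p : Matrix (Fin n) (Fin n) ℂ).mulVec (Y p)) volume volume :=
  volume_preserving_pi fun p => measurePreserving_mulVec_unitary (U p)

theorem volume_l2ball_zero (r : ℝ) (hr : 0 < r) :
    volume {x : Fin n → ℂ | l2norm x < r} = ENNReal.ofReal (r ^ (2 * n)) * ballVolume n := by
  rcases Nat.eq_zero_or_pos n with rfl | hn
  · have : {x : Fin 0 → ℂ | l2norm x < r} = Set.univ := by
      ext x; simp [l2norm, Subsingleton.elim (WithLp.toLp 2 x) 0, hr]
    rw [this]; simp [ballVolume, MeasureTheory.volume_pi]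
  · have : Nonempty (Fin n) := ⟨⟨0, hn⟩⟩
    have := Complex.volume_sum_rpow_lt (ι := Fin n) (p := 2) (by norm_num) r
    have h2 : {x : Fin n → ℂ | l2norm x < r} =
        {x : Fin n → ℂ | (∑ i, ‖x i‖ ^ (2:ℝ)) ^ (1 / (2:ℝ)) < r} := by
      ext x
      simp [l2norm, EuclideanSpace.norm_eq, Real.sqrt_eq_rpow]
    rw [h2, this, ballVolume]
    congr 2
    · rw [ENNReal.ofReal_pow hr.le]; simp
    · simp only [Fintype.card_fin]
      rw [show (2 : ℝ) / 2 + 1 = 2 by norm_num, show (2 : ℝ) * n / 2 + 1 = n + 1 by ring,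
        Real.Gamma_two, mul_one, Real.Gamma_nat_eq_factorial]

theorem volume_l2ball (b : Fin n → ℂ) (r : ℝ) (hr : 0 < r) :
    volume {x : Fin n → ℂ | l2norm (x - b) < r} =
      ENNReal.ofReal (r ^ (2 * n)) * ballVolume n := by
  rw [← volume_l2ball_zero r hr]
  simpa [sub_eq_add_neg] using measure_preimage_add_right (volume : Measure (Fin n → ℂ)) (-b)
    {x : Fin n → ℂ | l2norm x < r}

theorem volume_polyball (b : ι → Fin n → ℂ) (r : ι → ℝ) (hr : ∀ p, 0 < r p) :
    volume {Y : ι → Fin n → ℂ | ∀ p, l2norm (Y p - b p) < r p} =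
      ∏ p, ENNReal.ofReal (r p ^ (2 * n)) * ballVolume n := by
  have : {Y : ι → Fin n → ℂ | ∀ p, l2norm (Y p - b p) < r p} =
      Set.univ.pi fun p => {x | l2norm (x - b p) < r p} := by ext; simp
  rw [this, volume_pi_pi]
  exact Finset.prod_congr rfl fun p _ => volume_l2ball _ _ (hr p)

end Volumes

/-! ### Concentration: independent vectors of a high-dimensional ball are nearly orthonormal -/

section Concentration

variable {ι : Type*} {n : ℕ}

/-- Entrywise closeness of matrices. -/
def EntryClose (G Q : Matrix ι ι ℂ) (ε : ℝ) : Prop := ∀ p q, ‖G p q - Q p q‖ < ε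

/-- Tuples that are orthonormal up to an error `τ` in each entry of the Gram matrix. -/
def nearOrthonormal (ι : Type*) [DecidableEq ι] (n : ℕ) (τ : ℝ) : Set (ι → Fin n → ℂ) :=
  {c | EntryClose (gramMat c) 1 τ}

theorem l2norm_sub_smul_sq (x y : Fin n → ℂ) (c : ℂ) :
    l2norm (x - c • y) ^ 2 =
      l2norm x ^ 2 - 2 * (star c * (star y ⬝ᵥ x)).re + ‖c‖ ^ 2 * l2norm y ^ 2 := by
  have := norm_sub_sq (𝕜 := ℂ) (WithLp.toLp 2 x) (WithLp.toLp 2 (c • y))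
  rw [← WithLp.toLp_sub, inner_re_symm, inner_toLp_eq] at this
  change l2norm (x - c • y) ^ 2 = l2norm x ^ 2 - 2 * _ + l2norm (c • y) ^ 2 at this
  rw [this, l2norm_smul, mul_pow, star_smul, smul_dotProduct, smul_eq_mul]
  rfl

/-- Replaces one condition on a complex inner product by four real half-space conditions, fit for a
finite union bound. -/
theorem exists_quarter_turn_re_ge (z : ℂ) {η : ℝ} (hz : η ≤ ‖z‖) :
    ∃ k : Fin 4, η / 2 ≤ (Complex.I ^ (k : ℕ) * z).re := by
  by_contra! h
  have h0 := h 0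
  have h1 := h 1
  have h2 := h 2
  have h3 := h 3
  simp [pow_succ] at h0 h1 h2 h3
  have h4 := Complex.norm_le_abs_re_add_abs_im z
  have h5 : |z.re| < η / 2 := abs_lt.2 ⟨by linarith, h0⟩
  have h6 : |z.im| < η / 2 := abs_lt.2 ⟨by linarith, h3⟩
  linarith

/-- A union bound. -/
theorem le_two_mul_measure_of_union_bound {α I : Type*} [MeasurableSpace α] [Fintype I]
    (μ : Measure α) {D G : Set α} {B : I → Set α} {V x : ℝ≥0∞} (hV : V ≠ ⊤) (hD : μ D = V)
    (hDG : D ⊆ G ∪ ⋃ i, B i) (hB : ∀ i, μ (B i) ≤ x * V)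
    (hx : (Fintype.card I : ℝ≥0∞) * x ≤ 2⁻¹) : V ≤ 2 * μ G := by
  have h1 : V ≤ μ G + 2⁻¹ * V := by
    calc V = μ D := hD.symm
      _ ≤ μ G + μ (⋃ i, B i) := (measure_mono hDG).trans (measure_union_le _ _)
      _ ≤ μ G + ∑ i, μ (B i) := by gcongr; exact measure_iUnion_fintype_le _ _
      _ ≤ μ G + ∑ _i : I, x * V := by gcongr with i; exact hB i
      _ = μ G + (Fintype.card I : ℝ≥0∞) * x * V := by simp [mul_assoc]
      _ ≤ _ := by gcongr
  have h2 : 2⁻¹ * V ≠ ⊤ := ENNReal.mul_ne_top (by simp) hV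
  have h3 : V = 2⁻¹ * V + 2⁻¹ * V := by rw [← add_mul, ENNReal.inv_two_add_inv_two, one_mul]
  have h4 : 2⁻¹ * V ≤ μ G := by
    rw [h3] at h1
    conv at h1 => rhs; rw [← h3]
    exact (ENNReal.add_le_add_iff_right h2).1 h1
  calc V = 2 * (2⁻¹ * V) := by rw [← mul_assoc, ENNReal.mul_inv_cancel (by simp) (by simp), one_mul]
    _ ≤ _ := by gcongr

theorem eventually_mul_pow_le_half (c : ℕ) {r : ℝ} (h0 : 0 < r) (h1 : r < 1) :
    ∀ᶠ n : ℕ in atTop, (c : ℝ≥0∞) * ENNReal.ofReal (r ^ (2 * n)) ≤ 2⁻¹ := by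
  have h : Tendsto (fun n : ℕ => (c : ℝ) * r ^ (2 * n)) atTop (𝓝 0) := by
    have := (tendsto_pow_atTop_nhds_zero_of_lt_one (r := r ^ 2) (by positivity)
      (by nlinarith)).const_mul (c : ℝ)
    simpa [pow_mul] using this
  filter_upwards [h.eventually_le_const (show (0 : ℝ) < 2⁻¹ by norm_num)] with n hn
  have := ENNReal.ofReal_le_ofReal hn
  rw [ENNReal.ofReal_mul (by positivity), ENNReal.ofReal_natCast] at this
  refine this.trans (le_of_eq ?_)
  rw [ENNReal.ofReal_inv_of_pos (by norm_num)]; simp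

variable [Fintype ι]

theorem volume_unit_polyball :
    volume {Y : ι → Fin n → ℂ | ∀ p, l2norm (Y p) < 1} = ballVolume n ^ Fintype.card ι := by
  have := volume_polyball (n := n) (0 : ι → Fin n → ℂ) (fun _ => 1) fun _ => one_pos
  simpa using this

variable [DecidableEq ι]

theorem volume_shrunk_polyball (b : Fin n → ℂ) (q : ι) {r : ℝ} (hr : 0 < r) :
    volume {Y : ι → Fin n → ℂ | (∀ p, p ≠ q → l2norm (Y p) < 1) ∧ l2norm (Y q - b) < r} =
      ENNReal.ofReal (r ^ (2 * n)) * ballVolume n ^ Fintype.card ι := by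
  have := volume_polyball (n := n) (Function.update (0 : ι → Fin n → ℂ) q b)
    (Function.update (fun _ => 1) q r) (fun p => by
      by_cases h : p = q
      · subst h; simpa using hr
      · simp [h])
  have e : {Y : ι → Fin n → ℂ | (∀ p, p ≠ q → l2norm (Y p) < 1) ∧ l2norm (Y q - b) < r} =
      {Y : ι → Fin n → ℂ | ∀ p, l2norm (Y p - Function.update (0 : ι → Fin n → ℂ) q b p) <
        Function.update (fun _ => (1:ℝ)) q r p} := by
    ext Y
    refine ⟨fun h p => ?_, fun h => ⟨fun p hp => ?_, ?_⟩⟩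
    · by_cases hp : p = q
      · subst hp; simpa using h.2
      · simpa [hp] using h.1 p hp
    · simpa [hp] using h p
    · simpa using h q
  rw [e, this, Finset.prod_mul_distrib]
  congr 1
  · rw [Finset.prod_eq_single q]
    · simp
    · intro p _ hp; simp [hp]
    · simp
  · simp

/-- Failure means that some vector is too short or some pair has a large inner product. A short
vector lies in a smaller ball. In the other case a volume-preserving shear, subtracting a multiple
of one vector from the other, moves the latter into a smaller ball. Each bad event thus costs a
factor exponentially small in `n`. -/
theorem ballVolume_pow_le_nearOrthonormal (ι : Type*) [Fintype ι] [DecidableEq ι] {η : ℝ}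
    (hη : 0 < η) (hη1 : η ≤ 1) : ∀ᶠ n : ℕ in atTop, ballVolume n ^ Fintype.card ι ≤
      2 * volume ({c : ι → Fin n → ℂ | ∀ p, l2norm (c p) < 1} ∩ nearOrthonormal ι n η) := by
  have hr0 : 0 < 1 - η ^ 2 / 16 := by nlinarith
  have hr1 : 1 - η ^ 2 / 16 < 1 := by nlinarith
  have hη2 : η ^ 2 ≤ η := by nlinarith
  filter_upwards [eventually_mul_pow_le_half
    (Fintype.card (ι ⊕ {x : ι × ι // x.1 ≠ x.2} × Fin 4)) hr0 hr1] with n hn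
  let B : ι ⊕ {x : ι × ι // x.1 ≠ x.2} × Fin 4 → Set (ι → Fin n → ℂ) := fun i =>
    match i with
    | .inl p => {c | (∀ p, l2norm (c p) < 1) ∧ l2norm (c p) ^ 2 ≤ 1 - η}
    | .inr (x, k) => {c | (∀ p, l2norm (c p) < 1) ∧
        η / 2 ≤ (Complex.I ^ (k : ℕ) * (star (c x.1.1) ⬝ᵥ c x.1.2)).re}
  refine le_two_mul_measure_of_union_bound volume (B := B)
    (ENNReal.pow_ne_top (ballVolume_ne_top n)) volume_unit_polyball ?_ ?_ hn
  · intro c hc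
    by_cases hcl : c ∈ nearOrthonormal ι n η
    · exact Or.inl ⟨hc, hcl⟩
    right
    simp only [nearOrthonormal, EntryClose, Set.mem_ofPred_eq, not_forall, not_lt] at hcl
    obtain ⟨p, q, hpq⟩ := hcl
    by_cases h : p = q
    · subst h
      refine Set.mem_iUnion.2 ⟨.inl p, hc, ?_⟩
      rw [gramMat_self, Matrix.one_apply_eq, ← Complex.ofReal_one, ← Complex.ofReal_sub,
        Complex.norm_real, Real.norm_eq_abs] at hpq
      have h1 : l2norm (c p) ^ 2 ≤ 1 := by nlinarith [hc p, l2norm_nonneg (c p)]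
      rw [abs_of_nonpos (by linarith)] at hpq
      linarith
    · rw [Matrix.one_apply_ne h, sub_zero, gramMat_apply] at hpq
      obtain ⟨k, hk⟩ := exists_quarter_turn_re_ge _ hpq
      exact Set.mem_iUnion.2 ⟨.inr (⟨(p, q), h⟩, k), hc, hk⟩
  · rintro (p | ⟨⟨⟨p, q⟩, hpq⟩, k⟩)
    · rw [← volume_shrunk_polyball 0 p hr0]
      refine measure_mono fun c hc => ⟨fun q _ => hc.1 q, ?_⟩
      have h2 : l2norm (c p) ^ 2 ≤ 1 - η := hc.2
      rw [sub_zero]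
      refine lt_of_pow_lt_pow_left₀ 2 hr0.le ?_
      nlinarith
    -- The phase of `l` makes the real part of `⟨c q, l c p⟩` at least `η²/4`, so `‖c q - l c p‖² ≤
    -- 1 - η²/2 + η²/4`, which is below the square of the radius `1 - η²/16`.
    · set l : ℂ := (η / 2 : ℝ) * star (Complex.I ^ (k : ℕ)) with hl
      have hln : ‖l‖ = η / 2 := by
        rw [hl, norm_mul, norm_star, norm_pow, Complex.norm_I, one_pow, mul_one,
          Complex.norm_real, Real.norm_of_nonneg (by positivity)]
      have hdet : (Matrix.transvection p q (-l)).det = 1 := Matrix.det_transvection_of_ne p q hpq _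
      rw [← volume_shrunk_polyball 0 q hr0, volume_eq_recombine_preimage
        (Matrix.transvection p q (-l)) (by rw [hdet]; exact one_ne_zero)
        {Y | (∀ p, p ≠ q → l2norm (Y p) < 1) ∧ l2norm (Y q - 0) < 1 - η ^ 2 / 16}, hdet]
      simp only [norm_one, one_pow, ENNReal.ofReal_one, one_mul, sub_zero]
      refine measure_mono fun c hc => ?_
      have hrec : ∀ q', recombine (Matrix.transvection p q (-l)) c q' =
          if q' = q then c q - l • c p else c q' := by
        intro q'
        have : recombine (Matrix.transvection p q (-l)) c q' =
            recombine 1 c q' + ∑ p', Matrix.single p q (-l) p' q' • c p' := by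
          simp only [recombine, Matrix.transvection, Matrix.add_apply, add_smul,
            Finset.sum_add_distrib]
        rw [this, recombine_one, Finset.sum_eq_single p]
        · by_cases h : q' = q
          · subst h; simp [sub_eq_add_neg]
          · simp [h, Ne.symm h]
        · intro p' _ hp'; simp [Ne.symm hp']
        · simp
      have h1 : ∀ p, l2norm (c p) ^ 2 ≤ 1 := fun p => by
        nlinarith [hc.1 p, l2norm_nonneg (c p)]
      refine ⟨fun p' hp' => ?_, ?_⟩
      · rw [hrec, if_neg hp']; exact hc.1 p'
      · rw [hrec, if_pos rfl]
        refine lt_of_pow_lt_pow_left₀ 2 hr0.le ?_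
        rw [l2norm_sub_smul_sq, hln]
        have h2 : η / 2 ≤ (Complex.I ^ (k : ℕ) * (star (c p) ⬝ᵥ c q)).re := hc.2
        have h3 : (star l * (star (c p) ⬝ᵥ c q)).re =
            η / 2 * (Complex.I ^ (k : ℕ) * (star (c p) ⬝ᵥ c q)).re := by
          rw [hl, star_mul', star_star, mul_assoc, Complex.star_def, Complex.conj_ofReal,
            Complex.re_ofReal_mul]
        rw [h3]
        nlinarith [h1 p, h1 q, mul_le_mul_of_nonneg_left h2 (show (0:ℝ) ≤ η / 2 by positivity),
          mul_le_mul_of_nonneg_left (h1 p) (show (0:ℝ) ≤ (η / 2) ^ 2 by positivity)]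

/-- Here one side of each inner product is fixed, so a translation by a multiple of `b p` replaces
the shear. The threshold for `n` does not depend on `b`, which matters when `b` is later rotated by
an arbitrary unitary. -/
theorem ballVolume_pow_le_nearOrthogonal (ι : Type*) [Fintype ι] [DecidableEq ι] {θ K : ℝ}
    (hθ : 0 < θ) (hK : θ ≤ K) : ∀ᶠ n : ℕ in atTop, ∀ b : ι → Fin n → ℂ,
      (∀ p, l2norm (b p) ≤ K) → ballVolume n ^ Fintype.card ι ≤
        2 * volume {z : ι → Fin n → ℂ | (∀ p, l2norm (z p) < 1) ∧
          ∀ p q, ‖star (b p) ⬝ᵥ z q‖ < θ} := by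
  have hK0 : 0 < K := hθ.trans_le hK
  set u : ℝ := (θ / (2 * K)) ^ 2 with hu
  have hu0 : 0 < u := by positivity
  have hu1 : u ≤ 1 := by
    have : θ / (2 * K) ≤ 1 := by rw [div_le_one (by positivity)]; linarith
    have h0 : 0 ≤ θ / (2 * K) := by positivity
    nlinarith
  have hr0 : 0 < 1 - u / 4 := by linarith
  have hr1 : 1 - u / 4 < 1 := by linarith
  filter_upwards [eventually_mul_pow_le_half (Fintype.card ((ι × ι) × Fin 4)) hr0 hr1]
    with n hn b hb
  let B : (ι × ι) × Fin 4 → Set (ι → Fin n → ℂ) := fun x =>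
    {z | (∀ p, l2norm (z p) < 1) ∧
        θ / 2 ≤ (Complex.I ^ (x.2 : ℕ) * (star (b x.1.1) ⬝ᵥ z x.1.2)).re}
  refine le_two_mul_measure_of_union_bound volume (B := B)
    (ENNReal.pow_ne_top (ballVolume_ne_top n)) volume_unit_polyball ?_ ?_ hn
  · intro z hz
    by_cases hcl : ∀ p q, ‖star (b p) ⬝ᵥ z q‖ < θ
    · exact Or.inl ⟨hz, hcl⟩
    right
    simp only [not_forall, not_lt] at hcl
    obtain ⟨p, q, hpq⟩ := hcl
    obtain ⟨k, hk⟩ := exists_quarter_turn_re_ge _ hpq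
    exact Set.mem_iUnion.2 ⟨((p, q), k), hz, hk⟩
  · rintro ⟨⟨p, q⟩, k⟩
    -- The modulus minimises `1 - θ t + K² t²`; the minimum is `1 - u`, below the square of the
    -- radius `1 - u/4`.
    set l : ℂ := (θ / (2 * K ^ 2) : ℝ) * star (Complex.I ^ (k : ℕ)) with hl
    have hln : ‖l‖ = θ / (2 * K ^ 2) := by
      rw [hl, norm_mul, norm_star, norm_pow, Complex.norm_I, one_pow, mul_one,
        Complex.norm_real, Real.norm_of_nonneg (by positivity)]
    rw [← volume_shrunk_polyball (l • b p) q hr0]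
    refine measure_mono fun z hz => ⟨fun p' _ => hz.1 p', ?_⟩
    refine lt_of_pow_lt_pow_left₀ 2 hr0.le ?_
    rw [l2norm_sub_smul_sq, hln]
    have h2 : θ / 2 ≤ (Complex.I ^ (k : ℕ) * (star (b p) ⬝ᵥ z q)).re := hz.2
    have h3 : (star l * (star (b p) ⬝ᵥ z q)).re =
        θ / (2 * K ^ 2) * (Complex.I ^ (k : ℕ) * (star (b p) ⬝ᵥ z q)).re := by
      rw [hl, star_mul', star_star, mul_assoc, Complex.star_def, Complex.conj_ofReal,
        Complex.re_ofReal_mul]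
    rw [h3]
    have h4 : l2norm (z q) ^ 2 ≤ 1 := by nlinarith [hz.1 q, l2norm_nonneg (z q)]
    have h5 : l2norm (b p) ^ 2 ≤ K ^ 2 := pow_le_pow_left₀ (l2norm_nonneg _) (hb p) 2
    have h6 : (θ / (2 * K ^ 2)) ^ 2 * l2norm (b p) ^ 2 ≤ u := by
      calc _ ≤ (θ / (2 * K ^ 2)) ^ 2 * K ^ 2 := by gcongr
        _ = u := by rw [hu]; field_simp
    have h7 : 2 * u ≤ 2 * (θ / (2 * K ^ 2) *
        (Complex.I ^ (k : ℕ) * (star (b p) ⬝ᵥ z q)).re) := by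
      calc 2 * u = 2 * (θ / (2 * K ^ 2) * (θ / 2)) := by rw [hu]; field_simp
        _ ≤ _ := by gcongr
    nlinarith

end Concentration

/-! ### Perturbation of Gram matrices, and volumes of sets of tuples with prescribed Gram matrix -/

section GramEstimates

theorem exists_unitary_mulVec_eq_single {ι : Type*} [DecidableEq ι] {n : ℕ}
    {e : ι → Fin n → ℂ} (he : gramMat e = 1) (f : ι ↪ Fin n) :
    ∃ U : Matrix.unitaryGroup (Fin n) ℂ,
      ∀ p, (U : Matrix (Fin n) (Fin n) ℂ).mulVec (Pi.single (f p) 1) = e p := by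
  have hon : Orthonormal ℂ fun p => (WithLp.toLp 2 (e p) : EuclideanSpace ℂ (Fin n)) := by
    rw [orthonormal_iff_ite]
    intro p q
    rw [inner_toLp_eq, ← gramMat_apply, he, Matrix.one_apply]
  let v : Fin n → EuclideanSpace ℂ (Fin n) := Function.extend f (fun p => WithLp.toLp 2 (e p)) 0
  have hv : ∀ p, v (f p) = WithLp.toLp 2 (e p) := fun p => f.injective.extend_apply _ _ _
  have hon' : Orthonormal ℂ ((Set.range f).domRestrict v) := by
    have := hon.comp (Equiv.ofInjective f f.injective).symm (Equiv.injective _)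
    convert this using 1
    ext1 ⟨x, p, rfl⟩
    simp only [Set.domRestrict_apply, hv, Function.comp_apply, Equiv.ofInjective_symm_apply]
  obtain ⟨b, hb⟩ := hon'.exists_orthonormalBasis_extension_of_card_eq (by simp)
  refine ⟨⟨_, (EuclideanSpace.basisFun (Fin n) ℂ).toMatrix_orthonormalBasis_mem_unitary b⟩,
    fun p => ?_⟩
  ext a
  simp [Module.Basis.toMatrix_apply, hb (f p) ⟨p, rfl⟩, hv]

variable {ι : Type*} [Fintype ι] {n : ℕ}

theorem exists_colSum_le (T : Matrix ι ι ℂ) : ∃ K : ℝ, 0 < K ∧ ∀ q, ∑ p, ‖T p q‖ ≤ K :=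
  ⟨1 + ∑ q, ∑ p, ‖T p q‖, by positivity, fun q => by
    have : ∑ p, ‖T p q‖ ≤ ∑ q, ∑ p, ‖T p q‖ :=
      Finset.single_le_sum (f := fun q => ∑ p, ‖T p q‖)
        (fun _ _ => Finset.sum_nonneg fun _ _ => norm_nonneg _) (Finset.mem_univ q)
    linarith⟩

theorem norm_conj_sub_le {G Q T : Matrix ι ι ℂ} {ε K : ℝ} (h : EntryClose G Q ε)
    (hK : ∀ q, ∑ p, ‖T p q‖ ≤ K) (hK0 : 0 ≤ K) (hε : 0 ≤ ε) (p q : ι) :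
    ‖(T.conjTranspose * G * T) p q - (T.conjTranspose * Q * T) p q‖ ≤ ε * K ^ 2 := by
  rw [← Matrix.sub_apply, ← Matrix.sub_mul, ← Matrix.mul_sub]
  simp only [Matrix.mul_apply, Matrix.conjTranspose_apply, Matrix.sub_apply]
  calc _ ≤ ∑ q', ∑ p', ‖T p' p‖ * ε * ‖T q' q‖ := by
        refine (norm_sum_le _ _).trans (Finset.sum_le_sum fun q' _ => ?_)
        rw [norm_mul, ← Finset.sum_mul]
        refine mul_le_mul_of_nonneg_right ((norm_sum_le _ _).trans
          (Finset.sum_le_sum fun p' _ => ?_)) (norm_nonneg _)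
        rw [norm_mul, norm_star]
        exact mul_le_mul_of_nonneg_left (h p' q').le (norm_nonneg _)
    _ = ε * ((∑ p', ‖T p' p‖) * ∑ q', ‖T q' q‖) := by
        rw [Finset.sum_mul_sum, Finset.sum_comm, Finset.mul_sum]
        refine Finset.sum_congr rfl fun p' _ => ?_
        rw [Finset.mul_sum]
        exact Finset.sum_congr rfl fun q' _ => by ring
    _ ≤ ε * (K * K) := by
        gcongr
        · exact hK p
        · exact hK q
    _ = _ := by ring

theorem norm_quadForm_sub_le {G Q : Matrix ι ι ℂ} {ε : ℝ} (h : EntryClose G Q ε)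
    (hε : 0 ≤ ε) (x : ι → ℂ) :
    ‖star x ⬝ᵥ G.mulVec x - star x ⬝ᵥ Q.mulVec x‖ ≤ ε * Fintype.card ι * ∑ p, ‖x p‖ ^ 2 := by
  rw [← dotProduct_sub, ← Matrix.sub_mulVec]
  calc _ ≤ ∑ p, ∑ q, ‖x p‖ * (ε * ‖x q‖) := by
        simp only [dotProduct, Matrix.mulVec, Matrix.sub_apply]
        refine (norm_sum_le _ _).trans (Finset.sum_le_sum fun p _ => ?_)
        rw [norm_mul, Pi.star_apply, norm_star, ← Finset.mul_sum]
        refine mul_le_mul_of_nonneg_left ((norm_sum_le _ _).trans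
          (Finset.sum_le_sum fun q _ => ?_)) (norm_nonneg _)
        rw [norm_mul]
        exact mul_le_mul_of_nonneg_right (h p q).le (norm_nonneg _)
    _ = ε * (∑ p, ‖x p‖) ^ 2 := by
        rw [sq, Finset.sum_mul_sum, Finset.mul_sum]
        refine Finset.sum_congr rfl fun p' _ => ?_
        rw [Finset.mul_sum]
        exact Finset.sum_congr rfl fun q' _ => by ring
    _ ≤ ε * (Fintype.card ι * ∑ p, ‖x p‖ ^ 2) := by
        gcongr
        exact sq_sum_le_card_mul_sum_sq
    _ = _ := by ring

theorem star_dotProduct_self_eq_sum (x : ι → ℂ) :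
    star x ⬝ᵥ x = ((∑ p, ‖x p‖ ^ 2 : ℝ) : ℂ) := by
  simp [dotProduct, Complex.conj_mul']

theorem isOpen_setOf_entryClose (Q : Matrix ι ι ℂ) (ε : ℝ) :
    IsOpen {Y : ι → Fin n → ℂ | EntryClose (gramMat Y) Q ε} := by
  simp only [EntryClose, Set.ofPred_forall]
  refine isOpen_iInter_of_finite fun p => isOpen_iInter_of_finite fun q => ?_
  have h : Continuous fun Y : ι → Fin n → ℂ => gramMat Y p q :=
    continuous_gramMat.matrix_elem p q
  exact isOpen_lt (h.sub continuous_const).norm continuous_const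

/-- Diagonal Gram entries are squared norms; the point is that `B` does not depend on the dimension.
-/
theorem exists_l2norm_le_of_entryClose (Q : Matrix ι ι ℂ) :
    ∃ B : ℝ, 1 ≤ B ∧ ∀ {n : ℕ} {Y : ι → Fin n → ℂ} {ε : ℝ}, ε ≤ 1 →
      EntryClose (gramMat Y) Q ε → ∀ p, l2norm (Y p) ≤ B := by
  have h0 : 0 ≤ ∑ p, (1 + |(Q p p).re|) := by positivity
  refine ⟨1 + ∑ p, (1 + |(Q p p).re|), by linarith, fun {n Y ε} hε hY p => ?_⟩
  have h1 : 1 + |(Q p p).re| ≤ ∑ p, (1 + |(Q p p).re|) :=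
    Finset.single_le_sum (f := fun p => 1 + |(Q p p).re|) (fun _ _ => by positivity)
      (Finset.mem_univ p)
  have h2 := le_abs_self (Q p p).re
  have h3 := abs_nonneg (Q p p).re
  have h4 := (Complex.abs_re_le_norm _).trans (hY p p).le
  rw [gramMat_self, Complex.sub_re, Complex.ofReal_re] at h4
  have h5 := (abs_le.1 h4).2
  refine (pow_le_pow_iff_left₀ (l2norm_nonneg _) (by linarith) two_ne_zero).1 ?_
  nlinarith

variable [DecidableEq ι]

open scoped MatrixOrder in
theorem exists_conjTranspose_mul_self_eq {Q : Matrix ι ι ℂ} (hQ : Q.PosDef) :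
    ∃ T : Matrix ι ι ℂ, T.det ≠ 0 ∧ Q = T.conjTranspose * T := by
  obtain ⟨T, hT⟩ := CStarAlgebra.nonneg_iff_eq_star_mul_self.1 hQ.posSemidef.nonneg
  refine ⟨T, fun h => hQ.det_pos.ne' ?_, hT⟩
  rw [hT, Matrix.det_mul, h, mul_zero]

theorem re_det_conjTranspose_mul_self (T : Matrix ι ι ℂ) :
    (T.conjTranspose * T).det.re = ‖T.det‖ ^ 2 := by
  rw [Matrix.det_mul, Matrix.det_conjTranspose, Complex.star_def, Complex.conj_mul']
  norm_cast

open scoped MatrixOrder in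
theorem exists_posSemidef_mul_self_eq {G : Matrix ι ι ℂ} (h : G.PosSemidef) :
    ∃ S : Matrix ι ι ℂ, S.PosSemidef ∧ S * S = G :=
  ⟨CFC.sqrt G, Matrix.nonneg_iff_posSemidef.1 (CFC.sqrt_nonneg G), CFC.sqrt_mul_sqrt_self G h.nonneg⟩

theorem posDef_of_entryClose_one {G : Matrix ι ι ℂ} (hG : G.PosSemidef) {τ : ℝ} (hτ : 0 ≤ τ)
    (h : EntryClose G 1 τ) (hc : Fintype.card ι * τ < 1) : G.PosDef := by
  refine .of_dotProduct_mulVec_pos hG.isHermitian fun x hx => ?_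
  have h1 := hG.dotProduct_mulVec_nonneg x
  have h2 := norm_quadForm_sub_le h hτ x
  have h3 : 0 < ∑ p, ‖x p‖ ^ 2 := by
    obtain ⟨p, hp⟩ := Function.ne_iff.1 hx
    exact Finset.sum_pos' (fun _ _ => by positivity) ⟨p, Finset.mem_univ _, by
      have : 0 < ‖x p‖ := norm_pos_iff.2 hp
      positivity⟩
  rw [Matrix.one_mulVec, star_dotProduct_self_eq_sum] at h2
  refine lt_of_le_of_ne h1 fun h0 => ?_
  rw [← h0, zero_sub, norm_neg, Complex.norm_real, Real.norm_of_nonneg h3.le] at h2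
  nlinarith

/-- Symmetric orthonormalisation: with `G` the Gram matrix and `S` its positive square root, `e` is
`c` recombined by `S⁻¹`. The distances from `c` to `e` are read off the diagonal of `(S - 1)²`, and
`(S - 1)² ≤ (G - 1)²` because `G - 1 = (S - 1)(S + 1)` with `S ≥ 0`. -/
theorem exists_orthonormal_near {c : ι → Fin n → ℂ} {τ : ℝ} (hτ : 0 ≤ τ)
    (hc : c ∈ nearOrthonormal ι n τ) (h1 : Fintype.card ι * τ < 1) :
    ∃ e : ι → Fin n → ℂ, gramMat e = 1 ∧ ∀ q, l2norm (c q - e q) ≤ Fintype.card ι * τ := by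
  have hpd := posDef_of_entryClose_one (posSemidef_gramMat c) hτ hc h1
  obtain ⟨S, hS, hSS⟩ := exists_posSemidef_mul_self_eq (posSemidef_gramMat c)
  have hdet : IsUnit S.det := by
    rw [isUnit_iff_ne_zero]
    intro h
    apply hpd.det_pos.ne'
    rw [← hSS, Matrix.det_mul, h, mul_zero]
  have hSinv : S⁻¹.conjTranspose = S⁻¹ := by
    rw [Matrix.conjTranspose_nonsing_inv, hS.isHermitian]
  have he1 : gramMat (recombine S⁻¹ c) = 1 := by
    rw [gramMat_recombine, hSinv, ← hSS, ← Matrix.mul_assoc, Matrix.nonsing_inv_mul _ hdet,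
      Matrix.one_mul, Matrix.mul_nonsing_inv _ hdet]
  refine ⟨recombine S⁻¹ c, he1, fun q => ?_⟩
  set e := recombine S⁻¹ c with he
  have hce : c = recombine S e := by
    rw [he, recombine_recombine, Matrix.nonsing_inv_mul _ hdet, recombine_one]
  have hdiff : recombine (S - 1) e = c - e := by
    have h2 : recombine (S - 1) e = recombine S e - recombine 1 e := by
      ext q a; simp [recombine, sub_mul]
    rw [h2, ← hce, recombine_one]
  have hq : (((S - 1).conjTranspose * (S - 1)) q q).re = l2norm (c q - e q) ^ 2 := by
    have h3 := gramMat_self (recombine (S - 1) e) q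
    rw [gramMat_recombine, he1, Matrix.mul_one, hdiff] at h3
    rw [h3, Complex.ofReal_re]; rfl
  have hS1 : (S - 1).conjTranspose = S - 1 := by
    rw [Matrix.conjTranspose_sub, hS.isHermitian, Matrix.conjTranspose_one]
  have hps : ((S - 1).conjTranspose * (S + S + S * S) * (S - 1)).PosSemidef := by
    refine Matrix.PosSemidef.conjTranspose_mul_mul_same ((hS.add hS).add ?_) _
    rw [hSS]; exact posSemidef_gramMat c
  have hle : (((S - 1).conjTranspose * (S - 1)) q q).re ≤
      (((gramMat c - 1).conjTranspose * (gramMat c - 1)) q q).re := by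
    have h4 : (gramMat c - 1).conjTranspose * (gramMat c - 1) =
        (S - 1).conjTranspose * (S - 1) +
          (S - 1).conjTranspose * (S + S + S * S) * (S - 1) := by
      rw [Matrix.conjTranspose_sub, (posSemidef_gramMat c).isHermitian, Matrix.conjTranspose_one,
        hS1, ← hSS]
      noncomm_ring
    rw [h4, Matrix.add_apply, Complex.add_re]
    have := (Complex.le_def.1 (hps.diag_nonneg (i := q))).1
    simp only [Complex.zero_re] at this
    linarith
  have hub : (((gramMat c - 1).conjTranspose * (gramMat c - 1)) q q).re ≤
      Fintype.card ι * τ ^ 2 := by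
    rw [Matrix.mul_apply, Complex.re_sum]
    calc _ ≤ ∑ _p : ι, τ ^ 2 := by
          refine Finset.sum_le_sum fun p _ => ?_
          rw [Matrix.conjTranspose_apply, Complex.star_def, Complex.conj_mul',
            ← Complex.ofReal_pow, Complex.ofReal_re]
          exact pow_le_pow_left₀ (norm_nonneg _) (hc p q).le 2
      _ = _ := by simp
  have hcard : (1 : ℝ) ≤ Fintype.card ι := by
    exact_mod_cast Fintype.card_pos_iff.2 ⟨q⟩
  refine (sq_le_sq₀ (l2norm_nonneg _) (by positivity)).1 ?_
  nlinarith [mul_le_mul_of_nonneg_right hcard (show 0 ≤ Fintype.card ι * τ ^ 2 by positivity)]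

theorem exists_unitary_mulVec_eq {e e' : ι → Fin n → ℂ} (he : gramMat e = 1)
    (he' : gramMat e' = 1) : ∃ V : Matrix.unitaryGroup (Fin n) ℂ,
      ∀ p, (V : Matrix (Fin n) (Fin n) ℂ).mulVec (e p) = e' p := by
  have hon : Orthonormal ℂ fun p => (WithLp.toLp 2 (e p) : EuclideanSpace ℂ (Fin n)) := by
    rw [orthonormal_iff_ite]
    intro p q
    rw [inner_toLp_eq, ← gramMat_apply, he, Matrix.one_apply]
  have hcard := hon.linearIndependent.fintype_card_le_finrank
  rw [finrank_euclideanSpace, Fintype.card_fin] at hcard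
  obtain ⟨f⟩ := Function.Embedding.nonempty_of_card_le (α := ι) (β := Fin n) (by simpa using hcard)
  obtain ⟨U, hU⟩ := exists_unitary_mulVec_eq_single he f
  obtain ⟨U', hU'⟩ := exists_unitary_mulVec_eq_single he' f
  refine ⟨U' * U⁻¹, fun p => ?_⟩
  rw [← hU p, ← hU' p, Matrix.mulVec_mulVec]
  have : ((U' * U⁻¹ : Matrix.unitaryGroup (Fin n) ℂ) : Matrix (Fin n) (Fin n) ℂ) *
      (U : Matrix (Fin n) (Fin n) ℂ) = U' := by
    rw [← Submonoid.coe_mul, inv_mul_cancel_right]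
  rw [this]

/-- Nearly orthonormal tuples are nearly unitarily equivalent. -/
theorem exists_unitary_near {c c' : ι → Fin n → ℂ} {τ : ℝ} (hτ : 0 ≤ τ)
    (hc : c ∈ nearOrthonormal ι n τ) (hc' : c' ∈ nearOrthonormal ι n τ)
    (h1 : Fintype.card ι * τ < 1) : ∃ V : Matrix.unitaryGroup (Fin n) ℂ,
      ∀ q, l2norm ((V : Matrix (Fin n) (Fin n) ℂ).mulVec (c' q) - c q) ≤
        2 * (Fintype.card ι * τ) := by
  obtain ⟨e, he, hce⟩ := exists_orthonormal_near hτ hc h1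
  obtain ⟨e', he', hce'⟩ := exists_orthonormal_near hτ hc' h1
  obtain ⟨V, hV⟩ := exists_unitary_mulVec_eq he' he
  refine ⟨V, fun q => ?_⟩
  have : (V : Matrix (Fin n) (Fin n) ℂ).mulVec (c' q) - c q =
      (V : Matrix (Fin n) (Fin n) ℂ).mulVec (c' q - e' q) + (e q - c q) := by
    rw [Matrix.mulVec_sub, hV]; abel
  rw [this]
  refine (l2norm_add_le _ _).trans ?_
  rw [l2norm_mulVec_unitary, l2norm_sub_comm (e q)]
  linarith [hce q, hce' q]

/-- The multiple of the identity dominates the entrywise error in the quadratic form and makes the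
matrix invertible, equal to some `T* T`. Undoing the recombination by `T` then lands in the unit
polyball. Singular `Q` is allowed; this is what later produces the value `-∞`. -/
theorem volume_entryClose_le {Q : Matrix ι ι ℂ} (hQ : Q.PosSemidef) {ε : ℝ} (hε : 0 < ε) :
    volume {Y : ι → Fin n → ℂ | EntryClose (gramMat Y) Q ε} ≤
      ENNReal.ofReal ((Q + (((Fintype.card ι + 1) * ε : ℝ) : ℂ) • 1).det.re ^ n) *
        ballVolume n ^ Fintype.card ι := by
  set s : ℝ := (Fintype.card ι + 1) * ε with hs
  have hs0 : 0 < s := by positivity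
  have hQ' : (Q + (s : ℂ) • 1).PosDef :=
    Matrix.PosDef.posSemidef_add hQ (Matrix.PosDef.one.smul (by exact_mod_cast hs0))
  obtain ⟨T, hT, hQT⟩ := exists_conjTranspose_mul_self_eq hQ'
  rw [volume_eq_recombine_preimage T hT, hQT, re_det_conjTranspose_mul_self, ← pow_mul,
    ← volume_unit_polyball]
  refine mul_le_mul_right (measure_mono fun c hc p => ?_) _
  have hc' : EntryClose (gramMat (recombine T c)) Q ε := hc
  have hTu : IsUnit T.det := isUnit_iff_ne_zero.2 hT
  -- Testing the forms on this vector isolates the diagonal entry at `p` of the Gram matrix of `c`,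
  -- which is the squared norm to be bounded.
  set x : ι → ℂ := T⁻¹.mulVec (Pi.single p 1) with hx
  have hTx : T.mulVec x = Pi.single p 1 := by
    rw [hx, Matrix.mulVec_mulVec, Matrix.mul_nonsing_inv _ hTu, Matrix.one_mulVec]
  have key : ∀ G : Matrix ι ι ℂ, star x ⬝ᵥ (T.conjTranspose * G * T).mulVec x = G p p := by
    intro G
    rw [← Matrix.mulVec_mulVec, hTx, ← Matrix.mulVec_mulVec, Matrix.dotProduct_mulVec,
      ← Matrix.star_mulVec, hTx, ← Pi.single_star]
    simp
  have h1 := norm_quadForm_sub_le hc' hε.le x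
  rw [gramMat_recombine, key, gramMat_self] at h1
  have h2 : star x ⬝ᵥ Q.mulVec x = 1 - ((s * ∑ p, ‖x p‖ ^ 2 : ℝ) : ℂ) := by
    have h3 := key 1
    rw [Matrix.mul_one, ← hQT, Matrix.add_mulVec, dotProduct_add, Matrix.smul_mulVec,
      Matrix.one_mulVec, dotProduct_smul, star_dotProduct_self_eq_sum, Matrix.one_apply_eq] at h3
    rw [← h3]; push_cast; simp
  rw [h2] at h1
  have h4 : ((l2norm (c p) ^ 2 : ℝ) : ℂ) - (1 - ((s * ∑ p, ‖x p‖ ^ 2 : ℝ) : ℂ)) =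
      ((l2norm (c p) ^ 2 - (1 - s * ∑ p, ‖x p‖ ^ 2) : ℝ) : ℂ) := by push_cast; ring
  rw [h4, Complex.norm_real] at h1
  have h5 : 0 < ∑ p, ‖x p‖ ^ 2 := by
    have hx0 : x ≠ 0 := by
      rintro h0
      rw [h0, Matrix.mulVec_zero] at hTx
      simpa using (congrFun hTx p).symm
    obtain ⟨p, hp⟩ := Function.ne_iff.1 hx0
    exact Finset.sum_pos' (fun _ _ => by positivity) ⟨p, Finset.mem_univ _, by
      have : 0 < ‖x p‖ := norm_pos_iff.2 hp
      positivity⟩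
  have h6 := (abs_le.1 h1).2
  have h7 : l2norm (c p) ^ 2 < 1 ^ 2 := by
    have : 0 < ε * ∑ p, ‖x p‖ ^ 2 := by positivity
    rw [hs] at h6
    nlinarith
  exact lt_of_pow_lt_pow_left₀ 2 zero_le_one h7

/-- Recombining nearly orthonormal tuples by `T`, where `Q = T* T`, gives Gram matrices near `Q`.
The factor `2` is the concentration loss. -/
theorem le_volume_entryClose {Q : Matrix ι ι ℂ} (hQ : Q.PosDef) {ε : ℝ} (hε : 0 < ε) :
    ∀ᶠ n : ℕ in atTop, ENNReal.ofReal (Q.det.re ^ n) * ballVolume n ^ Fintype.card ι ≤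
      2 * volume {Y : ι → Fin n → ℂ | EntryClose (gramMat Y) Q ε} := by
  obtain ⟨T, hT, hQT⟩ := exists_conjTranspose_mul_self_eq hQ
  obtain ⟨K, hK0, hK⟩ := exists_colSum_le T
  set η : ℝ := min 1 (ε / (2 * K ^ 2)) with hη
  have hη0 : 0 < η := by positivity
  filter_upwards [ballVolume_pow_le_nearOrthonormal ι hη0 (min_le_left _ _)] with n hn
  rw [volume_eq_recombine_preimage T hT, hQT, re_det_conjTranspose_mul_self, ← pow_mul,
    mul_left_comm (2 : ℝ≥0∞)]
  refine mul_le_mul_right (hn.trans (mul_le_mul_right (measure_mono fun c hc => ?_) _)) _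
  intro p q
  have h1 := norm_conj_sub_le hc.2 hK hK0.le hη0.le p q
  rw [Matrix.mul_one] at h1
  rw [gramMat_recombine]
  refine h1.trans_lt ?_
  have h2 : η ≤ ε / (2 * K ^ 2) := min_le_right _ _
  calc η * K ^ 2 ≤ ε / (2 * K ^ 2) * K ^ 2 := by gcongr
    _ = ε / 2 := by field_simp
    _ < ε := by linarith

theorem volume_nearOrthonormal_le {τ : ℝ} (hτ : 0 ≤ τ) :
    volume (nearOrthonormal ι n τ) ≤
      ENNReal.ofReal ((1 + τ) ^ (n * Fintype.card ι)) * ballVolume n ^ Fintype.card ι := by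
  have := volume_polyball (n := n) (0 : ι → Fin n → ℂ) (fun _ => √(1 + τ)) fun _ => by positivity
  have h2 : ∏ _p : ι, ENNReal.ofReal (√(1 + τ) ^ (2 * n)) * ballVolume n =
      ENNReal.ofReal ((1 + τ) ^ (n * Fintype.card ι)) * ballVolume n ^ Fintype.card ι := by
    rw [Finset.prod_const, Finset.card_univ, mul_pow, pow_mul, Real.sq_sqrt (by positivity),
      ← ENNReal.ofReal_pow (by positivity), ← pow_mul]
  rw [← h2, ← this]
  refine measure_mono fun c hc p => ?_
  have h3 := hc p p
  rw [gramMat_self, Matrix.one_apply_eq, ← Complex.ofReal_one, ← Complex.ofReal_sub,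
    Complex.norm_real] at h3
  rw [Pi.zero_apply, sub_zero]
  refine Real.lt_sqrt_of_sq_lt ?_
  linarith [(abs_lt.1 h3).2]

end GramEstimates

/-! ### Haar probability of carrying one tuple near another: averaging over targets -/

section HaarUnitary

variable {ι : Type*} {n : ℕ}

/-- The unitary matrices that carry the tuple `a` to within `δ` of the tuple `b`. -/
def nearTransporters (a b : ι → Fin n → ℂ) (δ : ℝ) : Set (Matrix.unitaryGroup (Fin n) ℂ) :=
  {U | ∀ q, l2norm ((U : Matrix (Fin n) (Fin n) ℂ).mulVec (a q) - b q) < δ}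

theorem continuous_mulVec_unitary :
    Continuous fun x : Matrix.unitaryGroup (Fin n) ℂ × (Fin n → ℂ) =>
      (x.1 : Matrix (Fin n) (Fin n) ℂ).mulVec x.2 :=
  (continuous_subtype_val.comp continuous_fst).matrix_mulVec continuous_snd

theorem isOpen_setOf_mem_nearTransporters [Finite ι] (δ : ℝ) :
    IsOpen {x : Matrix.unitaryGroup (Fin n) ℂ × (ι → Fin n → ℂ) × (ι → Fin n → ℂ) |
      x.1 ∈ nearTransporters x.2.1 x.2.2 δ} := by
  have h : ∀ q : ι, Continuous fun x : Matrix.unitaryGroup (Fin n) ℂ ×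
      (ι → Fin n → ℂ) × (ι → Fin n → ℂ) =>
        l2norm ((x.1 : Matrix (Fin n) (Fin n) ℂ).mulVec (x.2.1 q) - x.2.2 q) := fun q =>
    continuous_l2norm.comp ((continuous_mulVec_unitary.comp (continuous_fst.prodMk
      ((continuous_apply q).comp (continuous_fst.comp continuous_snd)))).sub
        ((continuous_apply q).comp (continuous_snd.comp continuous_snd)))
  have e : {x : Matrix.unitaryGroup (Fin n) ℂ × (ι → Fin n → ℂ) × (ι → Fin n → ℂ) |
      x.1 ∈ nearTransporters x.2.1 x.2.2 δ} = ⋂ q, {x |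
        l2norm ((x.1 : Matrix (Fin n) (Fin n) ℂ).mulVec (x.2.1 q) - x.2.2 q) < δ} := by
    ext x; simp [nearTransporters]
  rw [e]
  exact isOpen_iInter_of_finite fun q => isOpen_lt (h q) continuous_const

/-- Fubini for pairs of a nearly orthonormal tuple and a unitary, followed by the substitution `Y =
recombine T c`. The right side involves only volumes near the rotated tuple `U a`. -/
theorem lintegral_measure_nearTransporters [Fintype ι] [DecidableEq ι]
    (μ : Measure (Matrix.unitaryGroup (Fin n) ℂ)) [IsProbabilityMeasure μ] (a : ι → Fin n → ℂ)
    {T : Matrix ι ι ℂ} (hT : T.det ≠ 0) (δ τ : ℝ) :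
    (∫⁻ c in nearOrthonormal ι n τ, μ (nearTransporters a (recombine T c) δ)) *
        ENNReal.ofReal (‖T.det‖ ^ (2 * n)) =
      ∫⁻ U, volume {Y : ι → Fin n → ℂ | U ∈ nearTransporters a Y δ ∧
        recombine T⁻¹ Y ∈ nearOrthonormal ι n τ} ∂μ := by
  let E : Set ((ι → Fin n → ℂ) × Matrix.unitaryGroup (Fin n) ℂ) :=
    {x | x.2 ∈ nearTransporters a (recombine T x.1) δ}
  have hE : MeasurableSet E :=
    ((isOpen_setOf_mem_nearTransporters δ).preimage (continuous_snd.prodMk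
      (continuous_const.prodMk ((continuous_recombine T).comp continuous_fst)))).measurableSet
  have hW : MeasurableSet (nearOrthonormal ι n τ) := (isOpen_setOf_entryClose _ _).measurableSet
  have h1 := Measure.prod_apply (μ := volume.restrict (nearOrthonormal ι n τ)) (ν := μ) hE
  rw [Measure.prod_apply_symm hE] at h1
  have h2 : ∀ U, volume.restrict (nearOrthonormal ι n τ) ((fun x => (x, U)) ⁻¹' E) *
      ENNReal.ofReal (‖T.det‖ ^ (2 * n)) = volume {Y : ι → Fin n → ℂ |
        U ∈ nearTransporters a Y δ ∧ recombine T⁻¹ Y ∈ nearOrthonormal ι n τ} := by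
    intro U
    rw [Measure.restrict_apply' hW, volume_eq_recombine_preimage T hT {Y : ι → Fin n → ℂ |
      U ∈ nearTransporters a Y δ ∧ recombine T⁻¹ Y ∈ nearOrthonormal ι n τ}, mul_comm]
    congr 2
    ext c
    simp only [Set.mem_inter_iff, Set.mem_preimage, Set.mem_ofPred_eq, E, recombine_recombine,
      Matrix.mul_nonsing_inv _ (isUnit_iff_ne_zero.2 hT), recombine_one]
  simp only [← h2]
  rw [lintegral_mul_const' _ _ ENNReal.ofReal_ne_top, h1]
  rfl

variable (μ : Measure (Matrix.unitaryGroup (Fin n) ℂ)) [μ.IsMulLeftInvariant]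

theorem measure_nearTransporters_mulVec (a b : ι → Fin n → ℂ) (δ : ℝ)
    (V : Matrix.unitaryGroup (Fin n) ℂ) :
    μ (nearTransporters a (fun q => (V : Matrix (Fin n) (Fin n) ℂ).mulVec (b q)) δ) =
      μ (nearTransporters a b δ) := by
  rw [← measure_preimage_mul μ V]
  congr 1
  ext U
  simp only [nearTransporters, Set.mem_preimage, Set.mem_ofPred_eq, Submonoid.coe_mul,
    ← Matrix.mulVec_mulVec, ← Matrix.mulVec_sub, l2norm_mulVec_unitary]

/-- By left invariance the target may be rotated for free. Up to a small change of radius the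
probability therefore depends on the target only through its Gram matrix, so it can be replaced by
its average. -/
theorem measure_nearTransporters_le {a b b' : ι → Fin n → ℂ} {δ ρ η : ℝ} (hρ : δ + η ≤ ρ)
    (V : Matrix.unitaryGroup (Fin n) ℂ)
    (h : ∀ q, l2norm ((V : Matrix (Fin n) (Fin n) ℂ).mulVec (b q) - b' q) ≤ η) :
    μ (nearTransporters a b δ) ≤ μ (nearTransporters a b' ρ) := by
  rw [← measure_nearTransporters_mulVec μ a b δ V]
  refine measure_mono fun U hU q => ?_
  have h1 := l2norm_add_le ((U : Matrix (Fin n) (Fin n) ℂ).mulVec (a q) -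
    (V : Matrix (Fin n) (Fin n) ℂ).mulVec (b q)) ((V : Matrix (Fin n) (Fin n) ℂ).mulVec (b q) - b' q)
  rw [sub_add_sub_cancel] at h1
  have h2 := hU q
  simp only at h2
  linarith [h q]

variable [Fintype ι] [DecidableEq ι]

theorem exists_unitary_near_recombine {c c' : ι → Fin n → ℂ} {T : Matrix ι ι ℂ} {τ K : ℝ}
    (hK : ∀ q, ∑ p, ‖T p q‖ ≤ K) (hτ : 0 ≤ τ) (hτ1 : Fintype.card ι * τ < 1)
    (hc : c ∈ nearOrthonormal ι n τ) (hc' : c' ∈ nearOrthonormal ι n τ) :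
    ∃ V : Matrix.unitaryGroup (Fin n) ℂ, ∀ q,
      l2norm ((V : Matrix (Fin n) (Fin n) ℂ).mulVec (recombine T c' q) - recombine T c q) ≤
        K * (2 * (Fintype.card ι * τ)) := by
  obtain ⟨V, hV⟩ := exists_unitary_near hτ hc hc' hτ1
  refine ⟨V, fun q => ?_⟩
  rw [← recombine_mulVec, ← Pi.sub_apply, ← recombine_sub]
  exact l2norm_recombine_le T _ hK (by positivity) hV q

variable [IsProbabilityMeasure μ]

theorem measure_nearTransporters_mul_le (a : ι → Fin n → ℂ) {c' : ι → Fin n → ℂ}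
    {T : Matrix ι ι ℂ} (hT : T.det ≠ 0) {δ ρ τ K : ℝ} (hK : ∀ q, ∑ p, ‖T p q‖ ≤ K) (hτ : 0 ≤ τ)
    (hτ1 : Fintype.card ι * τ < 1) (hc' : c' ∈ nearOrthonormal ι n τ) (hρ0 : 0 < ρ)
    (hρ : δ + K * (2 * (Fintype.card ι * τ)) ≤ ρ) :
    μ (nearTransporters a (recombine T c') δ) * volume (nearOrthonormal ι n τ) *
        ENNReal.ofReal (‖T.det‖ ^ (2 * n)) ≤
      (ENNReal.ofReal (ρ ^ (2 * n)) * ballVolume n) ^ Fintype.card ι := by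
  have hW : MeasurableSet (nearOrthonormal ι n τ) := (isOpen_setOf_entryClose _ _).measurableSet
  calc _ = (∫⁻ _c in nearOrthonormal ι n τ, μ (nearTransporters a (recombine T c') δ)) *
        ENNReal.ofReal (‖T.det‖ ^ (2 * n)) := by rw [setLIntegral_const]
    _ ≤ (∫⁻ c in nearOrthonormal ι n τ, μ (nearTransporters a (recombine T c) ρ)) *
        ENNReal.ofReal (‖T.det‖ ^ (2 * n)) := by
      refine mul_le_mul_left (setLIntegral_mono' hW fun c hc => ?_) _
      obtain ⟨V, hV⟩ := exists_unitary_near_recombine hK hτ hτ1 hc hc'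
      exact measure_nearTransporters_le μ hρ V hV
    _ = _ := lintegral_measure_nearTransporters μ a hT ρ τ
    _ ≤ ∫⁻ _U, (ENNReal.ofReal (ρ ^ (2 * n)) * ballVolume n) ^ Fintype.card ι ∂μ := by
      refine lintegral_mono fun U => ?_
      have := volume_polyball (fun q => (U : Matrix (Fin n) (Fin n) ℂ).mulVec (a q))
        (fun _ => ρ) fun _ => hρ0
      rw [Finset.prod_const, Finset.card_univ] at this
      rw [← this]
      refine measure_mono fun Y hY q => ?_
      rw [l2norm_sub_comm]
      exact hY.1 q
    _ = _ := by simp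

theorem le_measure_nearTransporters_mul (a : ι → Fin n → ℂ) {c' : ι → Fin n → ℂ}
    {T : Matrix ι ι ℂ} (hT : T.det ≠ 0) {δ ρ τ K : ℝ} (hK : ∀ q, ∑ p, ‖T p q‖ ≤ K) (hτ : 0 ≤ τ)
    (hτ1 : Fintype.card ι * τ < 1) (hc' : c' ∈ nearOrthonormal ι n τ)
    (hρ : ρ + K * (2 * (Fintype.card ι * τ)) ≤ δ) {L : ℝ≥0∞}
    (hL : ∀ U : Matrix.unitaryGroup (Fin n) ℂ, L ≤ 2 * volume {Y : ι → Fin n → ℂ |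
      U ∈ nearTransporters a Y ρ ∧ recombine T⁻¹ Y ∈ nearOrthonormal ι n τ}) :
    L ≤ 2 * (μ (nearTransporters a (recombine T c') δ) * volume (nearOrthonormal ι n τ) *
        ENNReal.ofReal (‖T.det‖ ^ (2 * n))) := by
  have hW : MeasurableSet (nearOrthonormal ι n τ) := (isOpen_setOf_entryClose _ _).measurableSet
  calc L = ∫⁻ _U, L ∂μ := by simp
    _ ≤ ∫⁻ U, 2 * volume {Y : ι → Fin n → ℂ |
        U ∈ nearTransporters a Y ρ ∧ recombine T⁻¹ Y ∈ nearOrthonormal ι n τ} ∂μ :=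
      lintegral_mono fun U => hL U
    _ = 2 * ∫⁻ U, volume {Y : ι → Fin n → ℂ |
        U ∈ nearTransporters a Y ρ ∧ recombine T⁻¹ Y ∈ nearOrthonormal ι n τ} ∂μ :=
      lintegral_const_mul' _ _ (by simp)
    _ = 2 * ((∫⁻ c in nearOrthonormal ι n τ, μ (nearTransporters a (recombine T c) ρ)) *
        ENNReal.ofReal (‖T.det‖ ^ (2 * n))) := by
      rw [lintegral_measure_nearTransporters μ a hT]
    _ ≤ 2 * ((∫⁻ _c in nearOrthonormal ι n τ, μ (nearTransporters a (recombine T c') δ)) *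
        ENNReal.ofReal (‖T.det‖ ^ (2 * n))) := by
      refine mul_le_mul_right (mul_le_mul_left (setLIntegral_mono' hW fun c hc => ?_) _) _
      obtain ⟨V, hV⟩ := exists_unitary_near_recombine hK hτ hτ1 hc' hc
      exact measure_nearTransporters_le μ hρ V hV
    _ = _ := by rw [setLIntegral_const]

end HaarUnitary

/-! ### Exponential asymptotics of these probabilities -/

section HaarAsymptotics

theorem measure_nearTransporters_mul_det_le (ι : Type*) [Fintype ι] [DecidableEq ι]
    {K₀ δ κ : ℝ} (hK₀ : 0 < K₀) (hδ : 0 < δ) (hκ : 0 < κ) : ∀ᶠ n : ℕ in atTop,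
      ∀ (μ : Measure (Matrix.unitaryGroup (Fin n) ℂ)) [μ.IsMulLeftInvariant]
        [IsProbabilityMeasure μ] (a b : ι → Fin n → ℂ), (gramMat b).det ≠ 0 →
        (∀ q, l2norm (b q) ≤ K₀) →
        μ (nearTransporters a b δ) * ENNReal.ofReal ((gramMat b).det.re ^ n) ≤
          2 * ENNReal.ofReal (((1 + κ) * δ) ^ (2 * n)) ^ Fintype.card ι := by
  set m : ℝ := ((Fintype.card ι : ℕ) : ℝ) with hm
  have hm0 : 0 ≤ m := by positivity
  -- The first bound gives `m τ < 1`; the second keeps the error `m K₀ · 2 m τ` from comparing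
  -- targets below `κ δ`.
  set τ : ℝ := min (1 / (m + 1)) (κ * δ / (2 * m * (m * K₀) + 1)) with hτ
  have hτ0 : 0 < τ := by positivity
  have hτ1 : τ ≤ 1 / (m + 1) := min_le_left _ _
  have hτ2 : τ ≤ κ * δ / (2 * m * (m * K₀) + 1) := min_le_right _ _
  rw [le_div_iff₀ (by positivity)] at hτ1 hτ2
  filter_upwards [ballVolume_pow_le_nearOrthonormal ι hτ0 (by nlinarith)] with n hn μ _ _ a b hb hbK
  have hpd : (gramMat b).PosDef := (posSemidef_gramMat b).posDef_iff_det_ne_zero.2 hb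
  obtain ⟨T, hT, hbT⟩ := exists_conjTranspose_mul_self_eq hpd
  have hTu : IsUnit T.det := isUnit_iff_ne_zero.2 hT
  set c' := recombine T⁻¹ b with hc'
  have hbc : b = recombine T c' := by
    rw [hc', recombine_recombine, Matrix.nonsing_inv_mul _ hTu, recombine_one]
  have hc'1 : gramMat c' = 1 := by
    have hTu' : IsUnit T.conjTranspose.det := by
      rw [Matrix.det_conjTranspose]; exact hTu.star
    rw [hc', gramMat_recombine, hbT, Matrix.conjTranspose_nonsing_inv, ← Matrix.mul_assoc,
      Matrix.nonsing_inv_mul _ hTu', Matrix.one_mul, Matrix.mul_nonsing_inv _ hTu]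
  have hc'W : c' ∈ nearOrthonormal ι n τ := fun p q => by rw [hc'1, sub_self, norm_zero]; exact hτ0
  -- Column `q` of `T` has the Euclidean norm of `b q`, so the bound is uniform in `b` however small
  -- its Gram determinant is.
  have hK : ∀ q, ∑ p, ‖T p q‖ ≤ m * K₀ := by
    intro q
    have h1 : ∑ p, ‖T p q‖ ^ 2 = l2norm (b q) ^ 2 := by
      have := gramMat_self b q
      rw [hbT, Matrix.mul_apply] at this
      simp only [Matrix.conjTranspose_apply, Complex.star_def, Complex.conj_mul'] at this
      exact_mod_cast this
    have h2 : ∀ p, ‖T p q‖ ≤ K₀ := fun p => by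
      have h3 := Finset.single_le_sum (f := fun p => ‖T p q‖ ^ 2) (fun _ _ => by positivity)
        (Finset.mem_univ p)
      simp only [h1] at h3
      exact (pow_le_pow_iff_left₀ (norm_nonneg _) hK₀.le two_ne_zero).1
        (h3.trans (pow_le_pow_left₀ (l2norm_nonneg _) (hbK q) 2))
    calc _ ≤ ∑ _p : ι, K₀ := Finset.sum_le_sum fun p _ => h2 p
      _ = _ := by simp [hm]
  have hmain := measure_nearTransporters_mul_le μ a hT (δ := δ) (ρ := (1 + κ) * δ) hK hτ0.le
    (by rw [← hm]; nlinarith) hc'W (by positivity) (by rw [← hm]; nlinarith)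
  rw [← hbc, mul_pow] at hmain
  rw [hbT, re_det_conjTranspose_mul_self, ← pow_mul]
  set x := μ (nearTransporters a b δ)
  set D := ENNReal.ofReal (‖T.det‖ ^ (2 * n))
  have hv0 : ballVolume n ^ Fintype.card ι ≠ 0 := pow_ne_zero _ (ballVolume_ne_zero n)
  have hvt : ballVolume n ^ Fintype.card ι ≠ ⊤ := ENNReal.pow_ne_top (ballVolume_ne_top n)
  refine (ENNReal.mul_le_mul_iff_left hv0 hvt).1 ?_
  calc x * D * ballVolume n ^ Fintype.card ι ≤ x * D * (2 * volume (nearOrthonormal ι n τ)) := by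
        refine mul_le_mul_right (hn.trans ?_) _
        gcongr
        exact Set.inter_subset_right
    _ = 2 * (x * volume (nearOrthonormal ι n τ) * D) := by ring
    _ ≤ 2 * _ := mul_le_mul_right hmain _
    _ = _ := by ring

/-- Most points within `r = (1 - κ) δ` of `U a` differ from it by a nearly orthogonal displacement,
so their Gram matrices stay within `4 δ²` of `Q`. Comparing targets whose Gram errors are of order
`δ²` changes the radius by order `δ²`, which for small `δ` fits into the slack `κ δ`. This is why
the hypotheses ask for closeness `δ ^ 2` and why `δ` must be small. -/
theorem le_measure_nearTransporters_mul_det {ι : Type*} [Fintype ι] [DecidableEq ι]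
    {Q : Matrix ι ι ℂ} (hQ : Q.PosDef) {κ : ℝ} (hκ : 0 < κ) (hκ1 : κ < 1) :
    ∀ᶠ δ : ℝ in 𝓝[>] 0, ∀ᶠ n : ℕ in atTop,
      ∀ (μ : Measure (Matrix.unitaryGroup (Fin n) ℂ)) [μ.IsMulLeftInvariant]
        [IsProbabilityMeasure μ] (a b : ι → Fin n → ℂ), EntryClose (gramMat a) Q (δ ^ 2) →
        EntryClose (gramMat b) Q (δ ^ 2) →
        ENNReal.ofReal (((1 - κ) * δ) ^ (2 * n)) ^ Fintype.card ι ≤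
          2 * (μ (nearTransporters a b δ) * ENNReal.ofReal (Q.det.re ^ n) *
            ENNReal.ofReal ((1 + κ) ^ (n * Fintype.card ι))) := by
  obtain ⟨T, hT, hQT⟩ := exists_conjTranspose_mul_self_eq hQ
  have hTu : IsUnit T.det := isUnit_iff_ne_zero.2 hT
  obtain ⟨K, hK0, hK⟩ := exists_colSum_le T
  obtain ⟨K', hK'0, hK'⟩ := exists_colSum_le T⁻¹
  set m : ℝ := ((Fintype.card ι : ℕ) : ℝ) with hm
  have hm0 : 0 ≤ m := by positivity
  set C : ℝ := 4 * K' ^ 2 + 1 with hC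
  have hC0 : 0 < C := by positivity
  obtain ⟨B, hB1, hB⟩ := exists_l2norm_le_of_entryClose Q
  have hlim : ∀ c : ℝ, 0 < c → ∀ᶠ δ : ℝ in 𝓝[>] 0, δ < c := fun c hc =>
    nhdsWithin_le_nhds (Iio_mem_nhds hc)
  filter_upwards [self_mem_nhdsWithin, hlim 1 one_pos, hlim (κ / C) (by positivity),
    hlim (1 / ((m + 1) * C)) (by positivity), hlim (κ / (K * (2 * ((m + 1) * C)))) (by positivity)]
    with δ hδ0 hδ1 hδ2 hδ3 hδ4
  rw [Set.mem_Ioi] at hδ0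
  rw [lt_div_iff₀ (by positivity)] at hδ2 hδ3 hδ4
  set τ : ℝ := C * δ ^ 2 with hτ
  have hτ0 : 0 < τ := by positivity
  have hτκ : τ ≤ κ := by rw [hτ]; nlinarith
  have hτm : m * τ < 1 := by
    have : (m + 1) * τ < 1 := by
      rw [hτ]
      calc (m + 1) * (C * δ ^ 2) = δ * (δ * ((m + 1) * C)) := by ring
        _ < 1 * 1 := by gcongr
        _ = 1 := one_mul 1
    nlinarith
  set r : ℝ := (1 - κ) * δ with hr
  have hr0 : 0 < r := mul_pos (by linarith) hδ0
  have hrδ : r ≤ δ := by rw [hr]; nlinarith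
  have hρ : r + K * (2 * (m * τ)) ≤ δ := by
    have h1 : K * (2 * (m * τ)) ≤ δ * κ := by
      calc K * (2 * (m * τ)) ≤ K * (2 * ((m + 1) * τ)) := by gcongr; linarith
        _ = δ * (δ * (K * (2 * ((m + 1) * C)))) := by rw [hτ]; ring
        _ ≤ δ * κ := by gcongr
    rw [hr]; linarith
  have hconj : ∀ G : Matrix ι ι ℂ, T⁻¹.conjTranspose * (T.conjTranspose * G * T) * T⁻¹ = G := by
    intro G
    have hTu' : IsUnit T.conjTranspose.det := by
      rw [Matrix.det_conjTranspose]; exact hTu.star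
    rw [Matrix.conjTranspose_nonsing_inv, ← Matrix.mul_assoc, ← Matrix.mul_assoc,
      Matrix.nonsing_inv_mul _ hTu', Matrix.one_mul, Matrix.mul_assoc,
      Matrix.mul_nonsing_inv _ hTu, Matrix.mul_one]
  have hclose : ∀ {n : ℕ} (Y : ι → Fin n → ℂ) {ε : ℝ}, 0 ≤ ε → ε ≤ 4 * δ ^ 2 →
      EntryClose (gramMat Y) Q ε → recombine T⁻¹ Y ∈ nearOrthonormal ι n τ := by
    intro n Y ε hε0 hε hY p q
    have h1 := norm_conj_sub_le hY hK' hK'0.le hε0 p q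
    have h2 := hconj 1
    rw [Matrix.mul_one, ← hQT] at h2
    rw [h2] at h1
    rw [gramMat_recombine]
    refine h1.trans_lt ?_
    calc ε * K' ^ 2 ≤ 4 * δ ^ 2 * K' ^ 2 := by gcongr
      _ < τ := by rw [hτ, hC]; nlinarith [sq_pos_of_pos hδ0]
  filter_upwards [ballVolume_pow_le_nearOrthogonal ι hδ0 (hδ1.le.trans hB1)]
    with n hn μ _ _ a b ha hb
  set c' := recombine T⁻¹ b with hc'
  have hbc : b = recombine T c' := by
    rw [hc', recombine_recombine, Matrix.nonsing_inv_mul _ hTu, recombine_one]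
  have hc'W : c' ∈ nearOrthonormal ι n τ := hclose b (sq_nonneg δ) (by nlinarith [sq_nonneg δ]) hb
  have haB : ∀ p, l2norm (a p) ≤ B := hB (by nlinarith) ha
  have hL : ∀ U : Matrix.unitaryGroup (Fin n) ℂ,
      ENNReal.ofReal (r ^ (2 * n)) ^ Fintype.card ι * ballVolume n ^ Fintype.card ι ≤
        2 * volume {Y : ι → Fin n → ℂ |
          U ∈ nearTransporters a Y r ∧ recombine T⁻¹ Y ∈ nearOrthonormal ι n τ} := by
    intro U
    set a' : ι → Fin n → ℂ := fun p => (U : Matrix (Fin n) (Fin n) ℂ).mulVec (a p) with ha'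
    have hgram : ∀ p q, star (a' p) ⬝ᵥ a' q = gramMat a p q := by
      intro p q
      rw [ha', Matrix.star_mulVec, ← Matrix.dotProduct_mulVec, Matrix.mulVec_mulVec]
      have : (U : Matrix (Fin n) (Fin n) ℂ).conjTranspose * (U : Matrix (Fin n) (Fin n) ℂ) = 1 :=
        Matrix.UnitaryGroup.star_mul_self U
      rw [this, Matrix.one_mulVec]; rfl
    have hn' := hn a' fun p => by rw [ha', l2norm_mulVec_unitary]; exact haB p
    have hdet : ((r : ℂ) • (1 : Matrix ι ι ℂ)).det = (r : ℂ) ^ Fintype.card ι := by simp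
    have hpow : ENNReal.ofReal (‖(r : ℂ) ^ Fintype.card ι‖ ^ (2 * n)) =
        ENNReal.ofReal (r ^ (2 * n)) ^ Fintype.card ι := by
      rw [norm_pow, Complex.norm_real, Real.norm_of_nonneg hr0.le, ← pow_mul,
        mul_comm (Fintype.card ι), pow_mul, ENNReal.ofReal_pow (by positivity)]
    -- Substitute `Y = a' + r z`, with `z` in the unit polyball and nearly orthogonal to every `a'
    -- p`.
    rw [← measure_preimage_add_right volume a', volume_eq_recombine_preimage ((r : ℂ) • 1)
      (by rw [hdet]; exact pow_ne_zero _ (by exact_mod_cast hr0.ne')), hdet, hpow, mul_left_comm (2 : ℝ≥0∞)]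
    refine mul_le_mul_right (hn'.trans (mul_le_mul_right (measure_mono ?_) _)) _
    rintro z ⟨hz1, hz2⟩
    have hrec : recombine ((r : ℂ) • (1 : Matrix ι ι ℂ)) z + a' = fun q => (r : ℂ) • z q + a' q := by
      have : recombine ((r : ℂ) • (1 : Matrix ι ι ℂ)) z = (r : ℂ) • recombine 1 z := by
        ext q i; simp [recombine, Finset.mul_sum, mul_assoc]
      rw [this, recombine_one]; rfl
    simp only [Set.mem_preimage, Set.mem_ofPred_eq, hrec]
    refine ⟨fun q => ?_, hclose _ (show 0 ≤ 4 * δ ^ 2 by positivity) le_rfl fun p q => ?_⟩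
    · change l2norm (a' q - _) < r
      rw [show a' q - ((r : ℂ) • z q + a' q) = -((r : ℂ) • z q) by abel, l2norm_neg, l2norm_smul,
        Complex.norm_real, Real.norm_of_nonneg hr0.le]
      nlinarith [hz1 q]
    · have h1 : gramMat (fun q => (r : ℂ) • z q + a' q) p q - Q p q =
          (gramMat a p q - Q p q) + (r : ℂ) * (star (a' p) ⬝ᵥ z q) +
            (r : ℂ) * star (star (a' q) ⬝ᵥ z p) + (r : ℂ) ^ 2 * (star (z p) ⬝ᵥ z q) := by
        rw [gramMat_apply, ← hgram, ← Matrix.star_dotProduct]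
        simp only [star_add, star_smul, add_dotProduct, dotProduct_add, smul_dotProduct,
          dotProduct_smul, smul_eq_mul, Complex.star_def, Complex.conj_ofReal]
        ring
      have hz3 : ‖star (z p) ⬝ᵥ z q‖ ≤ 1 := (norm_dotProduct_le _ _).trans
        (mul_le_one₀ (hz1 p).le (l2norm_nonneg _) (hz1 q).le)
      have hrn : ‖(r : ℂ)‖ = r := by rw [Complex.norm_real, Real.norm_of_nonneg hr0.le]
      rw [h1]
      calc _ ≤ ‖gramMat a p q - Q p q‖ + ‖(r : ℂ) * (star (a' p) ⬝ᵥ z q)‖ +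
            ‖(r : ℂ) * star (star (a' q) ⬝ᵥ z p)‖ + ‖(r : ℂ) ^ 2 * (star (z p) ⬝ᵥ z q)‖ :=
            norm_add₄_le
        _ < δ ^ 2 + r * δ + r * δ + r ^ 2 * 1 := by
            rw [norm_mul, norm_mul, norm_mul, norm_star, norm_pow, hrn]
            linarith [ha p q, mul_le_mul_of_nonneg_left (hz2 p q).le hr0.le,
              mul_le_mul_of_nonneg_left (hz2 q p).le hr0.le,
              mul_le_mul_of_nonneg_left hz3 (sq_nonneg r)]
        _ ≤ 4 * δ ^ 2 := by nlinarith
  have hmain := le_measure_nearTransporters_mul μ a hT hK hτ0.le hτm hc'W hρ hL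
  rw [← hbc] at hmain
  have hv0 : ballVolume n ^ Fintype.card ι ≠ 0 := pow_ne_zero _ (ballVolume_ne_zero n)
  have hvt : ballVolume n ^ Fintype.card ι ≠ ⊤ := ENNReal.pow_ne_top (ballVolume_ne_top n)
  refine (ENNReal.mul_le_mul_iff_left hv0 hvt).1 (hmain.trans ?_)
  rw [hQT, re_det_conjTranspose_mul_self, ← pow_mul]
  set x := μ (nearTransporters a b δ)
  set D := ENNReal.ofReal (‖T.det‖ ^ (2 * n))
  calc 2 * (x * volume (nearOrthonormal ι n τ) * D)
      ≤ 2 * (x * (ENNReal.ofReal ((1 + τ) ^ (n * Fintype.card ι)) *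
          ballVolume n ^ Fintype.card ι) * D) := by
        gcongr
        exact volume_nearOrthonormal_le hτ0.le
    _ ≤ 2 * (x * (ENNReal.ofReal ((1 + κ) ^ (n * Fintype.card ι)) *
          ballVolume n ^ Fintype.card ι) * D) := by gcongr
    _ = _ := by ring

end HaarAsymptotics

/-! ### Combinatorics of the left Cayley tree: parents, subtrees and balls -/

namespace FreeGroup

theorem of_inv_eq_mk {S : Type*} (s : S) : (of s)⁻¹ = mk [(s, false)] := rfl

variable {S : Type*} [DecidableEq S]

/-- The neighbour of `g` in the left Cayley tree that is closer to the identity. -/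
def parent (g : FreeGroup S) : FreeGroup S := mk g.toWord.tail

theorem parent_one : parent (1 : FreeGroup S) = 1 := by
  rw [parent, toWord_one]; rfl

theorem toWord_parent (g : FreeGroup S) : g.parent.toWord = g.toWord.tail := by
  rw [parent, toWord_mk]
  exact (isReduced_toWord.infix (List.tail_suffix _).isInfix).reduce_eq

theorem norm_parent {g : FreeGroup S} (hg : g ≠ 1) : g.parent.norm + 1 = g.norm := by
  rw [norm, norm, toWord_parent, List.length_tail]
  have : g.toWord.length ≠ 0 := by
    rw [ne_eq, List.length_eq_zero_iff, toWord_eq_nil_iff]; exact hg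
  omega

theorem norm_parent_le (g : FreeGroup S) : g.parent.norm ≤ g.norm := by
  by_cases hg : g = 1
  · rw [hg, parent_one]
  · have := norm_parent hg; omega

theorem mk_singleton_injective : Function.Injective fun x : S × Bool => mk [x] := by
  intro x y h
  have h1 := congrArg toWord (show mk [x] = mk [y] from h)
  rw [toWord_mk, toWord_mk, reduce_singleton, reduce_singleton] at h1
  simpa using h1

/-- Multiplication by a letter moves away from the identity or towards it. -/
theorem parent_mk_mul_or (x : S × Bool) (g : FreeGroup S) :
    (mk [x] * g ≠ 1 ∧ parent (mk [x] * g) = g) ∨ (g ≠ 1 ∧ parent g = mk [x] * g) := by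
  have h : toWord (mk [x] * g) = reduce (x :: g.toWord) := by
    rw [toWord_mul, toWord_mk, reduce_singleton]; rfl
  rw [reduce.cons, reduce_toWord] at h
  rcases hw : g.toWord with _ | ⟨y, w⟩
  · rw [hw] at h
    left
    refine ⟨fun h1 => ?_, ?_⟩
    · rw [h1, toWord_one] at h; simp at h
    · rw [parent, h, ← mk_toWord (x := g), hw]; rfl
  · rw [hw] at h
    simp only at h
    split_ifs at h with hxy
    · right
      refine ⟨fun h1 => ?_, ?_⟩
      · rw [h1, toWord_one] at hw; simp at hw
      · rw [parent, hw, List.tail_cons, ← h, mk_toWord]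
    · left
      refine ⟨fun h1 => ?_, ?_⟩
      · rw [h1, toWord_one] at h; simp at h
      · rw [parent, h, List.tail_cons, ← hw, mk_toWord]

theorem parent_eq_mk_mul_of_norm_le {x : S × Bool} {g : FreeGroup S}
    (h : (mk [x] * g).norm ≤ g.norm) : g ≠ 1 ∧ parent g = mk [x] * g := by
  rcases parent_mk_mul_or x g with ⟨h1, h2⟩ | h1
  · have := norm_parent h1
    rw [h2] at this; omega
  · exact h1

theorem exists_parent_eq {g : FreeGroup S} (hg : g ≠ 1) :
    ∃ x : S × Bool, parent g = mk [x] * g := by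
  rcases hw : g.toWord with _ | ⟨y, w⟩
  · exact absurd (toWord_eq_nil_iff.1 hw) hg
  · refine ⟨(y.1, !y.2), ?_⟩
    have h1 : g = mk [y] * mk w := by rw [← mk_toWord (x := g), hw]; rfl
    have h2 : mk [(y.1, !y.2)] = (mk [y])⁻¹ := by rw [inv_mk]; rfl
    rw [h2, parent, hw, List.tail_cons, h1, inv_mul_cancel_left]

/-- A finite connected set of vertices of the left Cayley tree containing the identity. -/
def IsSubtree (F : Finset (FreeGroup S)) : Prop := 1 ∈ F ∧ ∀ g ∈ F, parent g ∈ F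

theorem mem_inter_smul {F : Finset (FreeGroup S)} {a g : FreeGroup S} :
    g ∈ F ∩ a • F ↔ g ∈ F ∧ a⁻¹ * g ∈ F := by
  rw [Finset.mem_inter, ← Finset.inv_smul_mem_iff]; rfl

/-- Edges labelled `s` inside `F` are indexed by their targets `g ∈ F ∩ sF`. On each edge exactly
one endpoint is the parent of the other, so edges may instead be indexed by nonroot vertices. -/
theorem IsSubtree.forall_edge_iff {F : Finset (FreeGroup S)} (hF : IsSubtree F)
    {P : FreeGroup S → FreeGroup S → Prop} (hP : ∀ g h, P g h → P h g) :
    (∀ s : S, ∀ g ∈ F ∩ of s • F, P ((of s)⁻¹ * g) g) ↔ ∀ g ∈ F, g ≠ 1 → P (parent g) g := by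
  constructor
  · intro h g hg hg1
    obtain ⟨⟨s, b⟩, hx⟩ := exists_parent_eq hg1
    have hp := hF.2 g hg
    rcases b
    · rw [hx] at hp ⊢
      exact h s g (mem_inter_smul.2 ⟨hg, hp⟩)
    · have h1 : (of s)⁻¹ * parent g = g := by
        rw [hx]; exact inv_mul_cancel_left _ _
      have h2 := h s (parent g) (mem_inter_smul.2 ⟨hp, by rwa [h1]⟩)
      rw [h1] at h2
      exact hP _ _ h2
  · intro h s g hg
    rw [mem_inter_smul] at hg
    rcases parent_mk_mul_or (s, false) g with ⟨h1, h2⟩ | ⟨h1, h2⟩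
    · have := h _ hg.2 h1
      rw [of_inv_eq_mk, h2] at this
      exact hP _ _ this
    · have := h g hg.1 h1
      rwa [h2] at this

/-- Each edge is sent to its endpoint farther from the identity. The equality is what makes the
powers of `δ` cancel in the double count. -/
theorem IsSubtree.card_edges [Fintype S] {F : Finset (FreeGroup S)} (hF : IsSubtree F) :
    ∑ s : S, (F ∩ of s • F).card = (F.erase 1).card := by
  rw [← Finset.card_sigma]
  have hup : ∀ {s : S} {g : FreeGroup S}, ¬ ((of s)⁻¹ * g).norm < g.norm →
      (of s)⁻¹ * g ≠ 1 ∧ parent ((of s)⁻¹ * g) = mk [(s, true)] * ((of s)⁻¹ * g) := by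
    intro s g h
    refine parent_eq_mk_mul_of_norm_le ?_
    have : mk [(s, true)] * ((of s)⁻¹ * g) = g := mul_inv_cancel_left (of s) g
    rw [this]; omega
  refine Finset.card_bij (fun x _ => if ((of x.1)⁻¹ * x.2).norm < x.2.norm then x.2
    else (of x.1)⁻¹ * x.2) ?_ ?_ ?_
  · rintro ⟨s, g⟩ hx
    simp only [Finset.mem_sigma, Finset.mem_univ, true_and, mem_inter_smul] at hx
    simp only
    split_ifs with h
    · refine Finset.mem_erase.2 ⟨?_, hx.1⟩
      rintro rfl
      simp at h
    · exact Finset.mem_erase.2 ⟨(hup h).1, hx.2⟩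
  · rintro ⟨s, g⟩ - ⟨s', g'⟩ - heq
    simp only at heq
    have hinj : ∀ {x y : S × Bool} {g : FreeGroup S}, mk [x] * g = mk [y] * g → x = y :=
      fun h => mk_singleton_injective (mul_right_cancel h)
    split_ifs at heq with h h' h'
    · subst heq
      have h1 := parent_eq_mk_mul_of_norm_le (x := (s, false)) h.le
      have h2 := parent_eq_mk_mul_of_norm_le (x := (s', false)) h'.le
      have := hinj (h1.2.symm.trans h2.2)
      simp only [Prod.mk.injEq, and_true] at this
      rw [this]
    · have h1 := parent_eq_mk_mul_of_norm_le (x := (s, false)) h.le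
      have h2 := hup h'
      rw [← heq] at h2
      have := hinj (h1.2.symm.trans h2.2)
      simp at this
    · have h1 := hup h
      have h2 := parent_eq_mk_mul_of_norm_le (x := (s', false)) h'.le
      rw [heq] at h1
      have := hinj (h1.2.symm.trans h2.2)
      simp at this
    · have h1 := hup h
      have h2 := hup h'
      rw [← heq] at h2
      have := hinj (h1.2.symm.trans h2.2)
      simp only [Prod.mk.injEq, and_true] at this
      subst this
      rw [mul_left_cancel heq]
  · intro g hg
    obtain ⟨hg1, hgF⟩ := Finset.mem_erase.1 hg
    obtain ⟨⟨s, b⟩, hx⟩ := exists_parent_eq hg1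
    have hp := hF.2 g hgF
    have hn := norm_parent hg1
    rcases b
    · refine ⟨⟨s, g⟩, ?_, ?_⟩
      · rw [hx] at hp
        simp only [Finset.mem_sigma, Finset.mem_univ, true_and, mem_inter_smul]
        exact ⟨hgF, hp⟩
      · rw [hx] at hn
        simp only
        rw [if_pos]
        rw [of_inv_eq_mk]; omega
    · have h1 : (of s)⁻¹ * parent g = g := by
        rw [hx]; exact inv_mul_cancel_left _ _
      refine ⟨⟨s, parent g⟩, ?_, ?_⟩
      · simp only [Finset.mem_sigma, Finset.mem_univ, true_and, mem_inter_smul, h1]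
        exact ⟨hp, hgF⟩
      · simp only [h1]
        rw [if_neg (by omega)]

/-- A vertex of maximal length has its parent as only neighbour in `F`, so it cannot be both a
source and a target for the same label. Hence for each `s` the sources or the targets all survive
its removal, which lets singular determinants be pushed to a smaller subtree. -/
theorem IsSubtree.exists_leaf {F : Finset (FreeGroup S)} (hF : IsSubtree F) (h1 : F ≠ {1}) :
    ∃ g ∈ F, IsSubtree (F.erase g) ∧ ∀ s : S, (∀ h ∈ F ∩ of s • F, h ∈ F.erase g) ∨
      (∀ h ∈ F ∩ of s • F, (of s)⁻¹ * h ∈ F.erase g) := by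
  obtain ⟨g, hg, hmax⟩ := F.exists_max_image norm ⟨1, hF.1⟩
  have hg1 : g ≠ 1 := by
    rintro rfl
    refine h1 (Finset.eq_singleton_iff_unique_mem.2 ⟨hF.1, fun x hx => ?_⟩)
    have := hmax x hx
    rw [norm_one] at this
    exact norm_eq_zero.1 (by omega)
  refine ⟨g, hg, ⟨Finset.mem_erase.2 ⟨hg1.symm, hF.1⟩, fun x hx => ?_⟩, fun s => ?_⟩
  · obtain ⟨hxg, hx⟩ := Finset.mem_erase.1 hx
    refine Finset.mem_erase.2 ⟨fun h => ?_, hF.2 x hx⟩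
    by_cases hx1 : x = 1
    · rw [hx1, parent_one] at h
      exact hg1 h.symm
    · have := norm_parent hx1
      have := hmax x hx
      rw [h] at *
      omega
  · by_contra! hcon
    obtain ⟨⟨a, ha, hag⟩, ⟨b, hb, hbg⟩⟩ := hcon
    rw [mem_inter_smul] at ha hb
    have e1 : a = g := by
      by_contra h; exact hag (Finset.mem_erase.2 ⟨h, ha.1⟩)
    have e2 : (of s)⁻¹ * b = g := by
      by_contra h; exact hbg (Finset.mem_erase.2 ⟨h, hb.2⟩)
    have e3 : b = mk [(s, true)] * g := by rw [← e2]; exact (mul_inv_cancel_left _ _).symm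
    rw [e1] at ha
    rw [e3] at hb
    have h2 := parent_eq_mk_mul_of_norm_le (x := (s, false)) (hmax _ ha.2)
    have h3 := parent_eq_mk_mul_of_norm_le (x := (s, true)) (hmax _ hb.1)
    have := mk_singleton_injective (mul_right_cancel (h2.2.symm.trans h3.2))
    simp at this

theorem norm_mk_mul_le (x : S × Bool) (g : FreeGroup S) : (mk [x] * g).norm ≤ g.norm + 1 := by
  have h1 := norm_mul_le (mk [x]) g
  have h2 : (mk [x]).norm ≤ 1 := norm_mk_le
  omega

variable [Fintype S]

theorem mem_freeBall {n : ℕ} {g : FreeGroup S} : g ∈ freeBall S n ↔ g.norm ≤ n := by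
  rw [freeBall, Set.Finite.mem_toFinset]; rfl

theorem isSubtree_freeBall (n : ℕ) : IsSubtree (freeBall S n) :=
  ⟨mem_freeBall.2 (by simp), fun g hg => mem_freeBall.2
    ((norm_parent_le g).trans (mem_freeBall.1 hg))⟩

theorem freeBall_mono {m n : ℕ} (h : m ≤ n) : freeBall S m ⊆ freeBall S n := fun _ hg =>
  mem_freeBall.2 ((mem_freeBall.1 hg).trans h)

theorem mem_mk_smul_freeBall {n : ℕ} {x : S × Bool} {g : FreeGroup S} :
    g ∈ mk [x] • freeBall S n ↔ (mk [(x.1, !x.2)] * g).norm ≤ n := by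
  have h : (mk [x])⁻¹ = mk [(x.1, !x.2)] := by rw [inv_mk]; rfl
  rw [← Finset.inv_smul_mem_iff, mem_freeBall, h]; rfl

/-- The lengths of `g` and `s⁻¹g` differ by exactly one, so both are at most `n + 1` precisely when
one of them is at most `n`. -/
theorem freeBall_inter_smul_succ (n : ℕ) (s : S) :
    freeBall S (n + 1) ∩ of s • freeBall S (n + 1) = freeBall S n ∪ of s • freeBall S n := by
  ext g
  change g ∈ _ ∩ mk [(s, true)] • _ ↔ g ∈ _ ∪ mk [(s, true)] • _
  rw [Finset.mem_inter, Finset.mem_union, mem_mk_smul_freeBall, mem_mk_smul_freeBall, mem_freeBall,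
    mem_freeBall]
  simp only [Bool.not_true]
  have h0 := norm_mk_mul_le (s, false) g
  rcases parent_mk_mul_or (s, false) g with ⟨h1, h2⟩ | ⟨h1, h2⟩
  · have := norm_parent h1
    rw [h2] at this
    omega
  · have := norm_parent h1
    rw [h2] at this
    omega

theorem freeBall_succ (n : ℕ) : freeBall S (n + 1) =
    freeBall S n ∪ Finset.univ.biUnion fun x : S × Bool => mk [x] • freeBall S n := by
  ext g
  simp only [Finset.mem_union, Finset.mem_biUnion, Finset.mem_univ, true_and,
    mem_mk_smul_freeBall, mem_freeBall]
  constructor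
  · intro h
    by_cases hg : g = 1
    · left; simp [hg]
    obtain ⟨x, hx⟩ := exists_parent_eq hg
    refine Or.inr ⟨(x.1, !x.2), ?_⟩
    have := norm_parent hg
    rw [hx] at this
    change (mk [(x.1, !!x.2)] * g).norm ≤ n
    rw [Bool.not_not]
    change (mk [x] * g).norm ≤ n
    omega
  · rintro (h | ⟨x, hx⟩)
    · omega
    · have h1 := norm_mk_mul_le x (mk [(x.1, !x.2)] * g)
      have h2 : mk [x] * (mk [(x.1, !x.2)] * g) = g := by
        have h : mk [(x.1, !x.2)] = (mk [x])⁻¹ := by rw [inv_mk]; rfl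
        rw [h, mul_inv_cancel_left]
      rw [h2] at h1
      omega

/-- For `g` outside the ball, membership in the translate by `x` forces the parent of `g` to be
`x⁻¹g`, and this determines `x`. -/
theorem mk_smul_freeBall_inter {n : ℕ} {x y : S × Bool} (hxy : x ≠ y) {g : FreeGroup S}
    (hx : g ∈ mk [x] • freeBall S n) (hy : g ∈ mk [y] • freeBall S n) : g ∈ freeBall S n := by
  rw [mem_mk_smul_freeBall] at hx hy
  rw [mem_freeBall]
  by_contra h
  have h1 := parent_eq_mk_mul_of_norm_le (x := (x.1, !x.2)) (g := g) (by omega)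
  have h2 := parent_eq_mk_mul_of_norm_le (x := (y.1, !y.2)) (g := g) (by omega)
  have h3 := mk_singleton_injective (mul_right_cancel (h1.2.symm.trans h2.2))
  simp only [Prod.mk.injEq, Bool.not_inj_iff] at h3
  exact hxy (Prod.ext h3.1 h3.2)

end FreeGroup

/-! ### Determinant inequalities for positive definite matrices -/

section DeterminantInequalities

theorem Matrix.PosSemidef.re_det_le_one {ι : Type*} [Fintype ι] [DecidableEq ι]
    {W : Matrix ι ι ℂ} (hW : W.PosSemidef) (hW1 : (1 - W).PosSemidef) : W.det.re ≤ 1 := by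
  have h : W.det.re = ∏ i, hW.isHermitian.eigenvalues i := by
    rw [hW.isHermitian.det_eq_prod_eigenvalues, ← RCLike.ofReal_prod]
    exact Complex.ofReal_re _
  rw [h]
  refine Finset.prod_le_one (fun i _ => hW.eigenvalues_nonneg i) fun i _ => ?_
  rw [hW.isHermitian.eigenvalues_eq]
  set v : ι → ℂ := ⇑(hW.isHermitian.eigenvectorBasis i) with hv
  have h1 := hW1.re_dotProduct_nonneg v
  have h2 : star v ⬝ᵥ v = 1 := by
    have h3 := hW.isHermitian.eigenvectorBasis.orthonormal.1 i
    rw [EuclideanSpace.norm_eq, Real.sqrt_eq_one] at h3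
    rw [star_dotProduct_self_eq_sum, h3, Complex.ofReal_one]
  rw [Matrix.sub_mulVec, Matrix.one_mulVec, dotProduct_sub, h2, map_sub] at h1
  simpa using h1

theorem Matrix.PosSemidef.re_det_le {ι : Type*} [Fintype ι] [DecidableEq ι]
    {Z X : Matrix ι ι ℂ} (hZ : Z.PosSemidef) (hX : X.PosDef) (h : (X - Z).PosSemidef) :
    Z.det.re ≤ X.det.re := by
  obtain ⟨T, hT, rfl⟩ := exists_conjTranspose_mul_self_eq hX
  have hTu : IsUnit T.det := isUnit_iff_ne_zero.2 hT
  have hTu' : IsUnit T.conjTranspose.det := by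
    rw [Matrix.det_conjTranspose]; exact hTu.star
  set W := T⁻¹.conjTranspose * Z * T⁻¹ with hW
  have hWZ : Z = T.conjTranspose * W * T := by
    rw [hW, Matrix.conjTranspose_nonsing_inv, ← Matrix.mul_assoc, ← Matrix.mul_assoc,
      Matrix.mul_nonsing_inv _ hTu', Matrix.one_mul, Matrix.mul_assoc,
      Matrix.nonsing_inv_mul _ hTu, Matrix.mul_one]
  have h1 : T⁻¹.conjTranspose * (T.conjTranspose * T - Z) * T⁻¹ = 1 - W := by
    rw [Matrix.mul_sub, Matrix.sub_mul, ← hW, Matrix.conjTranspose_nonsing_inv,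
      ← Matrix.mul_assoc, Matrix.nonsing_inv_mul _ hTu', Matrix.one_mul,
      Matrix.mul_nonsing_inv _ hTu]
  have h2 := Matrix.PosSemidef.re_det_le_one (hZ.conjTranspose_mul_mul_same T⁻¹)
    (h1 ▸ h.conjTranspose_mul_mul_same T⁻¹)
  have h3 : Z.det = (T.conjTranspose * T).det * W.det := by
    rw [hWZ, Matrix.det_mul _ T, Matrix.det_mul _ W, Matrix.det_mul _ T, mul_right_comm]
  have h4 : (T.conjTranspose * T).det = (((T.conjTranspose * T).det.re : ℝ) : ℂ) := by
    have := (Complex.le_def.1 hX.posSemidef.det_nonneg).2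
    exact Complex.ext (by simp) (by simpa using this.symm)
  rw [h3, h4, Complex.re_ofReal_mul, Complex.ofReal_re]
  have h5 : 0 ≤ (T.conjTranspose * T).det.re :=
    (Complex.le_def.1 hX.posSemidef.det_nonneg).1
  exact mul_le_of_le_one_right h5 h2

theorem ofReal_re_det {ι : Type*} [Fintype ι] [DecidableEq ι] {P : Matrix ι ι ℂ}
    (hP : P.PosSemidef) : ((P.det.re : ℝ) : ℂ) = P.det :=
  Complex.ext (by simp) (by simpa using (Complex.le_def.1 hP.det_nonneg).2)

theorem re_det_pos {ι : Type*} [Fintype ι] [DecidableEq ι] {P : Matrix ι ι ℂ}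
    (hP : P.PosDef) : 0 < P.det.re := (Complex.lt_def.1 hP.det_pos).1

universe u

/-- Schur complements, with their restrictions to subsets. -/
theorem exists_schur_complement {γ α : Type u} [Fintype γ] [Fintype α] [DecidableEq γ]
    [DecidableEq α] {P : Matrix (γ ⊕ α) (γ ⊕ α) ℂ} (hP : P.PosDef) :
    ∃ X : Matrix α α ℂ, X.PosDef ∧ (P.submatrix Sum.inr Sum.inr - X).PosSemidef ∧
      ∀ {β : Type u} [Fintype β] [DecidableEq β] (f : β → α),
        (P.submatrix (Sum.map id f) (Sum.map id f)).det =
          (P.submatrix Sum.inl Sum.inl).det * (X.submatrix f f).det := by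
  have hA : P.toBlocks₁₁.PosDef := hP.submatrix Sum.inl_injective
  have hC : P.toBlocks₂₁ = P.toBlocks₁₂.conjTranspose := by
    ext i j
    exact (hP.isHermitian.apply (Sum.inr i) (Sum.inl j)).symm
  have hPb : P = Matrix.fromBlocks P.toBlocks₁₁ P.toBlocks₁₂ P.toBlocks₁₂.conjTranspose
      P.toBlocks₂₂ := by rw [← hC, Matrix.fromBlocks_toBlocks]
  obtain ⟨hinv⟩ := hA.isUnit.nonempty_invertible
  set X := P.toBlocks₂₂ - P.toBlocks₁₂.conjTranspose * P.toBlocks₁₁⁻¹ * P.toBlocks₁₂ with hX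
  have hS : X.PosSemidef := by
    have := hP.posSemidef
    rw [hPb] at this
    exact (Matrix.PosDef.fromBlocks₁₁ _ _ hA).1 this
  have key : ∀ {β : Type u} [Fintype β] [DecidableEq β] (f : β → α),
      (P.submatrix (Sum.map id f) (Sum.map id f)).det =
        (P.submatrix Sum.inl Sum.inl).det * (X.submatrix f f).det := by
    intro β _ _ f
    have h1 : P.submatrix (Sum.map id f) (Sum.map id f) =
        Matrix.fromBlocks P.toBlocks₁₁ (P.toBlocks₁₂.submatrix id f)
          (P.toBlocks₁₂.conjTranspose.submatrix f id) (P.toBlocks₂₂.submatrix f f) := by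
      conv_lhs => rw [hPb]
      ext (i | i) (j | j) <;> rfl
    rw [h1, Matrix.det_fromBlocks₁₁, Matrix.invOf_eq_nonsing_inv]
    rfl
  refine ⟨X, ?_, ?_, key⟩
  · rw [hS.posDef_iff_det_ne_zero]
    intro h0
    have := key (id : α → α)
    rw [Sum.map_id_id, Matrix.submatrix_id_id, Matrix.submatrix_id_id, h0, mul_zero] at this
    exact hP.det_pos.ne' this
  · change (P.toBlocks₂₂ - X).PosSemidef
    rw [hX, sub_sub_cancel]
    exact (hA.inv.posSemidef).conjTranspose_mul_mul_same _

/-- Fischer's inequality. -/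
theorem re_det_le_mul_of_posDef {α β : Type u} [Fintype α] [Fintype β] [DecidableEq α]
    [DecidableEq β] {P : Matrix (α ⊕ β) (α ⊕ β) ℂ} (hP : P.PosDef) :
    P.det.re ≤ (P.submatrix Sum.inl Sum.inl).det.re * (P.submatrix Sum.inr Sum.inr).det.re := by
  obtain ⟨X, hX, hPX, hdet⟩ := exists_schur_complement hP
  have hA := hP.submatrix (e := (Sum.inl : α → α ⊕ β)) Sum.inl_injective
  have h1 := hdet (id : β → β)
  rw [Sum.map_id_id, Matrix.submatrix_id_id, Matrix.submatrix_id_id] at h1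
  rw [h1, ← ofReal_re_det hA.posSemidef, Complex.re_ofReal_mul, Complex.ofReal_re]
  exact mul_le_mul_of_nonneg_left
    (hX.posSemidef.re_det_le (hP.submatrix Sum.inr_injective) hPX) (re_det_pos hA).le

/-- Koteljanskii's inequality, in block form. -/
theorem re_det_mul_le_of_posDef {γ α β : Type u} [Fintype γ] [Fintype α] [Fintype β]
    [DecidableEq γ] [DecidableEq α] [DecidableEq β]
    {P : Matrix (γ ⊕ (α ⊕ β)) (γ ⊕ (α ⊕ β)) ℂ} (hP : P.PosDef) :
    P.det.re * (P.submatrix Sum.inl Sum.inl).det.re ≤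
      (P.submatrix (Sum.map id Sum.inl) (Sum.map id Sum.inl)).det.re *
        (P.submatrix (Sum.map id Sum.inr) (Sum.map id Sum.inr)).det.re := by
  obtain ⟨X, hX, -, hdet⟩ := exists_schur_complement hP
  have hA := hP.submatrix (e := (Sum.inl : γ → γ ⊕ (α ⊕ β))) Sum.inl_injective
  have h1 := hdet (id : α ⊕ β → α ⊕ β)
  rw [Sum.map_id_id, Matrix.submatrix_id_id, Matrix.submatrix_id_id] at h1
  -- Dividing by the determinant of the common block `γ` turns the claim into Fischer's inequality
  -- for the Schur complement.
  have hF := re_det_le_mul_of_posDef hX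
  have hd := re_det_pos hA
  rw [h1, hdet, hdet, ← ofReal_re_det hA.posSemidef]
  simp only [Complex.re_ofReal_mul, Complex.ofReal_re]
  set d := (P.submatrix Sum.inl Sum.inl).det.re
  nlinarith [mul_le_mul_of_nonneg_left hF (mul_pos hd hd).le]

end DeterminantInequalities

/-! ### Gram determinants of a positive definite map: invariance and submodularity -/

section GramDeterminants

open PosDefMap

variable {Γ : Type*} [Group Γ] {k : ℕ}

/-- The infinite block matrix with block `φ (g⁻¹ * h)` at position `(g, h)`. -/
def kernelMatrix (φ : PosDefMap Γ k) : Matrix (Γ × Fin k) (Γ × Fin k) ℂ :=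
  Matrix.of fun p q => φ (p.1⁻¹ * q.1) p.2 q.2

theorem gram_eq_submatrix (φ : PosDefMap Γ k) (F : Finset Γ) :
    φ.gram F = (kernelMatrix φ).submatrix (fun p => ((p.1 : Γ), p.2))
      (fun p => ((p.1 : Γ), p.2)) := rfl

theorem posSemidef_gram (φ : PosDefMap Γ k) (F : Finset Γ) : (φ.gram F).PosSemidef := by
  classical
  have hq : ∀ x : F × Fin k → ℂ, 0 ≤ star x ⬝ᵥ (φ.gram F).mulVec x := by
    intro x
    let a : Fin k → Γ →₀ ℂ := fun i =>
      Finsupp.onFinset F (fun g => if h : g ∈ F then x (⟨g, h⟩, i) else 0) (by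
        intro g hg
        by_contra h
        simp [h] at hg)
    have h1 := φ.nonneg a
    have h2 : ∀ i, ∀ f : Γ → ℂ → ℂ, (∀ g, f g 0 = 0) →
        (a i).sum f = ∑ g : F, f g (x (g, i)) := by
      intro i f hf
      rw [Finsupp.onFinset_sum _ hf, ← Finset.sum_coe_sort]
      refine Finset.sum_congr rfl fun g _ => ?_
      simp
    convert h1 using 1
    rw [dotProduct, Fintype.sum_prod_type_right]
    refine Finset.sum_congr rfl fun i _ => ?_
    have h3 : ∀ j, ((a i).sum fun h x => (a j).sum fun g y => star x * y * φ (h⁻¹ * g) i j) =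
        ∑ h : F, ∑ g : F, star (x (h, i)) * x (g, j) * φ ((h : Γ)⁻¹ * g) i j := by
      intro j
      rw [h2 i _ fun g => by simp]
      refine Finset.sum_congr rfl fun h _ => ?_
      rw [h2 j _ fun g => by simp]
    simp only [h3]
    rw [Finset.sum_comm]
    refine Finset.sum_congr rfl fun h _ => ?_
    rw [Matrix.mulVec, dotProduct, Fintype.sum_prod_type_right, Finset.mul_sum]
    refine Finset.sum_congr rfl fun j _ => ?_
    rw [Finset.mul_sum]
    refine Finset.sum_congr rfl fun g _ => ?_
    simp only [gram, Matrix.of_apply, Pi.star_apply]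
    ring
  rw [← Matrix.isPositive_toEuclideanLin_iff, LinearMap.isPositive_iff_complex]
  intro x
  have h := hq x.ofLp
  have h4 : inner ℂ (Matrix.toEuclideanLin (φ.gram F) x) x =
      star (star x.ofLp ⬝ᵥ (φ.gram F).mulVec x.ofLp) := by
    rw [← inner_conj_symm, EuclideanSpace.inner_eq_star_dotProduct, dotProduct_comm]
    rfl
  have h5 := Complex.le_def.1 h
  rw [h4]
  refine ⟨Complex.ext (by simp) ?_, ?_⟩
  · simpa using h5.2.symm
  · simpa using h5.1

variable [DecidableEq Γ]

theorem gramDet_nonneg (φ : PosDefMap Γ k) (F : Finset Γ) : 0 ≤ φ.gramDet F :=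
  (Complex.le_def.1 (posSemidef_gram φ F).det_nonneg).1

theorem posDef_gram_iff (φ : PosDefMap Γ k) (F : Finset Γ) :
    (φ.gram F).PosDef ↔ φ.gramDet F ≠ 0 := by
  rw [(posSemidef_gram φ F).posDef_iff_det_ne_zero, gramDet,
    ← ofReal_re_det (posSemidef_gram φ F), Complex.ofReal_re, Complex.ofReal_ne_zero]

/-- The Gram determinant computed in an arbitrary indexing. -/
theorem gramDet_eq_of_range (φ : PosDefMap Γ k) (F : Finset Γ) {ι : Type*} [Fintype ι]
    [DecidableEq ι] (e : ι → Γ × Fin k) (he : Function.Injective e)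
    (hr : ∀ y, y ∈ Set.range e ↔ y.1 ∈ F) :
    ((kernelMatrix φ).submatrix e e).det.re = φ.gramDet F := by
  let f : ι ≃ F × Fin k := Equiv.ofBijective
    (fun i => (⟨(e i).1, (hr _).1 ⟨i, rfl⟩⟩, (e i).2)) ⟨fun i j h => he (by
      simp only [Prod.mk.injEq, Subtype.mk.injEq] at h
      exact Prod.ext h.1 h.2), fun p => by
      obtain ⟨i, hi⟩ := (hr ((p.1 : Γ), p.2)).2 p.1.2
      exact ⟨i, by ext <;> simp [hi]⟩⟩
  rw [gramDet, ← Matrix.det_submatrix_equiv_self f]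
  rfl

theorem posDef_kernelMatrix_submatrix {φ : PosDefMap Γ k} {F : Finset Γ} (h : φ.gramDet F ≠ 0)
    {ι : Type*} [Finite ι] (e : ι → Γ × Fin k) (he : Function.Injective e)
    (heF : ∀ i, (e i).1 ∈ F) : ((kernelMatrix φ).submatrix e e).PosDef := by
  have : (kernelMatrix φ).submatrix e e = (φ.gram F).submatrix
      (fun i => (⟨(e i).1, heF i⟩, (e i).2)) (fun i => (⟨(e i).1, heF i⟩, (e i).2)) := rfl
  rw [this]
  refine ((posDef_gram_iff φ _).2 h).submatrix fun i j hij => he ?_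
  simp only [Prod.mk.injEq, Subtype.mk.injEq] at hij
  exact Prod.ext hij.1 hij.2

theorem gramDet_ne_zero_of_subset {φ : PosDefMap Γ k} {F G : Finset Γ} (h : F ⊆ G)
    (hG : φ.gramDet G ≠ 0) : φ.gramDet F ≠ 0 := by
  rw [← posDef_gram_iff, gram_eq_submatrix]
  refine posDef_kernelMatrix_submatrix hG _ (fun p q hpq => ?_) fun p => h p.1.2
  simp only [Prod.mk.injEq] at hpq
  exact Prod.ext (Subtype.ext hpq.1) hpq.2

theorem gramDet_smul (φ : PosDefMap Γ k) (a : Γ) (F : Finset Γ) :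
    φ.gramDet (a • F) = φ.gramDet F := by
  rw [← gramDet_eq_of_range φ (a • F) (fun p : F × Fin k => (a * p.1, p.2))]
  · rw [gramDet]
    congr 2
    ext p q
    simp [kernelMatrix, gram, mul_assoc]
  · intro p q hpq
    simp only [Prod.mk.injEq, mul_right_inj] at hpq
    exact Prod.ext (Subtype.ext hpq.1) hpq.2
  · rintro ⟨g, i⟩
    simp [Finset.mem_smul_finset]

theorem gramDet_union_mul_inter_le {φ : PosDefMap Γ k} {A B : Finset Γ}
    (h : φ.gramDet (A ∪ B) ≠ 0) :
    φ.gramDet (A ∪ B) * φ.gramDet (A ∩ B) ≤ φ.gramDet A * φ.gramDet B := by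
  let e : ((A ∩ B : Finset Γ) × Fin k) ⊕ (((A \ B : Finset Γ) × Fin k) ⊕
      ((B \ A : Finset Γ) × Fin k)) → Γ × Fin k :=
    Sum.elim (fun p => (p.1, p.2)) (Sum.elim (fun p => (p.1, p.2)) (fun p => (p.1, p.2)))
  have hei : Function.Injective e := by
    rintro (⟨⟨p, hp⟩, i⟩ | ⟨⟨p, hp⟩, i⟩ | ⟨⟨p, hp⟩, i⟩)
      (⟨⟨q, hq⟩, j⟩ | ⟨⟨q, hq⟩, j⟩ | ⟨⟨q, hq⟩, j⟩) hpq <;>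
    simp only [e, Sum.elim_inl, Sum.elim_inr, Prod.mk.injEq] at hpq <;>
    obtain ⟨rfl, rfl⟩ := hpq <;>
    simp only [Finset.mem_inter, Finset.mem_sdiff] at hp hq <;> first | rfl | tauto
  have hP := gramDet_eq_of_range φ (A ∪ B) e hei (by
    rintro ⟨g, i⟩
    by_cases hA : g ∈ A <;> by_cases hB : g ∈ B <;> simp [e, hA, hB])
  have h1 := gramDet_eq_of_range φ (A ∩ B) (e ∘ Sum.inl) (hei.comp Sum.inl_injective) (by
    rintro ⟨g, i⟩
    simp [e])
  have h2 := gramDet_eq_of_range φ A (e ∘ Sum.map id Sum.inl)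
    (hei.comp (Sum.map_injective.2 ⟨Function.injective_id, Sum.inl_injective⟩)) (by
      rintro ⟨g, i⟩
      by_cases hA : g ∈ A <;> by_cases hB : g ∈ B <;> simp [e, hA, hB])
  have h3 := gramDet_eq_of_range φ B (e ∘ Sum.map id Sum.inr)
    (hei.comp (Sum.map_injective.2 ⟨Function.injective_id, Sum.inr_injective⟩)) (by
      rintro ⟨g, i⟩
      by_cases hA : g ∈ A <;> by_cases hB : g ∈ B <;> simp [e, hA, hB])
  have hpd := posDef_kernelMatrix_submatrix h e hei (by
    rintro (⟨⟨p, hp⟩, i⟩ | ⟨⟨p, hp⟩, i⟩ | ⟨⟨p, hp⟩, i⟩) <;>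
    simp only [Finset.mem_inter, Finset.mem_sdiff] at hp <;>
    simp [e, hp])
  rw [← hP, ← h1, ← h2, ← h3]
  exact re_det_mul_le_of_posDef hpd

theorem gramDet_pos {φ : PosDefMap Γ k} {F : Finset Γ} (h : φ.gramDet F ≠ 0) :
    0 < φ.gramDet F := lt_of_le_of_ne (gramDet_nonneg φ F) h.symm

theorem log_gramDet_union_le {φ : PosDefMap Γ k} {A B : Finset Γ}
    (h : φ.gramDet (A ∪ B) ≠ 0) :
    Real.log (φ.gramDet (A ∪ B)) ≤ Real.log (φ.gramDet A) + Real.log (φ.gramDet B) -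
      Real.log (φ.gramDet (A ∩ B)) := by
  have hA := gramDet_ne_zero_of_subset Finset.subset_union_left h
  have hB := gramDet_ne_zero_of_subset Finset.subset_union_right h
  have hAB : φ.gramDet (A ∩ B) ≠ 0 :=
    gramDet_ne_zero_of_subset Finset.inter_subset_left hA
  have := Real.log_le_log (mul_pos (gramDet_pos h) (gramDet_pos hAB))
    (gramDet_union_mul_inter_le h)
  rw [Real.log_mul h hAB, Real.log_mul hA hB] at this
  linarith

/-- Submodularity applied one `C x` at a time: the set built so far meets `B ∪ C x` exactly in `B`.
-/
theorem log_gramDet_biUnion_le (φ : PosDefMap Γ k) {ι : Type*} [DecidableEq ι] (B : Finset Γ)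
    (C : ι → Finset Γ) (hC : ∀ x y, x ≠ y → C x ∩ C y ⊆ B) (T : Finset ι)
    (h : φ.gramDet (B ∪ T.biUnion C) ≠ 0) :
    Real.log (φ.gramDet (B ∪ T.biUnion C)) ≤ Real.log (φ.gramDet B) +
      ∑ x ∈ T, (Real.log (φ.gramDet (B ∪ C x)) - Real.log (φ.gramDet B)) := by
  induction T using Finset.induction_on with
  | empty => simp
  | insert x T hx ih =>
    have e1 : B ∪ (insert x T).biUnion C = (B ∪ T.biUnion C) ∪ (B ∪ C x) := by
      rw [Finset.biUnion_insert]
      ext g; simp only [Finset.mem_union]; tauto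
    have e2 : (B ∪ T.biUnion C) ∩ (B ∪ C x) = B := by
      ext g
      simp only [Finset.mem_inter, Finset.mem_union, Finset.mem_biUnion]
      constructor
      · rintro ⟨h1 | ⟨y, hy, hgy⟩, h2 | hgx⟩
        · exact h1
        · exact h1
        · exact h2
        · exact hC x y (fun hxy => hx (hxy ▸ hy)) (Finset.mem_inter.2 ⟨hgx, hgy⟩)
      · exact fun h => ⟨Or.inl h, Or.inl h⟩
    rw [e1] at h ⊢
    have h1 := log_gramDet_union_le h
    have h2 := ih (gramDet_ne_zero_of_subset Finset.subset_union_left h)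
    rw [e2] at h1
    rw [Finset.sum_insert hx]
    linarith

end GramDeterminants

/-! ### Interlacing of the two sequences -/

section Interlacing

open FreeGroup

variable {S : Type*} [Fintype S] [DecidableEq S] {k : ℕ}

/-- Submodularity for the ball and its translate by each `s`. The sum contains `2r` copies of the
log determinant of the ball; all but one cancel. -/
theorem unionTerm_le_interTerm (φ : PosDefMap (FreeGroup S) k) (n : ℕ) :
    unionTerm φ n ≤ interTerm φ n := by
  rw [unionTerm]
  split_ifs with h
  · exact bot_le
  push Not at h
  obtain ⟨h0, hs⟩ := h
  rw [interTerm, if_neg, EReal.coe_le_coe_iff]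
  · have h1 : ∀ s : S, Real.log (φ.gramDet (freeBall S n ∪ of s • freeBall S n)) ≤
        2 * Real.log (φ.gramDet (freeBall S n)) -
          Real.log (φ.gramDet (freeBall S n ∩ of s • freeBall S n)) := by
      intro s
      have := log_gramDet_union_le (hs s)
      rw [gramDet_smul] at this
      linarith
    have h2 := Finset.sum_le_sum fun s (_ : s ∈ (Finset.univ : Finset S)) => h1 s
    rw [Finset.sum_sub_distrib, Finset.sum_const, Finset.card_univ, nsmul_eq_mul] at h2
    linarith
  · push Not
    exact ⟨h0, fun s => gramDet_ne_zero_of_subset Finset.inter_subset_left h0⟩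

/-- The ball of radius `n + 1` is the ball of radius `n` together with its translates by the `2r`
letters, disjoint outside it. A letter and its inverse give unions that are translates of each
other, so submodularity produces every union term twice; subtracting the intersections, which equal
these unions, leaves each once. -/
theorem interTerm_succ_le_unionTerm (φ : PosDefMap (FreeGroup S) k) (n : ℕ) :
    interTerm φ (n + 1) ≤ unionTerm φ n := by
  rw [interTerm]
  split_ifs with h
  · exact bot_le
  push Not at h
  obtain ⟨h0, -⟩ := h
  have hu : ∀ x : S × Bool, freeBall S n ∪ FreeGroup.mk [x] • freeBall S n ⊆
      freeBall S (n + 1) := by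
    intro x
    rw [freeBall_succ]
    exact Finset.union_subset_union_right (Finset.subset_biUnion_of_mem
      (fun x => FreeGroup.mk [x] • freeBall S n) (Finset.mem_univ x))
  rw [unionTerm, if_neg, EReal.coe_le_coe_iff]
  · have h1 := log_gramDet_biUnion_le φ (freeBall S n)
      (fun x : S × Bool => FreeGroup.mk [x] • freeBall S n) (fun x y hxy g hg =>
        mk_smul_freeBall_inter hxy (Finset.mem_inter.1 hg).1 (Finset.mem_inter.1 hg).2)
      Finset.univ (by rwa [← freeBall_succ])
    rw [← freeBall_succ, Finset.sum_sub_distrib, Fintype.sum_prod_type] at h1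
    simp only [Fintype.sum_bool, Finset.sum_const, Finset.card_univ, Fintype.card_prod,
      Fintype.card_bool, nsmul_eq_mul] at h1
    have h2 : ∀ s : S, φ.gramDet (freeBall S n ∪ FreeGroup.mk [(s, false)] • freeBall S n) =
        φ.gramDet (freeBall S n ∪ of s • freeBall S n) := by
      intro s
      rw [← gramDet_smul φ (of s), Finset.smul_finset_union, smul_smul, Finset.union_comm]
      have : of s * FreeGroup.mk [(s, false)] = 1 := mul_inv_cancel (of s)
      rw [this, one_smul]
    have h3 : ∀ s : S, FreeGroup.mk [(s, true)] = of s := fun _ => rfl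
    simp only [h2, h3, Finset.sum_add_distrib] at h1
    simp only [freeBall_inter_smul_succ]
    push_cast at h1
    linarith
  · push Not
    exact ⟨gramDet_ne_zero_of_subset (freeBall_mono n.le_succ) h0,
      fun s => gramDet_ne_zero_of_subset (hu (s, true)) h0⟩

end Interlacing

/-! ### Orbits along a subtree versus nearly consistent tuples, for fixed unitaries -/

theorem entryClose_gramMat_of_near {ι : Type*} {n : ℕ} {Y Y' : ι → Fin n → ℂ} {Q : Matrix ι ι ℂ}
    {ε ε' ρ B : ℝ} (h : EntryClose (gramMat Y) Q ε) (hB : ∀ p, l2norm (Y p) ≤ B)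
    (hρ : ∀ p, l2norm (Y' p - Y p) ≤ ρ) (hε : ε + ρ * (2 * B + ρ) ≤ ε') :
    EntryClose (gramMat Y') Q ε' := by
  intro p q
  have h1 : gramMat Y' p q - Q p q = (gramMat Y p q - Q p q) +
      star (Y' p - Y p) ⬝ᵥ Y q + star (Y p) ⬝ᵥ (Y' q - Y q) +
        star (Y' p - Y p) ⬝ᵥ (Y' q - Y q) := by
    simp only [gramMat_apply, star_sub, sub_dotProduct, dotProduct_sub]; ring
  rw [h1]
  have hρ0 : 0 ≤ ρ := (l2norm_nonneg _).trans (hρ p)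
  have hB0 : 0 ≤ B := (l2norm_nonneg _).trans (hB p)
  have h2 : ‖star (Y' p - Y p) ⬝ᵥ Y q‖ ≤ ρ * B := (norm_dotProduct_le _ _).trans
    (mul_le_mul (hρ p) (hB q) (l2norm_nonneg _) hρ0)
  have h3 : ‖star (Y p) ⬝ᵥ (Y' q - Y q)‖ ≤ B * ρ := (norm_dotProduct_le _ _).trans
    (mul_le_mul (hB p) (hρ q) (l2norm_nonneg _) hB0)
  have h4 : ‖star (Y' p - Y p) ⬝ᵥ (Y' q - Y q)‖ ≤ ρ * ρ := (norm_dotProduct_le _ _).trans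
    (mul_le_mul (hρ p) (hρ q) (l2norm_nonneg _) hρ0)
  refine norm_add₄_le.trans_lt ?_
  have := h p q
  linarith

section Orbits

open FreeGroup (of parent IsSubtree mem_inter_smul norm_parent)

variable {S : Type*} [DecidableEq S] {k n : ℕ}

/-- The part of the orbits of a tuple of vectors that is indexed by a finite set. -/
def orbitTuple {S : Type*} {k n : ℕ}
    (ρ : FreeGroup S →* Matrix.unitaryGroup (Fin n) ℂ) (F : Finset (FreeGroup S))
    (v : Fin k → Fin n → ℂ) : F × Fin k → Fin n → ℂ :=
  fun p => (ρ p.1 : Matrix (Fin n) (Fin n) ℂ).mulVec (v p.2)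

/-- The vectors at the sources of the edges with label `s` inside `F`. -/
def edgeSource (F : Finset (FreeGroup S)) (s : S) (Y : F × Fin k → Fin n → ℂ) :
    (F ∩ of s • F : Finset (FreeGroup S)) × Fin k → Fin n → ℂ :=
  fun p => Y (⟨(of s)⁻¹ * p.1, (mem_inter_smul.1 p.1.2).2⟩, p.2)

/-- The vectors at the targets of the edges with label `s` inside `F`. -/
def edgeTarget (F : Finset (FreeGroup S)) (s : S) (Y : F × Fin k → Fin n → ℂ) :
    (F ∩ of s • F : Finset (FreeGroup S)) × Fin k → Fin n → ℂ :=
  fun p => Y (⟨p.1, (mem_inter_smul.1 p.1.2).1⟩, p.2)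

/-- The tuples indexed by `F` that are nearly consistent with the unitary matrices `U`. -/
def nearConsistent (F : Finset (FreeGroup S)) (U : S → Matrix.unitaryGroup (Fin n) ℂ) (δ : ℝ) :
    Set (F × Fin k → Fin n → ℂ) :=
  {Y | ∀ s, U s ∈ nearTransporters (edgeSource F s Y) (edgeTarget F s Y) δ}

variable {F : Finset (FreeGroup S)} (hF : IsSubtree F)
  (ρ : FreeGroup S →* Matrix.unitaryGroup (Fin n) ℂ)

/-- The parent of an index. -/
def FreeGroup.IsSubtree.parentIndex (hF : IsSubtree F) (p : F × Fin k) : F × Fin k :=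
  (⟨parent p.1, hF.2 _ p.1.2⟩, p.2)

/-- Tuples that vary little along the edges of `F`. -/
def nearConstant (hF : IsSubtree F) (k n : ℕ) (δ : ℝ) : Set (F × Fin k → Fin n → ℂ) :=
  {X | ∀ p, (p.1 : FreeGroup S) ≠ 1 → l2norm (X p - X (hF.parentIndex p)) < δ}

/-- With `Y g = ρ(g) X g`, the defect `ρ(s) Y(s⁻¹g) - Y(g)` equals `ρ(g) (X(s⁻¹g) - X(g))`. The
substitution preserves volume and removes the unitaries from the edge condition. -/
theorem mulVec_mem_nearConsistent_iff (X : F × Fin k → Fin n → ℂ) (δ : ℝ) :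
    (fun p : F × Fin k => (ρ p.1 : Matrix (Fin n) (Fin n) ℂ).mulVec (X p)) ∈
      nearConsistent F (fun s => ρ (of s)) δ ↔ X ∈ nearConstant hF k n δ := by
  let P : FreeGroup S → FreeGroup S → Prop := fun g h => ∀ (hg : g ∈ F) (hh : h ∈ F) (i : Fin k),
    l2norm (X (⟨h, hh⟩, i) - X (⟨g, hg⟩, i)) < δ
  have hP : ∀ g h, P g h → P h g := fun g h H hg hh i => by
    rw [l2norm_sub_comm]; exact H hh hg i
  have hedge := hF.forall_edge_iff hP
  have h1 : ∀ s : S, ∀ g (hg : g ∈ F ∩ of s • F) (i : Fin k),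
      l2norm ((ρ (of s) : Matrix (Fin n) (Fin n) ℂ).mulVec
        ((ρ ((of s)⁻¹ * g) : Matrix (Fin n) (Fin n) ℂ).mulVec
          (X (⟨(of s)⁻¹ * g, (mem_inter_smul.1 hg).2⟩, i))) -
        (ρ g : Matrix (Fin n) (Fin n) ℂ).mulVec (X (⟨g, (mem_inter_smul.1 hg).1⟩, i))) =
      l2norm (X (⟨g, (mem_inter_smul.1 hg).1⟩, i) -
        X (⟨(of s)⁻¹ * g, (mem_inter_smul.1 hg).2⟩, i)) := by
    intro s g hg i
    rw [Matrix.mulVec_mulVec, ← Submonoid.coe_mul, ← map_mul, mul_inv_cancel_left,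
      ← Matrix.mulVec_sub, l2norm_mulVec_unitary, l2norm_sub_comm]
  constructor
  · intro h p hp
    refine hedge.1 (fun s g hg hg1 hg2 i => ?_) p.1 p.1.2 hp (hF.2 _ p.1.2) p.1.2 p.2
    rw [← h1 s g hg i]
    exact h s (⟨g, hg⟩, i)
  · rintro h s ⟨⟨g, hg⟩, i⟩
    change l2norm ((ρ (of s) : Matrix (Fin n) (Fin n) ℂ).mulVec
        ((ρ ((of s)⁻¹ * g) : Matrix (Fin n) (Fin n) ℂ).mulVec
          (X (⟨(of s)⁻¹ * g, (mem_inter_smul.1 hg).2⟩, i))) -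
        (ρ g : Matrix (Fin n) (Fin n) ℂ).mulVec (X (⟨g, (mem_inter_smul.1 hg).1⟩, i))) < δ
    rw [h1 s g hg i]
    exact hedge.2 (fun g hg hg1 hp hg' i => h (⟨g, hg⟩, i) hg1) s g hg
      (mem_inter_smul.1 hg).2 (mem_inter_smul.1 hg).1 i

theorem l2norm_sub_root_le {X : F × Fin k → Fin n → ℂ} {δ : ℝ}
    (hX : X ∈ nearConstant hF k n δ) (g : FreeGroup S) (hg : g ∈ F) (i : Fin k) :
    l2norm (X (⟨g, hg⟩, i) - X (⟨1, hF.1⟩, i)) ≤ g.norm * δ := by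
  induction hN : g.norm generalizing g with
  | zero =>
    have : g = 1 := FreeGroup.norm_eq_zero.1 hN
    subst this
    simp [l2norm_zero]
  | succ N ih =>
    have hg1 : g ≠ 1 := by rintro rfl; simp at hN
    have hn := norm_parent hg1
    have h1 := ih (parent g) (hF.2 g hg) (by omega)
    have h2 := hX (⟨g, hg⟩, i) hg1
    have h3 := l2norm_add_le (X (⟨g, hg⟩, i) - X (⟨parent g, hF.2 g hg⟩, i))
      (X (⟨parent g, hF.2 g hg⟩, i) - X (⟨1, hF.1⟩, i))
    rw [sub_add_sub_cancel] at h3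
    have h4 : l2norm (X (⟨g, hg⟩, i) - X (⟨parent g, hF.2 g hg⟩, i)) < δ := h2
    push_cast
    linarith

/-- The matrix that replaces the vector at each vertex by its increment along the edge to the
parent. -/
def incrementMatrix (hF : IsSubtree F) (k : ℕ) : Matrix (F × Fin k) (F × Fin k) ℂ :=
  1 - Matrix.of fun p q => if (q.1 : FreeGroup S) ≠ 1 ∧ p = hF.parentIndex q then 1 else 0

theorem recombine_incrementMatrix (X : F × Fin k → Fin n → ℂ) (q : F × Fin k) :
    recombine (incrementMatrix hF k) X q =
      if (q.1 : FreeGroup S) = 1 then X q else X q - X (hF.parentIndex q) := by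
  have h : recombine (incrementMatrix hF k) X q = recombine 1 X q -
      ∑ p, (if (q.1 : FreeGroup S) ≠ 1 ∧ p = hF.parentIndex q then (1 : ℂ) else 0) • X p := by
    simp only [recombine, incrementMatrix, Matrix.sub_apply, sub_smul, Finset.sum_sub_distrib,
      Matrix.of_apply]
  rw [h, recombine_one]
  by_cases hq : (q.1 : FreeGroup S) = 1
  · simp [hq]
  · simp [hq]

/-- Ordered by word length the matrix is block triangular with identity diagonal blocks, since a
parent is strictly shorter. -/
theorem det_incrementMatrix : (incrementMatrix hF k).det = 1 := by
  have hnorm : ∀ q : F × Fin k, (q.1 : FreeGroup S) ≠ 1 →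
      ((hF.parentIndex q).1 : FreeGroup S).norm < (q.1 : FreeGroup S).norm := fun q hq => by
    have := norm_parent hq
    change (parent (q.1 : FreeGroup S)).norm < _
    omega
  have hb : (incrementMatrix hF k).BlockTriangular fun p => (p.1 : FreeGroup S).norm := by
    intro p q hpq
    have h1 : p ≠ q := by rintro rfl; exact lt_irrefl _ hpq
    rw [incrementMatrix, Matrix.sub_apply, Matrix.one_apply_ne h1, Matrix.of_apply, if_neg,
      sub_zero]
    rintro ⟨hq, rfl⟩
    exact lt_asymm hpq (hnorm q hq)
  rw [hb.det]
  refine Finset.prod_eq_one fun a _ => ?_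
  have : (incrementMatrix hF k).toSquareBlock (fun p => (p.1 : FreeGroup S).norm) a = 1 := by
    ext ⟨p, hp⟩ ⟨q, hq⟩
    rw [Matrix.toSquareBlock_def, Matrix.of_apply, incrementMatrix, Matrix.sub_apply,
      Matrix.of_apply, if_neg, sub_zero]
    · simp [Matrix.one_apply, Subtype.ext_iff]
    · rintro ⟨hq1, rfl⟩
      have := hnorm q hq1
      change ((hF.parentIndex q).1 : FreeGroup S).norm = a at hp
      change (q.1 : FreeGroup S).norm = a at hq
      omega
  rw [this, Matrix.det_one]

/-- The product structure of tuples whose nonroot coordinates lie in a ball. -/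
theorem volume_root_prod (hF1 : 1 ∈ F) (V : Set (Fin k → Fin n → ℂ)) {δ : ℝ} (hδ : 0 < δ) :
    volume {Z : F × Fin k → Fin n → ℂ | (fun i => Z (⟨1, hF1⟩, i)) ∈ V ∧
      ∀ p, (p.1 : FreeGroup S) ≠ 1 → l2norm (Z p) < δ} =
    volume V * (ENNReal.ofReal (δ ^ (2 * n)) * ballVolume n) ^ ((F.erase 1).card * k) := by
  classical
  let e : Fin k ≃ {p : F × Fin k // (p.1 : FreeGroup S) = 1} :=
    { toFun := fun i => ⟨(⟨1, hF1⟩, i), rfl⟩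
      invFun := fun p => p.1.2
      left_inv := fun _ => rfl
      right_inv := fun p => Subtype.ext (Prod.ext (Subtype.ext p.2.symm) rfl) }
  have h1 := volume_preserving_piEquivPiSubtypeProd (fun _ : F × Fin k => Fin n → ℂ)
    (fun p => (p.1 : FreeGroup S) = 1)
  have h2 := volume_measurePreserving_piCongrLeft
    (fun _ : {p : F × Fin k // (p.1 : FreeGroup S) = 1} => Fin n → ℂ) e
  set V' : Set ({p : F × Fin k // (p.1 : FreeGroup S) = 1} → Fin n → ℂ) :=
    {z | (fun i => z (e i)) ∈ V} with hV'
  set D : Set ({p : F × Fin k // ¬ (p.1 : FreeGroup S) = 1} → Fin n → ℂ) :=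
    {z | ∀ p, l2norm (z p) < δ} with hD
  have hset : {Z : F × Fin k → Fin n → ℂ | (fun i => Z (⟨1, hF1⟩, i)) ∈ V ∧
      ∀ p, (p.1 : FreeGroup S) ≠ 1 → l2norm (Z p) < δ} =
      MeasurableEquiv.piEquivPiSubtypeProd (fun _ : F × Fin k => Fin n → ℂ)
        (fun p => (p.1 : FreeGroup S) = 1) ⁻¹' (V' ×ˢ D) := by
    ext Z
    simp only [Set.mem_preimage, Set.mem_prod, hV', hD, Set.mem_ofPred_eq]
    refine and_congr Iff.rfl ⟨fun h p => h p.1 p.2, fun h p hp => h ⟨p, hp⟩⟩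
  have hVV : volume V' = volume V := by
    rw [← h2.measure_preimage_equiv]
    congr 1
  have hDD : volume D =
      (ENNReal.ofReal (δ ^ (2 * n)) * ballVolume n) ^ ((F.erase 1).card * k) := by
    have h3 := volume_polyball (n := n)
      (0 : {p : F × Fin k // ¬ (p.1 : FreeGroup S) = 1} → Fin n → ℂ) (fun _ => δ) fun _ => hδ
    simp only [Pi.zero_apply, sub_zero, Finset.prod_const, Finset.card_univ] at h3
    rw [hD, h3]
    congr 1
    rw [Fintype.card_subtype]
    have h4 : (Finset.univ.filter fun p : F × Fin k => ¬ (p.1 : FreeGroup S) = 1) =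
        (Finset.univ.filter fun g : F => ¬ (g : FreeGroup S) = 1) ×ˢ Finset.univ := by
      ext p; simp
    rw [h4, Finset.card_product, Finset.card_univ, Fintype.card_fin]
    congr 1
    rw [← Finset.card_map (Function.Embedding.subtype (· ∈ F))]
    congr 1
    ext g
    simp only [Finset.mem_map, Finset.mem_filter, Finset.mem_univ, true_and, Subtype.exists,
      Function.Embedding.coe_subtype, Finset.mem_erase]
    constructor
    · rintro ⟨a, ha, ha1, rfl⟩; exact ⟨ha1, ha⟩
    · rintro ⟨ha1, ha⟩; exact ⟨g, ha, ha1, rfl⟩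
  rw [hset, h1.measure_preimage_equiv, Measure.volume_eq_prod, Measure.prod_prod, hVV, hDD]

/-- In the unimodular coordinates formed by the root and the increments along edges, the set is a
product. -/
theorem volume_root_and_nearConstant (V : Set (Fin k → Fin n → ℂ)) {δ : ℝ} (hδ : 0 < δ) :
    volume {X : F × Fin k → Fin n → ℂ | (fun i => X (⟨1, hF.1⟩, i)) ∈ V ∧
      X ∈ nearConstant hF k n δ} =
    volume V * (ENNReal.ofReal (δ ^ (2 * n)) * ballVolume n) ^ ((F.erase 1).card * k) := by
  rw [← volume_root_prod hF.1 V hδ, volume_eq_recombine_preimage (incrementMatrix hF k)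
    (by rw [det_incrementMatrix]; exact one_ne_zero)
    {Z : F × Fin k → Fin n → ℂ | (fun i => Z (⟨1, hF.1⟩, i)) ∈ V ∧
      ∀ p, (p.1 : FreeGroup S) ≠ 1 → l2norm (Z p) < δ}, det_incrementMatrix]
  simp only [norm_one, one_pow, ENNReal.ofReal_one, one_mul]
  congr 1
  ext X
  simp only [Set.mem_preimage, Set.mem_ofPred_eq, recombine_incrementMatrix, if_true]
  refine and_congr Iff.rfl (forall_congr' fun p => ?_)
  refine forall_congr' fun hp => ?_
  rw [if_neg hp]

theorem continuous_edgeSource (s : S) :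
    Continuous (edgeSource F s : (F × Fin k → Fin n → ℂ) → _) :=
  continuous_pi fun _ => continuous_apply _

theorem continuous_edgeTarget (s : S) :
    Continuous (edgeTarget F s : (F × Fin k → Fin n → ℂ) → _) :=
  continuous_pi fun _ => continuous_apply _

theorem isOpen_setOf_mem_nearTransporters_edge (s : S) (δ : ℝ) :
    IsOpen {x : Matrix.unitaryGroup (Fin n) ℂ × (F × Fin k → Fin n → ℂ) |
      x.1 ∈ nearTransporters (edgeSource F s x.2) (edgeTarget F s x.2) δ} :=
  (isOpen_setOf_mem_nearTransporters δ).preimage (continuous_fst.prodMk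
    (((continuous_edgeSource s).comp continuous_snd).prodMk
      ((continuous_edgeTarget s).comp continuous_snd)))

theorem volume_nearConsistent_eq [Finite S] (Q : Matrix (F × Fin k) (F × Fin k) ℂ) (ε δ : ℝ) :
    volume {Y : F × Fin k → Fin n → ℂ | EntryClose (gramMat Y) Q ε ∧
      Y ∈ nearConsistent F (fun s => ρ (of s)) δ} =
    volume {X : F × Fin k → Fin n → ℂ |
      EntryClose (gramMat fun p => (ρ p.1 : Matrix (Fin n) (Fin n) ℂ).mulVec (X p)) Q ε ∧
        X ∈ nearConstant hF k n δ} := by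
  have hm := measurePreserving_mulVec_unitary_pi (n := n) fun p : F × Fin k => ρ p.1
  rw [← hm.measure_preimage]
  · congr 1
    ext X
    simp only [Set.mem_preimage, Set.mem_ofPred_eq]
    rw [mulVec_mem_nearConsistent_iff hF]
  · refine (IsOpen.measurableSet ?_).nullMeasurableSet
    refine (isOpen_setOf_entryClose Q ε).inter ?_
    have : nearConsistent F (fun s => ρ (of s)) δ = ⋂ s, {Y : F × Fin k → Fin n → ℂ |
        ρ (of s) ∈ nearTransporters (edgeSource F s Y) (edgeTarget F s Y) δ} := by
      ext Y; simp [nearConsistent]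
    rw [this]
    exact isOpen_iInter_of_finite fun s => (isOpen_setOf_mem_nearTransporters_edge s δ).preimage
      (continuous_const.prodMk continuous_id)

variable {Q : Matrix (F × Fin k) (F × Fin k) ℂ} {ε ε' δ B M : ℝ}

theorem l2norm_orbitTuple_sub_le (hM : ∀ g ∈ F, (g.norm : ℝ) ≤ M) (hδ : 0 < δ)
    {X : F × Fin k → Fin n → ℂ} (hX : X ∈ nearConstant hF k n δ) (p : F × Fin k) :
    l2norm ((ρ p.1 : Matrix (Fin n) (Fin n) ℂ).mulVec (X p) -
      orbitTuple ρ F (fun i => X (⟨1, hF.1⟩, i)) p) ≤ M * δ := by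
  rw [orbitTuple, ← Matrix.mulVec_sub, l2norm_mulVec_unitary]
  exact (l2norm_sub_root_le hF hX p.1 p.1.2 p.2).trans
    (mul_le_mul_of_nonneg_right (hM _ p.1.2) hδ.le)

/-- A nearly consistent tuple stays within `M δ` of the orbit of its root, by telescoping along
paths. Passing between the two costs only the change from `ε` to `ε'`; the next theorem is the
converse comparison. -/
theorem volume_orbitTuple_mul_le [Finite S] (hF : IsSubtree F)
    (hM : ∀ g ∈ F, (g.norm : ℝ) ≤ M) (hδ : 0 < δ)
    (hB : ∀ Y : F × Fin k → Fin n → ℂ, EntryClose (gramMat Y) Q ε → ∀ p, l2norm (Y p) ≤ B)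
    (hε : ε + M * δ * (2 * B + M * δ) ≤ ε') :
    volume {v : Fin k → Fin n → ℂ | EntryClose (gramMat (orbitTuple ρ F v)) Q ε} *
      (ENNReal.ofReal (δ ^ (2 * n)) * ballVolume n) ^ ((F.erase 1).card * k) ≤
    volume {Y : F × Fin k → Fin n → ℂ | EntryClose (gramMat Y) Q ε' ∧
      Y ∈ nearConsistent F (fun s => ρ (of s)) δ} := by
  rw [volume_nearConsistent_eq hF, ← volume_root_and_nearConstant hF _ hδ]
  refine measure_mono fun X hX => ⟨?_, hX.2⟩
  exact entryClose_gramMat_of_near hX.1 (hB _ hX.1)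
    (l2norm_orbitTuple_sub_le hF ρ hM hδ hX.2) hε

theorem volume_nearConsistent_le [Finite S] (hF : IsSubtree F)
    (hM : ∀ g ∈ F, (g.norm : ℝ) ≤ M) (hδ : 0 < δ)
    (hB : ∀ Y : F × Fin k → Fin n → ℂ, EntryClose (gramMat Y) Q ε → ∀ p, l2norm (Y p) ≤ B)
    (hε : ε + M * δ * (2 * B + M * δ) ≤ ε') :
    volume {Y : F × Fin k → Fin n → ℂ | EntryClose (gramMat Y) Q ε ∧
      Y ∈ nearConsistent F (fun s => ρ (of s)) δ} ≤
    volume {v : Fin k → Fin n → ℂ | EntryClose (gramMat (orbitTuple ρ F v)) Q ε'} *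
      (ENNReal.ofReal (δ ^ (2 * n)) * ballVolume n) ^ ((F.erase 1).card * k) := by
  rw [volume_nearConsistent_eq hF, ← volume_root_and_nearConstant hF _ hδ]
  refine measure_mono fun X hX => ⟨?_, hX.2⟩
  refine entryClose_gramMat_of_near hX.1 (hB _ hX.1) (fun p => ?_) hε
  rw [l2norm_sub_comm]
  exact l2norm_orbitTuple_sub_le hF ρ hM hδ hX.2 p

end Orbits

/-! ### Averaging over the random unitaries -/

section Expectation

open FreeGroup (of parent IsSubtree mem_inter_smul norm_parent)

variable {S : Type*} [DecidableEq S] {k n : ℕ} {Ω : Type*} [MeasurableSpace Ω]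
  {P : Measure Ω} {π : ∀ n : ℕ, Ω → FreeGroup S →* Matrix.unitaryGroup (Fin n) ℂ}

theorem IsUniformlyRandom.isProbabilityMeasure_map {S : Type*} {Ω : Type*} [MeasurableSpace Ω]
    {P : Measure Ω} {π : ∀ n : ℕ, Ω → FreeGroup S →* Matrix.unitaryGroup (Fin n) ℂ}
    [IsProbabilityMeasure P] (hπ : IsUniformlyRandom P π) (n : ℕ) (s : S) :
    IsProbabilityMeasure (P.map fun ω => π n ω (of s)) :=
  Measure.isProbabilityMeasure_map (hπ.measurable n s).aemeasurable

/-- After Fubini `Y` is fixed, and the conditions for different generators are independent events.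
-/
theorem lintegral_volume_nearConsistent [Fintype S] [IsProbabilityMeasure P]
    (hπ : IsUniformlyRandom P π) (F : Finset (FreeGroup S))
    (Q : Matrix (F × Fin k) (F × Fin k) ℂ) (ε δ : ℝ) :
    ∫⁻ ω, volume {Y : F × Fin k → Fin n → ℂ | EntryClose (gramMat Y) Q ε ∧
      Y ∈ nearConsistent F (fun s => π n ω (of s)) δ} ∂P =
    ∫⁻ Y in {Y : F × Fin k → Fin n → ℂ | EntryClose (gramMat Y) Q ε},
      ∏ s, (P.map fun ω => π n ω (of s))
        (nearTransporters (edgeSource F s Y) (edgeTarget F s Y) δ) := by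
  have hE := (isOpen_setOf_entryClose (n := n) Q ε).measurableSet
  set A : Set (Ω × (F × Fin k → Fin n → ℂ)) := {x | EntryClose (gramMat x.2) Q ε ∧
    x.2 ∈ nearConsistent F (fun s => π n x.1 (of s)) δ} with hA
  have hs : ∀ s, MeasurableSet {x : Ω × (F × Fin k → Fin n → ℂ) |
      π n x.1 (of s) ∈ nearTransporters (edgeSource F s x.2) (edgeTarget F s x.2) δ} := fun s =>
    ((((hπ.measurable n s).comp measurable_fst).prodMk measurable_snd))
      (isOpen_setOf_mem_nearTransporters_edge s δ).measurableSet
  have hAm : MeasurableSet A := by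
    have : A = (Prod.snd ⁻¹' {Y | EntryClose (gramMat Y) Q ε}) ∩ ⋂ s,
        {x : Ω × (F × Fin k → Fin n → ℂ) |
          π n x.1 (of s) ∈ nearTransporters (edgeSource F s x.2) (edgeTarget F s x.2) δ} := by
      ext x; simp [hA, nearConsistent]
    rw [this]
    exact (measurable_snd hE).inter (MeasurableSet.iInter hs)
  have h1 : ∫⁻ ω, volume {Y : F × Fin k → Fin n → ℂ | EntryClose (gramMat Y) Q ε ∧
      Y ∈ nearConsistent F (fun s => π n ω (of s)) δ} ∂P = (P.prod volume) A :=
    (Measure.prod_apply hAm).symm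
  rw [h1, Measure.prod_apply_symm hAm, ← lintegral_indicator hE]
  refine lintegral_congr fun Y => ?_
  by_cases hY : EntryClose (gramMat Y) Q ε
  · rw [Set.indicator_of_mem (by exact hY)]
    have hpre : ∀ s, MeasurableSet (nearTransporters (edgeSource F s Y) (edgeTarget F s Y) δ) :=
      fun s => ((isOpen_setOf_mem_nearTransporters_edge (F := F) (k := k) s δ).preimage
        (continuous_id.prodMk continuous_const) : IsOpen ((fun U => (U, Y)) ⁻¹' _)).measurableSet
    have h2 : (fun ω => (ω, Y)) ⁻¹' A = ⋂ s, (fun ω => π n ω (of s)) ⁻¹'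
        nearTransporters (edgeSource F s Y) (edgeTarget F s Y) δ := by
      ext ω; simp [hA, nearConsistent, hY]
    rw [h2, (hπ.indep n).meas_iInter fun s => ⟨_, hpre s, rfl⟩]
    exact Finset.prod_congr rfl fun s _ => (Measure.map_apply (hπ.measurable n s) (hpre s)).symm
  · rw [Set.indicator_of_notMem (by exact hY)]
    have h2 : (fun ω => (ω, Y)) ⁻¹' A = ∅ := by
      ext ω; simp [hA, hY]
    rw [h2, measure_empty]

theorem lintegral_volume_nearConsistent_mul_le [Fintype S] [IsProbabilityMeasure P]
    (hπ : IsUniformlyRandom P π) {F : Finset (FreeGroup S)}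
    {Q : Matrix (F × Fin k) (F × Fin k) ℂ} {ε δ : ℝ} {c A : S → ℝ≥0∞} (hc : ∀ s, c s ≠ ⊤)
    (h : ∀ Y : F × Fin k → Fin n → ℂ, EntryClose (gramMat Y) Q ε → ∀ s,
      (P.map fun ω => π n ω (of s))
        (nearTransporters (edgeSource F s Y) (edgeTarget F s Y) δ) * c s ≤ A s) :
    (∫⁻ ω, volume {Y : F × Fin k → Fin n → ℂ | EntryClose (gramMat Y) Q ε ∧
      Y ∈ nearConsistent F (fun s => π n ω (of s)) δ} ∂P) * ∏ s, c s ≤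
    (∏ s, A s) * volume {Y : F × Fin k → Fin n → ℂ | EntryClose (gramMat Y) Q ε} := by
  rw [lintegral_volume_nearConsistent hπ, ← setLIntegral_const,
    ← lintegral_mul_const' _ _ (ENNReal.prod_ne_top fun s _ => hc s)]
  refine setLIntegral_mono' (isOpen_setOf_entryClose Q ε).measurableSet fun Y hY => ?_
  rw [← Finset.prod_mul_distrib]
  exact Finset.prod_le_prod' fun s _ => h Y hY s

theorem le_lintegral_volume_nearConsistent_mul [Fintype S] [IsProbabilityMeasure P]
    (hπ : IsUniformlyRandom P π) {F : Finset (FreeGroup S)}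
    {Q : Matrix (F × Fin k) (F × Fin k) ℂ} {ε δ : ℝ} {c A : S → ℝ≥0∞} (hc : ∀ s, c s ≠ ⊤)
    (h : ∀ Y : F × Fin k → Fin n → ℂ, EntryClose (gramMat Y) Q ε → ∀ s,
      A s ≤ (P.map fun ω => π n ω (of s))
        (nearTransporters (edgeSource F s Y) (edgeTarget F s Y) δ) * c s) :
    (∏ s, A s) * volume {Y : F × Fin k → Fin n → ℂ | EntryClose (gramMat Y) Q ε} ≤
    (∫⁻ ω, volume {Y : F × Fin k → Fin n → ℂ | EntryClose (gramMat Y) Q ε ∧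
      Y ∈ nearConsistent F (fun s => π n ω (of s)) δ} ∂P) * ∏ s, c s := by
  rw [lintegral_volume_nearConsistent hπ, ← setLIntegral_const,
    ← lintegral_mul_const' _ _ (ENNReal.prod_ne_top fun s _ => hc s)]
  refine setLIntegral_mono' (isOpen_setOf_entryClose Q ε).measurableSet fun Y hY => ?_
  rw [← Finset.prod_mul_distrib]
  exact Finset.prod_le_prod' fun s _ => h Y hY s

theorem entryClose_edgeSource {φ : PosDefMap (FreeGroup S) k} {F : Finset (FreeGroup S)}
    {Y : F × Fin k → Fin n → ℂ} {ε : ℝ} (hY : EntryClose (gramMat Y) (φ.gram F) ε) (s : S) :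
    EntryClose (gramMat (edgeSource F s Y)) (φ.gram (F ∩ of s • F)) ε := by
  intro p q
  have h : φ.gram (F ∩ of s • F) p q = φ.gram F
      (⟨(of s)⁻¹ * p.1, (mem_inter_smul.1 p.1.2).2⟩, p.2)
      (⟨(of s)⁻¹ * q.1, (mem_inter_smul.1 q.1.2).2⟩, q.2) := by
    simp [PosDefMap.gram, mul_assoc]
  rw [h]
  exact hY _ _

theorem entryClose_edgeTarget {φ : PosDefMap (FreeGroup S) k} {F : Finset (FreeGroup S)}
    {Y : F × Fin k → Fin n → ℂ} {ε : ℝ} (hY : EntryClose (gramMat Y) (φ.gram F) ε) (s : S) :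
    EntryClose (gramMat (edgeTarget F s Y)) (φ.gram (F ∩ of s • F)) ε := fun _ _ => hY _ _

theorem eventually_lt_re_det {ι : Type*} [Fintype ι] [DecidableEq ι] (Q : Matrix ι ι ℂ) {c : ℝ}
    (hc : c < Q.det.re) : ∀ᶠ ε : ℝ in 𝓝[>] 0, ∀ G : Matrix ι ι ℂ, EntryClose G Q ε →
      c < G.det.re := by
  have hcont : Continuous fun G : Matrix ι ι ℂ => G.det.re :=
    Complex.continuous_re.comp continuous_id.matrix_det
  have hmem : {G : Matrix ι ι ℂ | c < G.det.re} ∈ 𝓝 Q := hcont.continuousAt.eventually_const_lt hc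
  have hpi : {G : ι → ι → ℂ | c < (Matrix.of G).det.re} ∈ 𝓝 (fun p q => Q p q) := hmem
  obtain ⟨ε, hε, hb⟩ := Metric.mem_nhds_iff.1 hpi
  filter_upwards [Ioo_mem_nhdsGT hε] with ε' hε' G hG
  refine hb (mem_ball_iff_norm.2 ?_)
  refine (pi_norm_lt_iff hε).2 fun p => (pi_norm_lt_iff hε).2 fun q => ?_
  exact (hG p q).trans hε'.2

end Expectation

/-! ### The double count and the growth rate along a subtree -/

section Growth

open FreeGroup (of parent IsSubtree mem_inter_smul norm_parent)

/-- Bookkeeping of the cancellation: `N` is the expected volume of root tuples, `J` that of nearly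
consistent tuples, `a` the power of `δ`, `w` and `V` the powers of the ball volume for nonroot and
root vectors, `D` and `C` the vertex and edge determinants, and `T`, `K` the losses. -/
theorem div_le_mul_of_double_count {N a w C J T K D V R : ℝ≥0∞} (ha : a ≠ 0) (ha' : a ≠ ⊤)
    (hw : w ≠ 0) (hw' : w ≠ ⊤) (hC : C ≠ 0) (hC' : C ≠ ⊤) (h1 : N * (a * w) ≤ J)
    (h2 : J * C ≤ T * (K * a) * (D * (w * V))) (h3 : K * D ≤ R * C) : N / V ≤ T * R := by
  refine ENNReal.div_le_of_le_mul ?_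
  refine (ENNReal.mul_le_mul_iff_left (c := a * w * C)
    (mul_ne_zero (mul_ne_zero ha hw) hC)
    (ENNReal.mul_ne_top (ENNReal.mul_ne_top ha' hw') hC')).1 ?_
  calc N * (a * w * C) = N * (a * w) * C := by ring
    _ ≤ J * C := by gcongr
    _ ≤ T * (K * a) * (D * (w * V)) := h2
    _ = T * a * w * V * (K * D) := by ring
    _ ≤ T * a * w * V * (R * C) := by gcongr
    _ = T * R * V * (a * w * C) := by ring

theorem le_mul_div_of_double_count {N a w C J T K D V R v : ℝ≥0∞} (ha : a ≠ 0) (ha' : a ≠ ⊤)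
    (hw : w ≠ 0) (hw' : w ≠ ⊤) (hC : C ≠ 0) (hC' : C ≠ ⊤) (hV : V ≠ 0) (hV' : V ≠ ⊤)
    (h1 : J ≤ N * (a * w)) (h2 : K * a * v ≤ J * (T * C)) (h3 : D * (w * V) ≤ 2 * v)
    (h4 : R * C ≤ K * D) : R ≤ 2 * T * (N / V) := by
  rw [← mul_div_assoc]
  refine (ENNReal.le_div_iff_mul_le (Or.inl hV) (Or.inl hV')).2 ?_
  refine (ENNReal.mul_le_mul_iff_left (c := a * w * C)
    (mul_ne_zero (mul_ne_zero ha hw) hC)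
    (ENNReal.mul_ne_top (ENNReal.mul_ne_top ha' hw') hC')).1 ?_
  calc R * V * (a * w * C) = R * C * (a * w * V) := by ring
    _ ≤ K * D * (a * w * V) := by gcongr
    _ = K * a * (D * (w * V)) := by ring
    _ ≤ K * a * (2 * v) := by gcongr
    _ = 2 * (K * a * v) := by ring
    _ ≤ 2 * (J * (T * C)) := by gcongr
    _ ≤ 2 * (N * (a * w) * (T * C)) := by gcongr
    _ = 2 * T * N * (a * w * C) := by ring

/-- The expected normalized volume of the tuples whose orbits along `F` have a Gram matrix close
to that of `φ`. -/
noncomputable def expectedCloseVolume {S : Type*} {k : ℕ} {Ω : Type*} [MeasurableSpace Ω]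
    (P : Measure Ω) (π : ∀ n : ℕ, Ω → FreeGroup S →* Matrix.unitaryGroup (Fin n) ℂ)
    (φ : PosDefMap (FreeGroup S) k) (F : Finset (FreeGroup S)) (ε : ℝ) (n : ℕ) : ℝ≥0∞ :=
  ∫⁻ ω, volume {v : Fin k → Fin n → ℂ |
    EntryClose (gramMat (orbitTuple (π n ω) F v)) (φ.gram F) ε} / ballVolume n ^ k ∂P

theorem expectedCloseVolume_eq {S : Type*} {k : ℕ} {Ω : Type*} [MeasurableSpace Ω]
    (P : Measure Ω) (π : ∀ n : ℕ, Ω → FreeGroup S →* Matrix.unitaryGroup (Fin n) ℂ)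
    (φ : PosDefMap (FreeGroup S) k) (F : Finset (FreeGroup S)) (ε : ℝ) (n : ℕ) :
    expectedCloseVolume P π φ F ε n =
    (∫⁻ ω, volume {v : Fin k → Fin n → ℂ |
      EntryClose (gramMat (orbitTuple (π n ω) F v)) (φ.gram F) ε} ∂P) / ballVolume n ^ k := by
  simp only [expectedCloseVolume, div_eq_mul_inv]
  rw [lintegral_mul_const']
  exact ENNReal.inv_ne_top.2 (pow_ne_zero _ (ballVolume_ne_zero n))

variable {S : Type*} [DecidableEq S]

theorem FreeGroup.IsSubtree.card_prod {k : ℕ} {F : Finset (FreeGroup S)} (hF : IsSubtree F) :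
    Fintype.card (F × Fin k) = (F.erase 1).card * k + k := by
  rw [Fintype.card_prod, Fintype.card_coe, Fintype.card_fin, Finset.card_erase_of_mem hF.1,
    ← Nat.succ_mul, Nat.succ_eq_add_one, Nat.sub_add_cancel (Finset.card_pos.2 ⟨1, hF.1⟩)]

theorem exists_norm_le (F : Finset (FreeGroup S)) :
    ∃ M : ℝ, 0 ≤ M ∧ ∀ g ∈ F, (g.norm : ℝ) ≤ M :=
  ⟨(F.sup FreeGroup.norm : ℕ), Nat.cast_nonneg _, fun g hg => by
    exact_mod_cast Finset.le_sup (f := FreeGroup.norm) hg⟩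

variable [Fintype S] {k : ℕ} {Ω : Type*} [MeasurableSpace Ω]
  {P : Measure Ω} [IsProbabilityMeasure P]
  {π : ∀ n : ℕ, Ω → FreeGroup S →* Matrix.unitaryGroup (Fin n) ℂ}
  {φ : PosDefMap (FreeGroup S) k} {F : Finset (FreeGroup S)}

/-- The ratio of Gram determinants that governs the growth of `expectedCloseVolume`. -/
noncomputable def gramRatio (φ : PosDefMap (FreeGroup S) k) (F : Finset (FreeGroup S)) : ℝ :=
  φ.gramDet F / ∏ s : S, φ.gramDet (F ∩ of s • F)

theorem FreeGroup.IsSubtree.sum_card_edges_mul (hF : IsSubtree F) :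
    ∑ s : S, Fintype.card ((F ∩ of s • F : Finset (FreeGroup S)) × Fin k) =
      (F.erase 1).card * k := by
  simp only [Fintype.card_prod, Fintype.card_coe, Fintype.card_fin, ← Finset.sum_mul]
  rw [hF.card_edges]

/-- The parameters in the upper bound for `expectedCloseVolume`. -/
theorem exists_parameters_of_gramRatio_lt (hs : ∀ s : S, φ.gramDet (F ∩ of s • F) ≠ 0) {R : ℝ}
    (hR : gramRatio φ F < R) (e : ℕ) : ∃ κ : ℝ, 0 < κ ∧ κ < 1 ∧ ∃ ε : ℝ, 0 < ε ∧ ε ≤ 1 ∧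
      (∀ s : S, ∀ G, EntryClose G (φ.gram (F ∩ of s • F)) ε →
        (1 - κ) * φ.gramDet (F ∩ of s • F) < G.det.re) ∧
      (1 + κ) ^ (2 * e) *
        (φ.gram F + (((Fintype.card (F × Fin k) + 1) * ε : ℝ) : ℂ) • 1).det.re ≤
        R * ∏ s : S, ((1 - κ) * φ.gramDet (F ∩ of s • F)) := by
  have hd : ∀ s : S, 0 < φ.gramDet (F ∩ of s • F) := fun s => gramDet_pos (hs s)
  have hdp : 0 < ∏ s : S, φ.gramDet (F ∩ of s • F) := Finset.prod_pos fun s _ => hd s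
  rw [gramRatio, div_lt_iff₀ hdp] at hR
  -- The strict inequality at `κ = 0`, `ε = 0` persists by continuity, first for a small `κ` and
  -- then, with `κ` fixed, for a small `ε`.
  have h1 : Tendsto (fun κ : ℝ => R * ∏ s : S, ((1 - κ) * φ.gramDet (F ∩ of s • F)) -
      (1 + κ) ^ (2 * e) * φ.gramDet F) (𝓝[>] 0)
      (𝓝 (R * ∏ s : S, ((1 - 0) * φ.gramDet (F ∩ of s • F)) -
        (1 + 0) ^ (2 * e) * φ.gramDet F)) :=
    (Continuous.tendsto (by fun_prop) 0).mono_left nhdsWithin_le_nhds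
  have h2 := h1.eventually_const_lt (u := 0) (by simpa using hR)
  obtain ⟨κ, hκ, hκ0, hκ1⟩ := (h2.and (Ioo_mem_nhdsGT one_pos)).exists
  refine ⟨κ, hκ0, hκ1, ?_⟩
  have h3 : Tendsto (fun ε : ℝ => (1 + κ) ^ (2 * e) *
        (φ.gram F + (((Fintype.card (F × Fin k) + 1) * ε : ℝ) : ℂ) • 1).det.re) (𝓝[>] 0)
      (𝓝 ((1 + κ) ^ (2 * e) *
        (φ.gram F + (((Fintype.card (F × Fin k) + 1) * 0 : ℝ) : ℂ) • 1).det.re)) := by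
    refine (Continuous.tendsto ?_ 0).mono_left nhdsWithin_le_nhds
    refine continuous_const.mul (Complex.continuous_re.comp (Continuous.matrix_det ?_))
    exact continuous_const.add ((Complex.continuous_ofReal.comp
      (continuous_const.mul continuous_id)).smul continuous_const)
  have h4 := h3.eventually_lt_const (u := R * ∏ s : S, ((1 - κ) * φ.gramDet (F ∩ of s • F))) (by
    simp only [mul_zero, Complex.ofReal_zero, zero_smul, add_zero]
    exact sub_pos.1 hκ)
  have h5 : ∀ᶠ ε : ℝ in 𝓝[>] 0, ∀ s : S, ∀ G, EntryClose G (φ.gram (F ∩ of s • F)) ε →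
      (1 - κ) * φ.gramDet (F ∩ of s • F) < G.det.re :=
    eventually_all.2 fun s => eventually_lt_re_det _ (by
      have := hd s
      change (1 - κ) * φ.gramDet (F ∩ of s • F) < φ.gramDet (F ∩ of s • F)
      nlinarith)
  obtain ⟨ε, ⟨hε4, hε5⟩, hε0, hε1⟩ := ((h4.and h5).and (Ioc_mem_nhdsGT one_pos)).exists
  exact ⟨ε, hε0, hε1, hε5, hε4.le⟩

/-- Only the edge determinants must be nonzero; `φ[F]` itself may be singular. The number `δ` is
fixed before `n` grows, since its powers cancel exactly. -/
theorem exists_expectedCloseVolume_le (hπ : IsUniformlyRandom P π) (hF : IsSubtree F)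
    (hs : ∀ s : S, φ.gramDet (F ∩ of s • F) ≠ 0) {R : ℝ} (hR : gramRatio φ F < R) :
    ∃ ε : ℝ, 0 < ε ∧ ∀ᶠ n in atTop, expectedCloseVolume P π φ F ε n ≤
      2 ^ Fintype.card S * ENNReal.ofReal (R ^ n) := by
  have hd : ∀ s : S, 0 < φ.gramDet (F ∩ of s • F) := fun s => gramDet_pos (hs s)
  set e : ℕ := (F.erase 1).card * k with he
  obtain ⟨κ, hκ0, hκ1, ε, hε0, hε1, hdet, hpar⟩ := exists_parameters_of_gramRatio_lt hs hR e
  obtain ⟨B, hB1, hB⟩ := exists_l2norm_le_of_entryClose (φ.gram F)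
  obtain ⟨M, hM0, hM⟩ := exists_norm_le F
  have hκ1' : 0 < 1 - κ := by linarith
  -- Displacing each vector by at most `M δ` then changes Gram entries by at most `ε / 2`.
  set δ : ℝ := min 1 (ε / (2 * (M * (2 * B + M)) + 1)) with hδ
  have hδ0 : 0 < δ := by positivity
  have hδ1 : δ ≤ 1 := min_le_left _ _
  have hδ2 : δ ≤ ε / (2 * (M * (2 * B + M)) + 1) := min_le_right _ _
  rw [le_div_iff₀ (by positivity)] at hδ2
  have hclose : ε / 2 + M * δ * (2 * B + M * δ) ≤ ε := by
    have h1 : M * δ * (2 * B + M * δ) ≤ M * δ * (2 * B + M * 1) := by gcongr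
    nlinarith
  have hev := fun s : S => measure_nearTransporters_mul_det_le
    ((F ∩ of s • F : Finset (FreeGroup S)) × Fin k) (K₀ := B) (by linarith) hδ0 hκ0
  refine ⟨ε / 2, by positivity, ?_⟩
  filter_upwards [eventually_all.2 hev] with n hn
  set C : S → ℝ≥0∞ := fun s => ENNReal.ofReal (((1 - κ) * φ.gramDet (F ∩ of s • F)) ^ n) with hC
  set A : S → ℝ≥0∞ := fun s => 2 * ENNReal.ofReal (((1 + κ) * δ) ^ (2 * n)) ^
    Fintype.card ((F ∩ of s • F : Finset (FreeGroup S)) × Fin k) with hA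
  have hCpos : ∀ s : S, 0 < (1 - κ) * φ.gramDet (F ∩ of s • F) := fun s => mul_pos hκ1' (hd s)
  have hJ := lintegral_volume_nearConsistent_mul_le (n := n) (δ := δ) hπ (Q := φ.gram F) (ε := ε)
    (c := C) (A := A) (fun s => ENNReal.ofReal_ne_top) fun Y hY s => by
      have := hπ.haar n s
      have := hπ.isProbabilityMeasure_map n s
      -- Besides the numerical bound, this supplies the nonvanishing of the Gram determinant of the
      -- targets that the Haar estimate requires.
      have h1 := hdet s _ (entryClose_edgeTarget hY s)
      refine le_trans ?_ (hn s (P.map fun ω => π n ω (of s)) (edgeSource F s Y)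
        (edgeTarget F s Y) ?_ fun q => hB hε1 hY _)
      · exact mul_le_mul' le_rfl (ENNReal.ofReal_le_ofReal
          (pow_le_pow_left₀ (hCpos s).le h1.le n))
      · intro h0
        rw [h0] at h1
        exact lt_asymm h1 (hCpos s)
  have hAprod : ∏ s, A s = 2 ^ Fintype.card S *
      (ENNReal.ofReal ((1 + κ) ^ (2 * n)) ^ e * ENNReal.ofReal (δ ^ (2 * n)) ^ e) := by
    rw [hA, Finset.prod_mul_distrib, Finset.prod_const, Finset.card_univ,
      Finset.prod_pow_eq_pow_sum, hF.sum_card_edges_mul, ← mul_pow, mul_pow (1 + κ) δ,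
      ENNReal.ofReal_mul (by positivity)]
  have hCprod : ∏ s, C s =
      ENNReal.ofReal ((∏ s : S, ((1 - κ) * φ.gramDet (F ∩ of s • F))) ^ n) := by
    rw [hC, ← Finset.prod_pow, ENNReal.ofReal_prod_of_nonneg fun s _ => (pow_pos (hCpos s) n).le]
  have hCprod0 : 0 < ∏ s : S, ((1 - κ) * φ.gramDet (F ∩ of s • F)) :=
    Finset.prod_pos fun s _ => hCpos s
  rw [hAprod, hCprod] at hJ
  have hE := volume_entryClose_le (n := n) (posSemidef_gram φ F) hε0
  rw [hF.card_prod, pow_add] at hE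
  rw [expectedCloseVolume_eq]
  refine div_le_mul_of_double_count (a := ENNReal.ofReal (δ ^ (2 * n)) ^ e)
    (w := ballVolume n ^ e) (pow_ne_zero _ ?_) (ENNReal.pow_ne_top ENNReal.ofReal_ne_top)
    (pow_ne_zero _ (ballVolume_ne_zero n)) (ENNReal.pow_ne_top (ballVolume_ne_top n)) ?_
    ENNReal.ofReal_ne_top ?_ (hJ.trans (mul_le_mul_right hE _)) ?_
  · exact (ENNReal.ofReal_pos.2 (by positivity)).ne'
  · exact (ENNReal.ofReal_pos.2 (by positivity)).ne'
  · rw [← mul_pow, ← lintegral_mul_const']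
    · exact lintegral_mono fun ω => volume_orbitTuple_mul_le (π n ω) hF hM hδ0
        (fun Y hY => hB (by linarith) hY) hclose
    · exact ENNReal.pow_ne_top (ENNReal.mul_ne_top ENNReal.ofReal_ne_top (ballVolume_ne_top n))
  · rw [hF.card_prod] at hpar
    have hR0 : 0 ≤ R := le_trans (div_nonneg (gramDet_nonneg φ F)
      (Finset.prod_nonneg fun s _ => (hd s).le)) hR.le
    rw [← ENNReal.ofReal_pow (by positivity), ← ENNReal.ofReal_mul (by positivity),
      ← ENNReal.ofReal_mul (by positivity), ← mul_pow]
    have h0 : 0 ≤ (φ.gram F + ((((((F.erase 1).card * k + k : ℕ) : ℝ) + 1) * ε : ℝ) : ℂ) •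
        1).det.re := by
      have : (φ.gram F + ((((((F.erase 1).card * k + k : ℕ) : ℝ) + 1) * ε : ℝ) : ℂ) •
        1).PosDef := Matrix.PosDef.posSemidef_add (posSemidef_gram φ F)
          (Matrix.PosDef.one.smul (by exact_mod_cast (by positivity :
            0 < (((F.erase 1).card * k + k : ℕ) + 1 : ℝ) * ε)))
      exact (re_det_pos this).le
    refine ENNReal.ofReal_le_ofReal ?_
    rw [← pow_mul, mul_right_comm, pow_mul, ← mul_pow]
    exact pow_le_pow_left₀ (mul_nonneg (by positivity) h0) hpar n

theorem exists_le_expectedCloseVolume (hπ : IsUniformlyRandom P π) (hF : IsSubtree F)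
    (h : φ.gramDet F ≠ 0) {R : ℝ} (hR0 : 0 ≤ R) (hR : R < gramRatio φ F) {ε : ℝ} (hε : 0 < ε) :
    ∀ᶠ n in atTop, ENNReal.ofReal (R ^ n) ≤
      2 * 2 ^ Fintype.card S * expectedCloseVolume P π φ F ε n := by
  have hs : ∀ s : S, φ.gramDet (F ∩ of s • F) ≠ 0 := fun s =>
    gramDet_ne_zero_of_subset Finset.inter_subset_left h
  have hd : ∀ s : S, 0 < φ.gramDet (F ∩ of s • F) := fun s => gramDet_pos (hs s)
  have hdp : 0 < ∏ s : S, φ.gramDet (F ∩ of s • F) := Finset.prod_pos fun s _ => hd s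
  have hD : 0 < φ.gramDet F := gramDet_pos h
  rw [gramRatio, lt_div_iff₀ hdp] at hR
  set e : ℕ := (F.erase 1).card * k with he
  obtain ⟨B, hB1, hB⟩ := exists_l2norm_le_of_entryClose (φ.gram F)
  obtain ⟨M, hM0, hM⟩ := exists_norm_le F
  have h1 : Tendsto (fun κ : ℝ => (1 - κ) ^ (2 * e) * φ.gramDet F -
      R * ((1 + κ) ^ e * ∏ s : S, φ.gramDet (F ∩ of s • F))) (𝓝[>] 0)
      (𝓝 ((1 - 0) ^ (2 * e) * φ.gramDet F -
        R * ((1 + 0) ^ e * ∏ s : S, φ.gramDet (F ∩ of s • F)))) :=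
    (Continuous.tendsto (by fun_prop) 0).mono_left nhdsWithin_le_nhds
  have h2 := h1.eventually_const_lt (u := 0) (by simpa using hR)
  obtain ⟨κ, hκ, hκ0, hκ1⟩ := (h2.and (Ioo_mem_nhdsGT one_pos)).exists
  have hκ1' : 0 < 1 - κ := by linarith
  -- The tuples `Y` are taken within `δ²` of `φ[F]`, as the Haar lower bound demands; their roots
  -- must then be within `ε`.
  have h3 : Tendsto (fun δ : ℝ => δ ^ 2 + M * δ * (2 * B + M * δ)) (𝓝[>] 0)
      (𝓝 (0 ^ 2 + M * 0 * (2 * B + M * 0))) :=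
    (Continuous.tendsto (by fun_prop) 0).mono_left nhdsWithin_le_nhds
  have h4 := h3.eventually_lt_const (u := ε) (by simpa using hε)
  have h5 := fun s : S => le_measure_nearTransporters_mul_det
    ((posDef_gram_iff φ (F ∩ of s • F)).2 (hs s)) hκ0 hκ1
  obtain ⟨δ, ⟨hδ4, hδ5⟩, hδ0, hδ1⟩ :=
    ((h4.and (eventually_all.2 h5)).and (Ioc_mem_nhdsGT one_pos)).exists
  filter_upwards [eventually_all.2 hδ5,
    le_volume_entryClose ((posDef_gram_iff φ F).2 h) (pow_pos hδ0 2)] with n hn hE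
  set C : S → ℝ≥0∞ := fun s => 2 * (ENNReal.ofReal (φ.gramDet (F ∩ of s • F) ^ n) *
    ENNReal.ofReal ((1 + κ) ^ (n * Fintype.card
      ((F ∩ of s • F : Finset (FreeGroup S)) × Fin k)))) with hC
  set A : S → ℝ≥0∞ := fun s => ENNReal.ofReal (((1 - κ) * δ) ^ (2 * n)) ^
    Fintype.card ((F ∩ of s • F : Finset (FreeGroup S)) × Fin k) with hA
  have hJ := le_lintegral_volume_nearConsistent_mul (n := n) (δ := δ) hπ (Q := φ.gram F)
    (ε := δ ^ 2) (c := C) (A := A)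
    (fun s => ENNReal.mul_ne_top ENNReal.ofNat_ne_top
      (ENNReal.mul_ne_top ENNReal.ofReal_ne_top ENNReal.ofReal_ne_top)) fun Y hY s => by
      have := hπ.haar n s
      have := hπ.isProbabilityMeasure_map n s
      refine (hn s (P.map fun ω => π n ω (of s)) (edgeSource F s Y)
        (edgeTarget F s Y) (entryClose_edgeSource hY s) (entryClose_edgeTarget hY s)).trans_eq ?_
      simp only [hC, PosDefMap.gramDet]
      ring
  have hAprod : ∏ s, A s =
      ENNReal.ofReal ((1 - κ) ^ (2 * n)) ^ e * ENNReal.ofReal (δ ^ (2 * n)) ^ e := by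
    rw [hA, Finset.prod_pow_eq_pow_sum, hF.sum_card_edges_mul, ← mul_pow, mul_pow (1 - κ) δ,
      ENNReal.ofReal_mul (by positivity)]
  have hCprod : ∏ s, C s = 2 ^ Fintype.card S *
      ENNReal.ofReal (((1 + κ) ^ e * ∏ s : S, φ.gramDet (F ∩ of s • F)) ^ n) := by
    rw [hC, Finset.prod_mul_distrib, Finset.prod_const, Finset.card_univ,
      Finset.prod_mul_distrib, mul_pow ((1 + κ) ^ e), ENNReal.ofReal_mul (by positivity),
      ← ENNReal.ofReal_prod_of_nonneg fun s _ => (pow_pos (hd s) n).le, Finset.prod_pow,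
      ← ENNReal.ofReal_prod_of_nonneg fun s _ => by positivity, Finset.prod_pow_eq_pow_sum,
      ← Finset.mul_sum, hF.sum_card_edges_mul, mul_comm n, pow_mul, mul_comm (ENNReal.ofReal _)]
  rw [hAprod, hCprod] at hJ
  rw [hF.card_prod, pow_add] at hE
  rw [expectedCloseVolume_eq]
  have hCpos : 0 < (1 + κ) ^ e * ∏ s : S, φ.gramDet (F ∩ of s • F) :=
    mul_pos (by positivity) hdp
  refine le_mul_div_of_double_count (a := ENNReal.ofReal (δ ^ (2 * n)) ^ e)
    (w := ballVolume n ^ e) (pow_ne_zero _ ?_) (ENNReal.pow_ne_top ENNReal.ofReal_ne_top)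
    (pow_ne_zero _ (ballVolume_ne_zero n)) (ENNReal.pow_ne_top (ballVolume_ne_top n)) ?_
    ENNReal.ofReal_ne_top (pow_ne_zero _ (ballVolume_ne_zero n))
    (ENNReal.pow_ne_top (ballVolume_ne_top n)) ?_ hJ hE ?_
  · exact (ENNReal.ofReal_pos.2 (by positivity)).ne'
  · exact (ENNReal.ofReal_pos.2 (pow_pos hCpos n)).ne'
  · rw [← mul_pow, ← lintegral_mul_const']
    · exact lintegral_mono fun ω => volume_nearConsistent_le (π n ω) hF hM hδ0
        (fun Y hY => hB (pow_le_one₀ hδ0.le hδ1) hY) hδ4.le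
    · exact ENNReal.pow_ne_top (ENNReal.mul_ne_top ENNReal.ofReal_ne_top (ballVolume_ne_top n))
  · rw [← ENNReal.ofReal_pow (by positivity), ← ENNReal.ofReal_mul (by positivity),
      ← ENNReal.ofReal_mul (by positivity), ← mul_pow]
    refine ENNReal.ofReal_le_ofReal ?_
    rw [← pow_mul (1 - κ), mul_right_comm 2 n e, pow_mul (1 - κ), ← mul_pow]
    exact pow_le_pow_left₀ (mul_nonneg hR0 hCpos.le) (sub_pos.1 hκ).le n

end Growth

/-! ### The weak-star topology on positive definite maps -/

section WeakStar

variable {Γ : Type*} [Group Γ] {k n : ℕ}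

theorem PosDefMap.continuous_eval (g : Γ) (i j : Fin k) :
    Continuous fun ψ : PosDefMap Γ k => ψ g i j := by
  classical
  have hind : Continuous (fun (ψ : PosDefMap Γ k)
      (p : {f : Γ → ℂ // Summable fun g => ‖f g‖} × Fin k × Fin k) =>
        ∑' g, p.1.1 g * ψ g p.2.1 p.2.2) := continuous_induced_dom
  let f : {f : Γ → ℂ // Summable fun g => ‖f g‖} := ⟨Pi.single g 1,
    summable_of_ne_finset_zero (s := {g}) fun h hh => by
      rw [Pi.single_eq_of_ne (by simpa using hh), norm_zero]⟩
  have h1 : Continuous fun ψ : PosDefMap Γ k => ∑' h, f.1 h * ψ h i j :=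
    (continuous_pi_iff.1 hind) (f, i, j)
  refine h1.congr fun ψ => ?_
  rw [tsum_eq_single g fun h hh => by simp [f, Pi.single_eq_of_ne hh]]
  simp [f]

theorem PosDefMap.entryClose_mem_nhds (φ : PosDefMap Γ k) (F : Finset Γ) {ε : ℝ} (hε : 0 < ε) :
    {ψ : PosDefMap Γ k | EntryClose (ψ.gram F) (φ.gram F) ε} ∈ 𝓝 φ := by
  refine eventually_all.2 fun p => eventually_all.2 fun q => ?_
  have h := (((PosDefMap.continuous_eval (k := k) ((p.1 : Γ)⁻¹ * q.1) p.2 q.2).sub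
    continuous_const).norm.tendsto' φ 0 (by simp [PosDefMap.gram]) : Tendsto (fun ψ =>
      ‖ψ ((p.1 : Γ)⁻¹ * q.1) p.2 q.2 - φ.gram F p q‖) (𝓝 φ) (𝓝 0))
  exact h.eventually_lt_const hε

/-- On bounded sets the weak-star topology is the topology of pointwise convergence. -/
theorem PosDefMap.tendsto_of_bounded {α : Type*} {l : Filter α} {ψ : α → PosDefMap Γ k}
    {φ : PosDefMap Γ k} {C : ℝ} (hC : ∀ a g i j, ‖ψ a g i j‖ ≤ C)
    (h : ∀ g i j, Tendsto (fun a => ψ a g i j) l (𝓝 (φ g i j))) : Tendsto ψ l (𝓝 φ) := by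
  have hind : IsInducing (fun (ψ : PosDefMap Γ k)
      (p : {f : Γ → ℂ // Summable fun g => ‖f g‖} × Fin k × Fin k) =>
        ∑' g, p.1.1 g * ψ g p.2.1 p.2.2) := ⟨rfl⟩
  refine hind.tendsto_nhds_iff.2 (tendsto_pi_nhds.2 fun p => ?_)
  refine tendsto_tsum_of_dominated_convergence (bound := fun g => ‖p.1.1 g‖ * C)
    (p.1.2.mul_right C) (fun g => (h g _ _).const_mul _) (Eventually.of_forall fun a g => ?_)
  rw [norm_mul]
  exact mul_le_mul_of_nonneg_left (hC a g _ _) (norm_nonneg _)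

theorem norm_tupleType_le (ρ : Γ →* Matrix.unitaryGroup (Fin n) ℂ) {v : Fin k → Fin n → ℂ}
    {B : ℝ} (hB : ∀ i, l2norm (v i) ≤ B) (g : Γ) (i j : Fin k) :
    ‖tupleType ρ v g i j‖ ≤ B * B := by
  refine (norm_dotProduct_le (v i) ((ρ g : Matrix (Fin n) (Fin n) ℂ).mulVec (v j))).trans ?_
  rw [l2norm_mulVec_unitary]
  exact mul_le_mul (hB i) (hB j) (l2norm_nonneg _) ((l2norm_nonneg _).trans (hB i))

end WeakStar

/-! ### From growth rates to the entropy -/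

section Limits

open FreeGroup (of parent IsSubtree mem_inter_smul norm_parent isSubtree_freeBall mem_freeBall
  freeBall_mono)
open ExpGrowth

theorem gramMat_orbitTuple {S : Type*} {k n : ℕ} (ρ : FreeGroup S →* Matrix.unitaryGroup (Fin n) ℂ)
    (F : Finset (FreeGroup S)) (v : Fin k → Fin n → ℂ) :
    gramMat (orbitTuple ρ F v) = (tupleType ρ v).gram F := by
  ext p q
  exact (matrixElements_inv_mul ρ v p.1 q.1 p.2 q.2).symm

variable {S : Type*} [DecidableEq S] [Fintype S] {k : ℕ}

/-- Types close to `φ` at the identity are uniformly bounded, and on bounded sets weak-star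
convergence is pointwise, so finitely many entries control `O`, uniformly in the dimension and the
representation. -/
theorem eventually_exists_entryClose_subset {φ : PosDefMap (FreeGroup S) k}
    {O : Set (PosDefMap (FreeGroup S) k)} (hO : O ∈ 𝓝 φ) : ∀ᶠ m in atTop, ∃ ε : ℝ, 0 < ε ∧
      ∀ (n : ℕ) (ρ : FreeGroup S →* Matrix.unitaryGroup (Fin n) ℂ) (v : Fin k → Fin n → ℂ),
        EntryClose (gramMat (orbitTuple ρ (freeBall S m) v)) (φ.gram (freeBall S m)) ε →
          v ∈ typicalTuples ρ O := by
  obtain ⟨B, hB1, hB⟩ := exists_l2norm_le_of_entryClose (φ.gram {1})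
  obtain ⟨C₀, hC₀⟩ := φ.bounded
  let good : ℕ → PosDefMap (FreeGroup S) k → Prop := fun m ψ =>
    (∀ g i j, ‖ψ g i j‖ ≤ max C₀ (B * B)) ∧
      EntryClose (ψ.gram (freeBall S m)) (φ.gram (freeBall S m)) (1 / (m + 1))
  -- Choose a counterexample at scale `m` whenever one exists, and `φ` otherwise. The resulting
  -- sequence tends to `φ`, so eventually it lies in `O` and counterexamples cease.
  have hgood : ∀ m, ∃ ψ, good m ψ ∧ ((∃ ψ', good m ψ' ∧ ψ' ∉ O) → ψ ∉ O) := by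
    intro m
    by_cases h : ∃ ψ', good m ψ' ∧ ψ' ∉ O
    · obtain ⟨ψ, h1, h2⟩ := h
      exact ⟨ψ, h1, fun _ => h2⟩
    · refine ⟨φ, ⟨fun g i j => (hC₀ g i j).trans (le_max_left _ _), fun p q => ?_⟩,
        fun h' => absurd h' h⟩
      rw [sub_self, norm_zero]
      positivity
  choose ψ hψ hbad using hgood
  have hlim : Tendsto ψ atTop (𝓝 φ) := by
    refine PosDefMap.tendsto_of_bounded (fun m => (hψ m).1) fun g i j => ?_
    rw [tendsto_iff_norm_sub_tendsto_zero]
    refine squeeze_zero' (Eventually.of_forall fun m => norm_nonneg _) ?_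
      tendsto_one_div_add_atTop_nhds_zero_nat
    filter_upwards [eventually_ge_atTop g.norm] with m hm
    have := (hψ m).2 (⟨1, (isSubtree_freeBall m).1⟩, i) (⟨g, mem_freeBall.2 hm⟩, j)
    simpa [PosDefMap.gram] using this.le
  filter_upwards [hlim hO] with m hm
  refine ⟨1 / (m + 1), by positivity, fun n ρ v hv => ?_⟩
  by_contra hvO
  refine hbad m ⟨tupleType ρ v, ⟨fun g i j => ?_, ?_⟩, hvO⟩ hm
  · refine (norm_tupleType_le ρ (fun i => ?_) g i j).trans (le_max_right _ _)
    have hsub : EntryClose (gramMat (orbitTuple ρ {1} v)) (φ.gram {1}) (1 / (m + 1)) := by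
      intro p q
      have h1 : ∀ x : ({1} : Finset (FreeGroup S)), (x : FreeGroup S) ∈ freeBall S m := fun x => by
        rw [Finset.mem_singleton.1 x.2]; exact (isSubtree_freeBall m).1
      exact hv (⟨p.1, h1 p.1⟩, p.2) (⟨q.1, h1 q.1⟩, q.2)
    have h2 := hB (by
      rw [div_le_one (by positivity)]
      linarith [(Nat.cast_nonneg m : (0 : ℝ) ≤ m)]) hsub (⟨1, Finset.mem_singleton_self 1⟩, i)
    simpa [orbitTuple] using h2
  · rwa [← gramMat_orbitTuple]

theorem log_ofReal_gramRatio_freeBall (φ : PosDefMap (FreeGroup S) k) (n : ℕ) :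
    interTerm φ n = ENNReal.log (ENNReal.ofReal (gramRatio φ (freeBall S n))) := by
  rw [interTerm]
  by_cases h0 : φ.gramDet (freeBall S n) = 0
  · rw [if_pos (Or.inl h0), gramRatio, h0, zero_div, ENNReal.ofReal_zero, ENNReal.log_zero]
  · have hs : ∀ s : S, φ.gramDet (freeBall S n ∩ of s • freeBall S n) ≠ 0 := fun s =>
      gramDet_ne_zero_of_subset Finset.inter_subset_left h0
    have hp : 0 < ∏ s : S, φ.gramDet (freeBall S n ∩ of s • freeBall S n) :=
      Finset.prod_pos fun s _ => gramDet_pos (hs s)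
    rw [if_neg (by push Not; exact ⟨h0, hs⟩), gramRatio,
      ENNReal.log_ofReal_of_pos (div_pos (gramDet_pos h0) hp),
      Real.log_div h0 hp.ne', Real.log_prod fun s _ => hs s]

variable {Ω : Type*} [MeasurableSpace Ω] {P : Measure Ω} [IsProbabilityMeasure P]
  {π : ∀ n : ℕ, Ω → FreeGroup S →* Matrix.unitaryGroup (Fin n) ℂ}
  {φ : PosDefMap (FreeGroup S) k} {F : Finset (FreeGroup S)}

/-- The exponential growth rate of the expected normalized volume of the `O`-typical tuples. -/
noncomputable def typicalGrowth {S : Type*} {k : ℕ} {Ω : Type*} [MeasurableSpace Ω]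
    (P : Measure Ω) (π : ∀ n : ℕ, Ω → FreeGroup S →* Matrix.unitaryGroup (Fin n) ℂ)
    (O : Set (PosDefMap (FreeGroup S) k)) : EReal :=
  expGrowthSup fun n => ∫⁻ ω, volume (typicalTuples (π n ω) O) / ballVolume n ^ k ∂P

theorem annealedEntropy_le_typicalGrowth {S : Type*} {k : ℕ} {Ω : Type*} [MeasurableSpace Ω]
    {P : Measure Ω} {π : ∀ n : ℕ, Ω → FreeGroup S →* Matrix.unitaryGroup (Fin n) ℂ}
    {φ : PosDefMap (FreeGroup S) k} {O : Set (PosDefMap (FreeGroup S) k)} (hO : O ∈ 𝓝 φ) :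
    annealedEntropy P π φ ≤ typicalGrowth P π O := iInf₂_le O hO

theorem continuous_log_ofReal : Continuous fun x : ℝ => ENNReal.log (ENNReal.ofReal x) :=
  ENNReal.continuous_log.comp ENNReal.continuous_ofReal

theorem expGrowthSup_ofReal_pow {R : ℝ} (hR : 0 ≤ R) :
    expGrowthSup (fun n => ENNReal.ofReal (R ^ n)) = ENNReal.log (ENNReal.ofReal R) := by
  simp only [ENNReal.ofReal_pow hR, expGrowthSup_pow]

theorem gramRatio_nonneg (φ : PosDefMap (FreeGroup S) k) (F : Finset (FreeGroup S)) :
    0 ≤ gramRatio φ F :=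
  div_nonneg (gramDet_nonneg φ F) (Finset.prod_nonneg fun _ _ => gramDet_nonneg φ _)

/-- Let `R` decrease to the ratio; the logarithm is continuous into the extended reals, so a zero
ratio gives `-∞`. -/
theorem annealedEntropy_le_log_gramRatio (hπ : IsUniformlyRandom P π) (hF : IsSubtree F)
    (hs : ∀ s : S, φ.gramDet (F ∩ of s • F) ≠ 0) :
    annealedEntropy P π φ ≤ ENNReal.log (ENNReal.ofReal (gramRatio φ F)) := by
  refine ge_of_tendsto (continuous_log_ofReal.continuousWithinAt (s := Set.Ioi (gramRatio φ F))) ?_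
  filter_upwards [self_mem_nhdsWithin] with R hR
  obtain ⟨ε, hε, hle⟩ := exists_expectedCloseVolume_le hπ hF hs hR
  refine (annealedEntropy_le_typicalGrowth (φ.entryClose_mem_nhds F hε)).trans ?_
  rw [← expGrowthSup_ofReal_pow ((gramRatio_nonneg φ F).trans (le_of_lt hR))]
  refine expGrowthSup_le_of_eventually_le (b := 2 ^ Fintype.card S)
    (ENNReal.pow_ne_top ENNReal.ofNat_ne_top) ?_
  filter_upwards [hle] with n hn
  simp only [expectedCloseVolume, gramMat_orbitTuple] at hn
  exact hn

theorem eventually_interTerm_le_typicalGrowth (hπ : IsUniformlyRandom P π)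
    {O : Set (PosDefMap (FreeGroup S) k)} (hO : O ∈ 𝓝 φ) :
    ∀ᶠ m in atTop, interTerm φ m ≤ typicalGrowth P π O := by
  filter_upwards [eventually_exists_entryClose_subset hO] with m ⟨ε, hε, hsub⟩
  rw [log_ofReal_gramRatio_freeBall]
  by_cases h0 : φ.gramDet (freeBall S m) = 0
  · rw [gramRatio, h0, zero_div, ENNReal.ofReal_zero, ENNReal.log_zero]
    exact bot_le
  have hpos : 0 < gramRatio φ (freeBall S m) := div_pos (gramDet_pos h0)
    (Finset.prod_pos fun s _ => gramDet_pos (gramDet_ne_zero_of_subset Finset.inter_subset_left h0))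
  refine le_of_tendsto
    (continuous_log_ofReal.continuousWithinAt (s := Set.Iio (gramRatio φ (freeBall S m)))) ?_
  filter_upwards [Ioo_mem_nhdsLT hpos] with R hR
  have hle := exists_le_expectedCloseVolume hπ (isSubtree_freeBall m) h0 hR.1.le hR.2 hε
  rw [← expGrowthSup_ofReal_pow hR.1.le]
  refine expGrowthSup_le_of_eventually_le (b := 2 * 2 ^ Fintype.card S)
    (ENNReal.mul_ne_top ENNReal.ofNat_ne_top (ENNReal.pow_ne_top ENNReal.ofNat_ne_top)) ?_
  filter_upwards [hle] with n hn
  refine hn.trans (mul_le_mul' le_rfl (lintegral_mono fun ω => ?_))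
  exact ENNReal.div_le_div_right (measure_mono fun v hv => hsub n (π n ω) v hv) _

/-- If all edge determinants are nonzero the upper bound applies. Otherwise remove a leaf: were the
smaller determinant nonzero, every edge set or its translate would lie in the smaller subtree and be
nonsingular. So the smaller subtree is singular too, and induction applies. -/
theorem annealedEntropy_eq_bot_of_gramDet_eq_zero (hπ : IsUniformlyRandom P π)
    (hF : IsSubtree F) (h0 : φ.gramDet F = 0) : annealedEntropy P π φ = ⊥ := by
  induction hN : F.card using Nat.strong_induction_on generalizing F with
  | _ N ih =>
    by_cases hs : ∀ s : S, φ.gramDet (F ∩ of s • F) ≠ 0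
    · have h := annealedEntropy_le_log_gramRatio hπ hF hs
      rw [gramRatio, h0, zero_div, ENNReal.ofReal_zero, ENNReal.log_zero] at h
      exact le_bot_iff.1 h
    · have h1 : F ≠ {1} := by
        rintro rfl
        refine hs fun s => ?_
        -- A single vertex has no edges, and the empty determinant is `1`.
        have he : ({1} ∩ of s • {1} : Finset (FreeGroup S)) = ∅ := by
          ext g
          simp only [mem_inter_smul, Finset.mem_singleton, Finset.notMem_empty, iff_false]
          rintro ⟨rfl, h⟩
          exact FreeGroup.of_ne_one s (by simp at h)
        rw [he, PosDefMap.gramDet, Matrix.det_isEmpty]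
        simp
      obtain ⟨g, hg, hsub, hleaf⟩ := hF.exists_leaf h1
      by_cases h2 : φ.gramDet (F.erase g) = 0
      · exact ih _ (by rw [← hN]; exact Finset.card_erase_lt_of_mem hg) hsub h2 rfl
      · refine absurd (fun s => ?_) hs
        rcases hleaf s with h | h
        · exact gramDet_ne_zero_of_subset h h2
        · rw [← gramDet_smul φ (of s)⁻¹]
          refine gramDet_ne_zero_of_subset (fun x hx => ?_) h2
          obtain ⟨y, hy, rfl⟩ := Finset.mem_smul_finset.1 hx
          exact h y hy

theorem annealedEntropy_le_interTerm (hπ : IsUniformlyRandom P π) (n : ℕ) :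
    annealedEntropy P π φ ≤ interTerm φ n := by
  by_cases h0 : φ.gramDet (freeBall S n) = 0
  · rw [annealedEntropy_eq_bot_of_gramDet_eq_zero hπ (isSubtree_freeBall n) h0]
    exact bot_le
  · rw [log_ofReal_gramRatio_freeBall]
    exact annealedEntropy_le_log_gramRatio hπ (isSubtree_freeBall n) fun s =>
      gramDet_ne_zero_of_subset Finset.inter_subset_left h0

/-- The upper bound holds at every radius; the lower bound holds for each neighbourhood from some
radius on. No monotonicity in the radius is needed. -/
theorem tendsto_interTerm (hπ : IsUniformlyRandom P π) :
    Tendsto (fun n : ℕ => interTerm φ n) atTop (𝓝 (annealedEntropy P π φ)) := by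
  refine tendsto_order.2 ⟨fun a ha => Eventually.of_forall fun n =>
    ha.trans_le (annealedEntropy_le_interTerm hπ n), fun a ha => ?_⟩
  obtain ⟨O, hO⟩ := iInf_lt_iff.1 ha
  obtain ⟨hOφ, hO⟩ := iInf_lt_iff.1 hO
  filter_upwards [eventually_interTerm_le_typicalGrowth hπ hOφ] with n hn
  exact hn.trans_lt hO

end Limits

theorem theoremA {S : Type*} [Fintype S] [DecidableEq S] {k : ℕ}
    {Ω : Type*} [MeasurableSpace Ω] (P : Measure Ω) [IsProbabilityMeasure P]
    (π : ∀ n : ℕ, Ω → FreeGroup S →* Matrix.unitaryGroup (Fin n) ℂ)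
    (hπ : IsUniformlyRandom P π) (φ : PosDefMap (FreeGroup S) k) :
    annealedEntropy P π φ < ⊤ ∧
      Tendsto (fun n : ℕ => interTerm φ n) atTop (𝓝 (annealedEntropy P π φ)) ∧
      Tendsto (fun n : ℕ => unionTerm φ n) atTop (𝓝 (annealedEntropy P π φ)) := by
  have hlim := tendsto_interTerm (φ := φ) hπ
  -- Finiteness from above already follows at radius zero; the union terms are squeezed between the
  -- intersection terms and their shift by one.
  refine ⟨(annealedEntropy_le_interTerm hπ 0).trans_lt ?_, hlim,
    tendsto_of_tendsto_of_tendsto_of_le_of_le (hlim.comp (tendsto_add_atTop_nat 1)) hlim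
      (fun n => interTerm_succ_le_unionTerm φ n) fun n => unionTerm_le_interTerm φ n⟩
  rw [log_ofReal_gramRatio_freeBall]
  exact lt_top_iff_ne_top.2 fun h => ENNReal.ofReal_ne_top (ENNReal.log_eq_top_iff.1 h)
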